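/- Let $G$ be a topological group. A multiplicative ($\mathbb Z$-graded, reduced) $G$-equivariant cohomology theory $\tilde E^*=\bigoplus_{n\in\mathbb Z}\tilde E^n$ is a contravariant functor from pointed $G$-CW complexes to graded-commutative rings (the unreduced rings $E^*Y=\tilde E^*(Y_+)$ having natural units) which is invariant under pointed $G$-homotopy, sends each cofibre sequence $A\to Y\to Y/A$ to an exact sequence, and has a class $e\in\tilde E^1(S^1)$ such that the cross product $x\mapsto e\times x$ is a natural isomorphism $\tilde E^*Y\to\tilde E^{*+1}(S^1\wedge Y)$. Let $E$ be such a theory and let $X$ be a $G$-CW complex that is the union of two subcomplexes $U$ and $V$; put $W=U\cap V$, and write $j_U,j_V$ for the inclusions of $W$ into $U,V$ and $i_U,i_V$ for the inclusions of $U,V$ into $X$. Suppose $E^nU=E^nV=E^nW=0$ for all odd $n$. Let $\delta\colon E^*W\to E^{*+1}X$ be the connecting map of the Mayer–Vietoris sequence, that is, the composite $$E^*W\cong\tilde E^{*+1}(S^1\wedge W_+)\to E^{*+1}X'\cong E^{*+1}X,$$ where $X'=(U\times\{0\})\cup(W\times[0,1])\cup(V\times\{1\})$ is the double mapping cylinder,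 the middle map is induced by collapsing the ends $U\times\{0\}$ and $V\times\{1\}$, and the last isomorphism is the inverse of the one induced by the projection $X'\to X$; this is well defined, i.e. there is exactly one such additive map $\delta$. Then: 1. the map $x\mapsto(i_U^*x,i_V^*x)$ is an isomorphism of graded rings $E^{\mathrm{even}}X\cong E^*U\times_{E^*W}E^*V$; 2. the subgroup $\operatorname{im}j_U^*+\operatorname{im}j_V^*$ of $E^*W$ is an $E^*X$-submodule, where $E^*X$ acts on $E^*W$ through restriction to $W$, and $\delta$ induces an isomorphism of graded $E^*X$-modules $\bigl(E^*W/(\operatorname{im}j_U^*+\operatorname{im}j_V^*)\bigr)[1]\cong E^{\mathrm{odd}}X$, where $[1]$ raises degrees by one; 3. the product of any two elements of $E^{\mathrm{odd}}X$ is zero; 4. $x\cdot\delta w=\delta\bigl(j_U^*i_U^*(x)\cdot w\bigr)$ for all $x\in E^{\mathrm{even}}X$ and $w\in E^*W$. -/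

import Mathlib

open Set Topology

universe u v

/-- The closed unit disk of dimension `n`, as the unit ball of the supremum norm on `ℝⁿ` (a cube). -/
abbrev Disk (n : ℕ) : Type := Metric.closedBall (0 : Fin n → ℝ) 1

/-- The centre of the disk. -/
def Disk.zero (n : ℕ) : Disk n := ⟨0, Metric.mem_closedBall_self zero_le_one⟩

/-- A `G`-CW structure on a `G`-space `X`: equivariant cells `G/H × Dⁿ`, with `H` closed, and
characteristic maps such that `X` is partitioned by the open cells, the boundary of every cell
lies in the union of the open cells of lower dimension, every skeleton carries the pushout
topology, and `X` carries the colimit topology of the skeleta. -/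
structure GCW (G : Type u) [Group G] [TopologicalSpace G]
    (X : Type u) [TopologicalSpace X] [MulAction G X] where
  cell : Type u
  dim : cell → ℕ
  stab : cell → Subgroup G
  isClosed_stab : ∀ i, IsClosed (stab i : Set G)
  char : ∀ i, (G ⧸ stab i) × Disk (dim i) → X
  continuous_char : ∀ i, Continuous (char i)
  char_smul : ∀ (i) (g : G) (c : G ⧸ stab i) (d : Disk (dim i)),
    char i (g • c, d) = g • char i (c, d)
  exists_cell : ∀ x, ∃ (i : cell) (p : (G ⧸ stab i) × Disk (dim i)), ‖p.2.1‖ < 1 ∧ char i p = x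
  cell_unique : ∀ (i j : cell) (p : (G ⧸ stab i) × Disk (dim i))
    (q : (G ⧸ stab j) × Disk (dim j)),
    ‖p.2.1‖ < 1 → ‖q.2.1‖ < 1 → char i p = char j q → i = j
  char_inj : ∀ (i : cell) (p q : (G ⧸ stab i) × Disk (dim i)),
    ‖p.2.1‖ < 1 → ‖q.2.1‖ < 1 → char i p = char i q → p = q
  boundary : ∀ (i : cell) (p : (G ⧸ stab i) × Disk (dim i)), ‖p.2.1‖ = 1 →
    ∃ (j : cell) (q : (G ⧸ stab j) × Disk (dim j)),
      dim j < dim i ∧ ‖q.2.1‖ < 1 ∧ char j q = char i p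
  closed_of_skeleton : ∀ (n : ℕ) (A : Set X),
    (∀ x ∈ A, ∃ (i : cell) (p : (G ⧸ stab i) × Disk (dim i)),
      dim i ≤ n ∧ ‖p.2.1‖ < 1 ∧ char i p = x) →
    (∀ i, dim i ≤ n → IsClosed (char i ⁻¹' A)) → IsClosed A
  closed_of_colimit : ∀ A : Set X,
    (∀ n : ℕ, IsClosed (A ∩ {x | ∃ (i : cell) (p : (G ⧸ stab i) × Disk (dim i)),
      dim i ≤ n ∧ ‖p.2.1‖ < 1 ∧ char i p = x})) → IsClosed A

namespace GCW

section

variable {G : Type u} [Group G] [TopologicalSpace G]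
  {X : Type u} [TopologicalSpace X] [MulAction G X] (K : GCW G X)

/-- The `n`-skeleton. -/
def skel (n : ℕ) : Set X :=
  {x | ∃ (i : K.cell) (p : (G ⧸ K.stab i) × Disk (K.dim i)),
    K.dim i ≤ n ∧ ‖p.2.1‖ < 1 ∧ K.char i p = x}

/-- A subcomplex: a subset containing with any point of an open cell the whole closed cell. -/
def IsSubcomplex (A : Set X) : Prop :=
  ∀ (i : K.cell) (p : (G ⧸ K.stab i) × Disk (K.dim i)), ‖p.2.1‖ < 1 → K.char i p ∈ A →
    ∀ q, K.char i q ∈ A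

theorem norm_lt_or_eq {n : ℕ} (d : Disk n) : ‖d.1‖ < 1 ∨ ‖d.1‖ = 1 :=
  lt_or_eq_of_le (mem_closedBall_zero_iff.1 d.2)

theorem char_mem_skel (i : K.cell) (p : (G ⧸ K.stab i) × Disk (K.dim i)) {n : ℕ}
    (h : K.dim i ≤ n) : K.char i p ∈ K.skel n := by
  rcases norm_lt_or_eq p.2 with h1 | h1
  · exact ⟨i, p, h, h1, rfl⟩
  · obtain ⟨j, q, hj, hq, e⟩ := K.boundary i p h1
    exact ⟨j, q, hj.le.trans h, hq, e⟩

theorem isClosed_inter_skel {A B : Set X} (hA : K.IsSubcomplex A) (hBA : B ⊆ A) (n : ℕ)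
    (h : ∀ i, K.dim i ≤ n → (∀ q, K.char i q ∈ A) → IsClosed (K.char i ⁻¹' B)) :
    IsClosed (B ∩ K.skel n) := by
  induction n using Nat.strong_induction_on with
  | _ n ih =>
    refine K.closed_of_skeleton n _ (fun x hx => hx.2) fun i hi => ?_
    by_cases hiA : ∀ q, K.char i q ∈ A
    · have : K.char i ⁻¹' (B ∩ K.skel n) = K.char i ⁻¹' B := by
        ext p
        simp [K.char_mem_skel i p hi]
      rw [this]
      exact h i hi hiA
    · have hint : ∀ p, K.char i p ∈ B → ‖p.2.1‖ = 1 := fun p hp =>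
        (norm_lt_or_eq p.2).resolve_left fun h1 => hiA (hA i p h1 (hBA hp))
      rcases Nat.eq_zero_or_pos (K.dim i) with h0 | hpos
      · have : K.char i ⁻¹' (B ∩ K.skel n) = ∅ := by
          ext p
          simp only [mem_preimage, mem_inter_iff, mem_empty_iff_false, iff_false, not_and]
          intro hp
          obtain ⟨j, q, hj, -⟩ := K.boundary i p (hint p hp)
          omega
        rw [this]
        exact isClosed_empty
      · have : K.char i ⁻¹' (B ∩ K.skel n) = K.char i ⁻¹' (B ∩ K.skel (K.dim i - 1)) := by
          ext p
          simp only [mem_preimage, mem_inter_iff, and_congr_right_iff]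
          intro hp
          simp only [K.char_mem_skel i p hi, true_iff]
          obtain ⟨j, q, hj, hq, e⟩ := K.boundary i p (hint p hp)
          exact ⟨j, q, by omega, hq, e⟩
        rw [this]
        exact (ih _ (by omega) fun j hj => h j (by omega)).preimage (K.continuous_char i)

theorem isClosed_of_cells {A B : Set X} (hA : K.IsSubcomplex A) (hBA : B ⊆ A)
    (h : ∀ i, (∀ q, K.char i q ∈ A) → IsClosed (K.char i ⁻¹' B)) : IsClosed B :=
  K.closed_of_colimit B fun n => K.isClosed_inter_skel hA hBA n fun i _ => h i

theorem IsSubcomplex.isClosed {A : Set X} (hA : K.IsSubcomplex A) : IsClosed A :=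
  K.isClosed_of_cells hA subset_rfl fun i hi => by
    have : K.char i ⁻¹' A = univ := eq_univ_of_forall hi
    rw [this]
    exact isClosed_univ

variable {K} in
theorem IsSubcomplex.smul_mem {A : Set X} (hA : K.IsSubcomplex A) (g : G) {x : X} (hx : x ∈ A) :
    g • x ∈ A := by
  obtain ⟨i, ⟨c, d⟩, hp, rfl⟩ := K.exists_cell x
  rw [← K.char_smul]
  exact hA i _ hp hx _

variable {K} in
theorem IsSubcomplex.smul_mem_iff {A : Set X} (hA : K.IsSubcomplex A) (g : G) {x : X} :
    g • x ∈ A ↔ x ∈ A :=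
  ⟨fun h => by simpa using hA.smul_mem g⁻¹ h, hA.smul_mem g⟩

theorem isSubcomplex_inter {A B : Set X} (hA : K.IsSubcomplex A) (hB : K.IsSubcomplex B) :
    K.IsSubcomplex (A ∩ B) :=
  fun i p hp h q => ⟨hA i p hp h.1 q, hB i p hp h.2 q⟩

theorem isSubcomplex_skel (n : ℕ) : K.IsSubcomplex (K.skel n) := by
  rintro i p hp ⟨j, q, hj, hq, e⟩ r
  obtain rfl := K.cell_unique _ _ _ _ hq hp e
  exact K.char_mem_skel _ _ hj

/-- The action of `G` on an invariant subset. -/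
@[reducible] def subAction {A : Set X} (hA : K.IsSubcomplex A) : MulAction G A where
  smul g x := ⟨g • x.1, hA.smul_mem g x.2⟩
  one_smul x := Subtype.ext (one_smul G x.1)
  mul_smul g h x := Subtype.ext (mul_smul g h x.1)

/-- The induced `G`-CW structure on a subcomplex. -/
def sub {A : Set X} (hA : K.IsSubcomplex A) : @GCW G _ _ A _ (K.subAction hA) :=
  letI := K.subAction hA
  { cell := {i : K.cell // ∀ q, K.char i q ∈ A}
    dim := fun i => K.dim i.1
    stab := fun i => K.stab i.1
    isClosed_stab := fun i => K.isClosed_stab i.1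
    char := fun i p => ⟨K.char i.1 p, i.2 p⟩
    continuous_char := fun i => (K.continuous_char i.1).subtype_mk _
    char_smul := fun i g c d => Subtype.ext (K.char_smul i.1 g c d)
    exists_cell := by
      rintro ⟨x, hx⟩
      obtain ⟨i, p, hp, rfl⟩ := K.exists_cell x
      exact ⟨⟨i, hA i p hp hx⟩, p, hp, rfl⟩
    cell_unique := fun i j p q hp hq e =>
      Subtype.ext (K.cell_unique i.1 j.1 p q hp hq (congrArg Subtype.val e))
    char_inj := fun i p q hp hq e => K.char_inj i.1 p q hp hq (congrArg Subtype.val e)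
    boundary := by
      rintro ⟨i, hi⟩ p hp
      obtain ⟨j, q, hj, hq, e⟩ := K.boundary i p hp
      exact ⟨⟨j, hA j q hq (e ▸ hi p)⟩, q, hj, hq, Subtype.ext e⟩
    closed_of_skeleton := by
      intro n B hB h
      have h1 : IsClosed ((Subtype.val '' B) ∩ K.skel n) := by
        refine K.isClosed_inter_skel hA (by rintro _ ⟨x, -, rfl⟩; exact x.2) n fun i hi hiA => ?_
        convert h ⟨i, hiA⟩ hi using 1
        ext p
        simp [hiA p]
      have h2 : B = Subtype.val ⁻¹' ((Subtype.val '' B) ∩ K.skel n) := by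
        ext x
        constructor
        · intro hx
          refine ⟨⟨x, hx, rfl⟩, ?_⟩
          obtain ⟨i, p, hi, hp, e⟩ := hB x hx
          exact ⟨i.1, p, hi, hp, congrArg Subtype.val e⟩
        · rintro ⟨⟨y, hy, e⟩, -⟩
          rwa [← Subtype.ext e]
      rw [h2]
      exact h1.preimage continuous_subtype_val
    closed_of_colimit := by
      intro B h
      have h1 : IsClosed (Subtype.val '' B) := by
        refine K.closed_of_colimit _ fun n => ?_
        have := (IsClosed.isClosedEmbedding_subtypeVal hA.isClosed).isClosedMap _ (h n)
        convert this using 1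
        ext x
        constructor
        · rintro ⟨⟨y, hy, rfl⟩, i, p, hi, hp, e⟩
          exact ⟨y, ⟨hy, ⟨i, hA i p hp (e ▸ y.2)⟩, p, hi, hp, Subtype.ext e⟩, rfl⟩
        · rintro ⟨y, ⟨hy, i, p, hi, hp, e⟩, rfl⟩
          exact ⟨⟨y, hy, rfl⟩, i.1, p, hi, hp, congrArg Subtype.val e⟩
      rw [← Set.preimage_image_eq B Subtype.val_injective]
      exact h1.preimage continuous_subtype_val }

theorem norm_disk_zero (d : Disk 0) : ‖d.1‖ < 1 := by
  rw [Subsingleton.elim d.1 0, norm_zero]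
  exact one_pos

/-- The `G`-CW structure on `X` with a disjoint fixed point added. -/
def plus : GCW G (X ⊕ PUnit.{u + 1}) where
  cell := K.cell ⊕ PUnit.{u + 1}
  dim := Sum.elim K.dim fun _ => 0
  stab := Sum.elim K.stab fun _ => ⊤
  isClosed_stab := by
    rintro (i | i)
    · exact K.isClosed_stab i
    · exact isClosed_univ
  char := fun
    | .inl i => fun p => .inl (K.char i p)
    | .inr i => fun _ => .inr i
  continuous_char := by
    rintro (i | i)
    · exact continuous_inl.comp (K.continuous_char i)
    · exact continuous_const
  char_smul := by
    rintro (i | i) g c d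
    · exact congrArg Sum.inl (K.char_smul i g c d)
    · rfl
  exists_cell := by
    rintro (x | x)
    · obtain ⟨i, p, hp, rfl⟩ := K.exists_cell x
      exact ⟨.inl i, p, hp, rfl⟩
    · exact ⟨.inr x, (QuotientGroup.mk 1, Disk.zero 0), norm_disk_zero _, rfl⟩
  cell_unique := by
    rintro (i | i) (j | j) p q hp hq e
    · exact congrArg Sum.inl (K.cell_unique i j p q hp hq (Sum.inl_injective e))
    · exact absurd e Sum.inl_ne_inr
    · exact absurd e Sum.inr_ne_inl
    · rfl
  char_inj := by
    rintro (i | i) p q hp hq e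
    · exact K.char_inj i p q hp hq (Sum.inl_injective e)
    · have := QuotientGroup.subsingleton_quotient_top (G := G)
      exact Prod.ext (Subsingleton.elim (α := G ⧸ (⊤ : Subgroup G)) _ _)
        (Subtype.ext (Subsingleton.elim (α := Fin 0 → ℝ) _ _))
  boundary := by
    rintro (i | i) p hp
    · obtain ⟨j, q, hj, hq, e⟩ := K.boundary i p hp
      exact ⟨.inl j, q, hj, hq, congrArg Sum.inl e⟩
    · exact absurd hp (norm_disk_zero _).ne
  closed_of_skeleton := by
    intro n A hA h
    rw [isClosed_sum_iff]
    refine ⟨K.closed_of_skeleton n _ ?_ fun i hi => h (.inl i) hi, isClosed_discrete _⟩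
    intro x hx
    obtain ⟨i | i, p, hi, hp, e⟩ := hA _ hx
    · exact ⟨i, p, hi, hp, Sum.inl_injective e⟩
    · exact absurd e Sum.inr_ne_inl
  closed_of_colimit := by
    intro A h
    rw [isClosed_sum_iff]
    refine ⟨K.closed_of_colimit _ fun n => ?_, isClosed_discrete _⟩
    convert (h n).preimage continuous_inl using 1
    ext x
    simp only [mem_inter_iff, mem_preimage, and_congr_right_iff, mem_ofPred_eq]
    intro _
    constructor
    · rintro ⟨i, p, hi, hp, rfl⟩
      exact ⟨.inl i, p, hi, hp, rfl⟩
    · rintro ⟨i | i, p, hi, hp, e⟩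
      · exact ⟨i, p, hi, hp, Sum.inl_injective e⟩
      · exact absurd e Sum.inr_ne_inl

theorem isSubcomplex_plus_inr : K.plus.IsSubcomplex {.inr PUnit.unit} := by
  rintro (i | i) p hp h q
  · exact absurd h Sum.inl_ne_inr
  · rfl

/-- The equivalence relation that identifies all points of `A`. -/
def collapse (A : Set X) : Setoid X where
  r x y := x = y ∨ (x ∈ A ∧ y ∈ A)
  iseqv := ⟨fun _ => .inl rfl, fun h => h.elim (fun h => .inl h.symm) fun h => .inr h.symm, by
    rintro x y z (rfl | h) (rfl | h')
    · exact .inl rfl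
    · exact .inr h'
    · exact .inr h
    · exact .inr ⟨h.1, h'.2⟩⟩

/-- The action of `G` on the quotient of `X` by an invariant subset. -/
@[reducible] def quotAction {A : Set X} (hA : K.IsSubcomplex A) :
    MulAction G (Quotient (collapse A)) where
  smul g := Quotient.map (g • ·) fun _ _ h =>
    h.elim (fun h => .inl (congrArg _ h)) fun h => .inr ⟨hA.smul_mem g h.1, hA.smul_mem g h.2⟩
  one_smul := by
    rintro ⟨x⟩
    exact congrArg _ (one_smul G x)
  mul_smul := by
    rintro g h ⟨x⟩
    exact congrArg _ (mul_smul g h x)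

theorem mk_eq_iff {Y : Type u} {A : Set Y} {x y : Y} :
    (Quotient.mk (collapse A) x = Quotient.mk (collapse A) y) ↔ (x = y ∨ (x ∈ A ∧ y ∈ A)) :=
  Quotient.eq

open Classical in
/-- The quotient `G`-CW structure on `X / A` for a non-empty subcomplex `A`. -/
def quot {A : Set X} (hA : K.IsSubcomplex A) {a : X} (ha : a ∈ A) :
    @GCW G _ _ (Quotient (collapse A)) _ (K.quotAction hA) :=
  letI := K.quotAction hA
  { cell := {i : K.cell // ¬ ∀ q, K.char i q ∈ A} ⊕ PUnit.{u + 1}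
    dim := Sum.elim (fun i => K.dim i.1) fun _ => 0
    stab := Sum.elim (fun i => K.stab i.1) fun _ => ⊤
    isClosed_stab := by
      rintro (i | i)
      · exact K.isClosed_stab i.1
      · exact isClosed_univ
    char := fun
      | .inl i => fun p => Quotient.mk _ (K.char i.1 p)
      | .inr i => fun _ => Quotient.mk _ a
    continuous_char := by
      rintro (i | i)
      · exact continuous_quotient_mk'.comp (K.continuous_char i.1)
      · exact continuous_const
    char_smul := by
      rintro (i | i) g c d
      · exact congrArg (Quotient.mk _) (K.char_smul i.1 g c d)
      · exact mk_eq_iff.2 (.inr ⟨ha, hA.smul_mem g ha⟩)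
    exists_cell := by
      rintro ⟨x⟩
      by_cases hx : x ∈ A
      · exact ⟨.inr PUnit.unit, (QuotientGroup.mk 1, Disk.zero 0), norm_disk_zero _,
          mk_eq_iff.2 (.inr ⟨ha, hx⟩)⟩
      · obtain ⟨i, p, hp, rfl⟩ := K.exists_cell x
        exact ⟨.inl ⟨i, fun h => hx (h p)⟩, p, hp, rfl⟩
    cell_unique := by
      have key : ∀ i : {i : K.cell // ¬ ∀ q, K.char i q ∈ A}, ∀ p, ‖p.2.1‖ < 1 →
          K.char i.1 p ∉ A := fun i p hp h => i.2 (hA i.1 p hp h)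
      rintro (i | i) (j | j) p q hp hq e
      · rcases mk_eq_iff.1 e with e | e
        · exact congrArg Sum.inl (Subtype.ext (K.cell_unique i.1 j.1 p q hp hq e))
        · exact absurd e.1 (key i p hp)
      · rcases mk_eq_iff.1 e with e | e
        · exact absurd (e ▸ ha) (key i p hp)
        · exact absurd e.1 (key i p hp)
      · rcases mk_eq_iff.1 e with e | e
        · exact absurd (e ▸ ha) (key j q hq)
        · exact absurd e.2 (key j q hq)
      · rfl
    char_inj := by
      rintro (i | i) p q hp hq e
      · rcases mk_eq_iff.1 e with e | e
        · exact K.char_inj i.1 p q hp hq e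
        · exact absurd (hA i.1 p hp e.1) i.2
      · have := QuotientGroup.subsingleton_quotient_top (G := G)
        exact Prod.ext (Subsingleton.elim (α := G ⧸ (⊤ : Subgroup G)) _ _)
          (Subtype.ext (Subsingleton.elim (α := Fin 0 → ℝ) _ _))
    boundary := by
      rintro (i | i) p hp
      · obtain ⟨j, q, hj, hq, e⟩ := K.boundary i.1 p hp
        by_cases hjA : ∀ q, K.char j q ∈ A
        · exact ⟨.inr PUnit.unit, (QuotientGroup.mk 1, Disk.zero 0), (Nat.zero_le _).trans_lt hj,
            norm_disk_zero _, mk_eq_iff.2 (.inr ⟨ha, e ▸ hjA q⟩)⟩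
        · exact ⟨.inl ⟨j, hjA⟩, q, hj, hq, congrArg (Quotient.mk _) e⟩
      · exact absurd hp (norm_disk_zero _).ne
    closed_of_skeleton := by
      intro n B hB h
      rw [← isQuotientMap_quotient_mk'.isClosed_preimage]
      refine K.closed_of_colimit _ fun m => K.closed_of_skeleton m _ (fun x hx => hx.2) ?_
      have hmem : ∀ x ∈ A, (Quotient.mk (collapse A) x ∈ B ↔ Quotient.mk (collapse A) a ∈ B) :=
        fun x hx => by rw [mk_eq_iff.2 (.inr ⟨hx, ha⟩)]
      have hsub : Quotient.mk (collapse A) ⁻¹' B ⊆ A ∪ K.skel n := by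
        intro x hx
        obtain ⟨i | i, p, hi, hp, e⟩ := hB _ hx
        · rcases mk_eq_iff.1 e with e | e
          · exact .inr ⟨i.1, p, hi, hp, e⟩
          · exact .inl e.2
        · rcases mk_eq_iff.1 e with e | e
          · exact .inl (e ▸ ha)
          · exact .inl e.2
      have hn : IsClosed (Quotient.mk (collapse A) ⁻¹' B ∩ K.skel n) := by
        refine K.closed_of_skeleton n _ (fun x hx => hx.2) fun i hi => ?_
        have h1 : K.char i ⁻¹' (Quotient.mk (collapse A) ⁻¹' B ∩ K.skel n) =
            K.char i ⁻¹' (Quotient.mk (collapse A) ⁻¹' B) := by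
          ext p
          simp [K.char_mem_skel i p hi]
        rw [h1]
        by_cases hiA : ∀ q, K.char i q ∈ A
        · by_cases hb : Quotient.mk (collapse A) a ∈ B
          · convert isClosed_univ
            exact eq_univ_of_forall fun p => (hmem _ (hiA p)).2 hb
          · convert isClosed_empty
            exact eq_empty_of_forall_notMem fun p hp => hb ((hmem _ (hiA p)).1 hp)
        · exact h (.inl ⟨i, hiA⟩) hi
      have hall : IsClosed (Quotient.mk (collapse A) ⁻¹' B) := by
        by_cases hb : Quotient.mk (collapse A) a ∈ B
        · convert hA.isClosed.union hn using 1
          ext x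
          constructor
          · intro hx
            exact (hsub hx).imp id fun h => ⟨hx, h⟩
          · rintro (hx | hx)
            · exact (hmem x hx).2 hb
            · exact hx.1
        · convert hn using 1
          ext x
          constructor
          · intro hx
            exact ⟨hx, (hsub hx).resolve_left fun h => hb ((hmem x h).1 hx)⟩
          · exact fun hx => hx.1
      exact fun i _ => (hall.inter (K.isSubcomplex_skel m).isClosed).preimage (K.continuous_char i)
    closed_of_colimit := by
      intro B h
      rw [← isQuotientMap_quotient_mk'.isClosed_preimage]
      refine K.closed_of_colimit _ fun n => ?_
      have h1 := ((h n).preimage (continuous_quotient_mk' (s := collapse A))).inter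
        (K.isSubcomplex_skel n).isClosed
      convert h1 using 1
      ext x
      constructor
      · rintro ⟨hx, i, p, hi, hp, rfl⟩
        refine ⟨⟨hx, ?_⟩, ⟨i, p, hi, hp, rfl⟩⟩
        by_cases hiA : ∀ q, K.char i q ∈ A
        · exact ⟨.inr PUnit.unit, (QuotientGroup.mk 1, Disk.zero 0), Nat.zero_le _,
            norm_disk_zero _, mk_eq_iff.2 (.inr ⟨ha, hiA p⟩)⟩
        · exact ⟨.inl ⟨i, hiA⟩, p, hi, hp, rfl⟩
      · rintro ⟨⟨hx, -⟩, hx'⟩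
        exact ⟨hx, hx'⟩ }

theorem isSubcomplex_quot {A : Set X} (hA : K.IsSubcomplex A) {a : X} (ha : a ∈ A) :
    @IsSubcomplex G _ _ _ _ (K.quotAction hA) (K.quot hA ha) {Quotient.mk _ a} := by
  rintro (i | i) p hp h q
  · rcases mk_eq_iff.1 h with e | e
    · exact absurd (hA i.1 p hp (e ▸ ha)) i.2
    · exact absurd (hA i.1 p hp e.1) i.2
  · rfl


end

end GCW

/-- A finite CW structure on a compact Hausdorff space `K` (without group action). -/
structure FinCW (K : Type) [TopologicalSpace K] where
  cell : Type
  finite_cell : Finite cell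
  dim : cell → ℕ
  char : ∀ i, Disk (dim i) → K
  continuous_char : ∀ i, Continuous (char i)
  exists_cell : ∀ x, ∃ (i : cell) (d : Disk (dim i)), ‖d.1‖ < 1 ∧ char i d = x
  cell_unique : ∀ (i j : cell) (d : Disk (dim i)) (e : Disk (dim j)),
    ‖d.1‖ < 1 → ‖e.1‖ < 1 → char i d = char j e → i = j
  char_inj : ∀ (i : cell) (d e : Disk (dim i)), ‖d.1‖ < 1 → ‖e.1‖ < 1 →
    char i d = char i e → d = e
  boundary : ∀ (i : cell) (d : Disk (dim i)), ‖d.1‖ = 1 →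
    ∃ (j : cell) (e : Disk (dim j)), dim j < dim i ∧ ‖e.1‖ < 1 ∧ char j e = char i d

/-- The space `K` (in any universe), with the trivial action of every group. -/
def Triv (K : Type) : Type u := ULift.{u} K

namespace Triv

variable {K : Type} [TopologicalSpace K]

instance : TopologicalSpace (Triv.{u} K) := inferInstanceAs (TopologicalSpace (ULift.{u} K))

/-- A point of `K` as a point of `Triv K`. -/
def mk {K : Type} (k : K) : Triv.{u} K := ULift.up k

/-- A point of `Triv K` as a point of `K`. -/
def val {K : Type} (k : Triv.{u} K) : K := ULift.down k

theorem continuous_mk : Continuous (mk : K → Triv.{u} K) := continuous_uliftUp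

theorem continuous_val : Continuous (val : Triv.{u} K → K) := continuous_uliftDown

instance {K : Type} {G : Type u} [Group G] : MulAction G (Triv.{u} K) where
  smul _ k := k
  one_smul _ := rfl
  mul_smul _ _ _ := rfl

instance {G : Type u} [Group G] : ContinuousConstSMul G (Triv.{u} K) :=
  ⟨fun _ => continuous_id⟩

end Triv

/-- The first factor of `D^(m+n) = D^m × D^n`. -/
def Disk.fst {m n : ℕ} (d : Disk (m + n)) : Disk m :=
  ⟨fun a => d.1 (Fin.castAdd n a), mem_closedBall_zero_iff.2 <|
    (pi_norm_le_iff_of_nonneg zero_le_one).2 fun _ =>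
      (norm_le_pi_norm d.1 _).trans (mem_closedBall_zero_iff.1 d.2)⟩

/-- The second factor of `D^(m+n) = D^m × D^n`. -/
def Disk.snd {m n : ℕ} (d : Disk (m + n)) : Disk n :=
  ⟨fun a => d.1 (Fin.natAdd m a), mem_closedBall_zero_iff.2 <|
    (pi_norm_le_iff_of_nonneg zero_le_one).2 fun _ =>
      (norm_le_pi_norm d.1 _).trans (mem_closedBall_zero_iff.1 d.2)⟩

/-- The point of `D^(m+n) = D^m × D^n` with the given components. -/
def Disk.pair {m n : ℕ} (d : Disk m) (e : Disk n) : Disk (m + n) :=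
  ⟨Fin.append d.1 e.1, mem_closedBall_zero_iff.2 <|
    (pi_norm_le_iff_of_nonneg zero_le_one).2 fun a => by
      refine Fin.addCases (fun a => ?_) (fun a => ?_) a
      · rw [Fin.append_left]
        exact (norm_le_pi_norm d.1 _).trans (mem_closedBall_zero_iff.1 d.2)
      · rw [Fin.append_right]
        exact (norm_le_pi_norm e.1 _).trans (mem_closedBall_zero_iff.1 e.2)⟩

theorem Disk.fst_pair {m n : ℕ} (d : Disk m) (e : Disk n) : (d.pair e).fst = d :=
  Subtype.ext (funext fun a => Fin.append_left d.1 e.1 a)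

theorem Disk.snd_pair {m n : ℕ} (d : Disk m) (e : Disk n) : (d.pair e).snd = e :=
  Subtype.ext (funext fun a => Fin.append_right d.1 e.1 a)

theorem Disk.pair_fst_snd {m n : ℕ} (d : Disk (m + n)) : d.fst.pair d.snd = d :=
  Subtype.ext (Fin.append_castAdd_natAdd)

theorem Disk.norm_lt_iff {m n : ℕ} (d : Disk (m + n)) :
    ‖d.1‖ < 1 ↔ ‖d.fst.1‖ < 1 ∧ ‖d.snd.1‖ < 1 := by
  simp only [pi_norm_lt_iff one_pos]
  exact ⟨fun h => ⟨fun a => h _, fun a => h _⟩, fun h a => Fin.addCases h.1 h.2 a⟩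

theorem Disk.norm_pair_lt {m n : ℕ} {d : Disk m} {e : Disk n} (hd : ‖d.1‖ < 1) (he : ‖e.1‖ < 1) :
    ‖(d.pair e).1‖ < 1 := by
  rw [Disk.norm_lt_iff, Disk.fst_pair, Disk.snd_pair]
  exact ⟨hd, he⟩

theorem Disk.continuous_fst {m n : ℕ} : Continuous (Disk.fst : Disk (m + n) → Disk m) :=
  continuous_induced_rng.2 (continuous_pi fun a =>
    (continuous_apply (Fin.castAdd n a)).comp continuous_subtype_val)

theorem Disk.continuous_snd {m n : ℕ} : Continuous (Disk.snd : Disk (m + n) → Disk n) :=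
  continuous_induced_rng.2 (continuous_pi fun a =>
    (continuous_apply (Fin.natAdd m a)).comp continuous_subtype_val)

theorem Disk.continuous_pair {m n : ℕ} :
    Continuous fun p : Disk m × Disk n => p.1.pair p.2 := by
  refine Continuous.subtype_mk (continuous_pi fun a => ?_) _
  refine Fin.addCases (fun a => ?_) (fun a => ?_) a
  · simp only [Fin.append_left]
    exact (continuous_apply a).comp (continuous_subtype_val.comp _root_.continuous_fst)
  · simp only [Fin.append_right]
    exact (continuous_apply a).comp (continuous_subtype_val.comp _root_.continuous_snd)

namespace GCW

section

variable {G : Type u} [Group G] [TopologicalSpace G]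
  {X : Type u} [TopologicalSpace X] [MulAction G X]
  {K : Type} [TopologicalSpace K]

/-- A finite CW complex as a `G`-CW complex with trivial action. -/
def triv [CompactSpace K] [T2Space K] (L : FinCW K) : GCW G (Triv.{u} K) := by
  have hclosed : ∀ A : Set (Triv.{u} K),
      (∀ x ∈ A, ∃ (i : L.cell) (d : Disk (L.dim i)), L.char i d = x.val ∧
        IsClosed ((fun e : Disk (L.dim i) => Triv.mk (L.char i e)) ⁻¹' A)) → IsClosed A := by
    intro A hA
    have := L.finite_cell
    have : A = ⋃ i : {i : L.cell //
        IsClosed ((fun e : Disk (L.dim i) => Triv.mk.{u} (L.char i e)) ⁻¹' A)},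
        Triv.val ⁻¹' (L.char i.1 '' ((fun e => Triv.mk (L.char i.1 e)) ⁻¹' A)) := by
      ext x
      simp only [mem_iUnion, mem_preimage, mem_image]
      constructor
      · intro hx
        obtain ⟨i, d, e, h⟩ := hA x hx
        exact ⟨⟨i, h⟩, d, by rw [e]; exact hx, e⟩
      · rintro ⟨i, d, h, e⟩
        rw [e] at h
        exact h
    rw [this]
    exact isClosed_iUnion_of_finite fun i =>
      ((i.2.isCompact.image (L.continuous_char i.1)).isClosed).preimage Triv.continuous_val
  exact
  { cell := ULift.{u} L.cell
    dim := fun i => L.dim i.down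
    stab := fun _ => ⊤
    isClosed_stab := fun _ => isClosed_univ
    char := fun i p => Triv.mk (L.char i.down p.2)
    continuous_char := fun i =>
      Triv.continuous_mk.comp ((L.continuous_char i.down).comp continuous_snd)
    char_smul := fun _ _ _ _ => rfl
    exists_cell := fun x => by
      obtain ⟨i, d, hd, e⟩ := L.exists_cell x.val
      exact ⟨⟨i⟩, (QuotientGroup.mk 1, d), hd, congrArg Triv.mk e⟩
    cell_unique := fun i j p q hp hq e =>
      ULift.ext _ _ (L.cell_unique i.down j.down p.2 q.2 hp hq (congrArg Triv.val e))
    char_inj := fun i p q hp hq e => by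
      have := QuotientGroup.subsingleton_quotient_top (G := G)
      exact Prod.ext (Subsingleton.elim (α := G ⧸ (⊤ : Subgroup G)) _ _)
        (L.char_inj i.down p.2 q.2 hp hq (congrArg Triv.val e))
    boundary := fun i p hp => by
      obtain ⟨j, e, hj, he, h⟩ := L.boundary i.down p.2 hp
      exact ⟨⟨j⟩, (QuotientGroup.mk 1, e), hj, he, congrArg Triv.mk h⟩
    closed_of_skeleton := fun n A hA h => hclosed A fun x hx => by
      obtain ⟨i, p, hi, hp, e⟩ := hA x hx
      exact ⟨i.down, p.2, congrArg Triv.val e,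
        (h i hi).preimage (Continuous.prodMk_right (QuotientGroup.mk 1 : G ⧸ (⊤ : Subgroup G)))⟩
    closed_of_colimit := fun A h => hclosed A fun x hx => by
      obtain ⟨i, d, hd, e⟩ := L.exists_cell x.val
      refine ⟨i, d, e, ?_⟩
      convert (h (L.dim i)).preimage (Triv.continuous_mk.comp (L.continuous_char i)) using 1
      ext d'
      simp only [mem_preimage, Function.comp_apply, mem_inter_iff, mem_ofPred_eq]
      refine ⟨fun h' => ⟨h', ?_⟩, fun h' => h'.1⟩
      rcases norm_lt_or_eq d' with h1 | h1
      · exact ⟨⟨i⟩, (QuotientGroup.mk 1, d'), le_rfl, h1, rfl⟩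
      · obtain ⟨j, e', hj, he, h2⟩ := L.boundary i d' h1
        exact ⟨⟨j⟩, (QuotientGroup.mk 1, e'), hj.le, he, congrArg Triv.mk h2⟩ }

/-- The product of a locally compact space with the skeleton of a `G`-CW complex has the
topology determined by the cells. -/
theorem isClosed_prod_skel (J : GCW G X) {D : Type*} [TopologicalSpace D] [LocallyCompactSpace D]
    (n : ℕ) (C : Set (D × X)) (hC : ∀ y ∈ C, y.2 ∈ J.skel n)
    (h : ∀ i, J.dim i ≤ n → IsClosed {y : D × ((G ⧸ J.stab i) × Disk (J.dim i)) |
      (y.1, J.char i y.2) ∈ C}) : IsClosed C := by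
  let f : (Σ i : {i : J.cell // J.dim i ≤ n}, (G ⧸ J.stab i.1) × Disk (J.dim i.1)) → J.skel n :=
    fun s => ⟨J.char s.1.1 s.2, J.char_mem_skel _ _ s.1.2⟩
  have hf : IsQuotientMap f := by
    rw [isQuotientMap_iff_isClosed]
    refine ⟨?_, fun A => ⟨fun hA => hA.preimage ?_, fun hA => ?_⟩⟩
    · rintro ⟨_, i, p, hi, hp, rfl⟩
      exact ⟨⟨⟨i, hi⟩, p⟩, rfl⟩
    · exact continuous_sigma fun i => (J.continuous_char i.1).subtype_mk _
    · have h1 : IsClosed (Subtype.val '' A) := by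
        refine J.closed_of_skeleton n _ ?_ fun i hi => ?_
        · rintro _ ⟨x, -, rfl⟩
          exact x.2
        · have h2 := (isClosed_sigma_iff.1 hA) ⟨i, hi⟩
          convert h2 using 1
          ext p
          constructor
          · rintro ⟨y, hy, e⟩
            have : y = f ⟨⟨i, hi⟩, p⟩ := Subtype.ext e
            rw [this] at hy
            exact hy
          · exact fun hp => ⟨_, hp, rfl⟩
      rw [← Set.preimage_image_eq A Subtype.val_injective]
      exact h1.preimage continuous_subtype_val
  have hcont : Continuous fun y : D × J.skel n => (y.1, y.2.1) ∉ C := by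
    refine hf.continuous_lift_prod_right ?_
    rw [continuous_Prop]
    let e : D × (Σ i : {i : J.cell // J.dim i ≤ n}, (G ⧸ J.stab i.1) × Disk (J.dim i.1)) ≃ₜ
        Σ i : {i : J.cell // J.dim i ≤ n}, ((G ⧸ J.stab i.1) × Disk (J.dim i.1)) × D :=
      (Homeomorph.prodComm _ _).trans Homeomorph.sigmaProdDistrib
    rw [← e.symm.isOpen_preimage, isOpen_sigma_iff]
    intro i
    exact (h i.1 i.2).isOpen_compl.preimage continuous_swap
  have h3 : IsClosed {y : D × J.skel n | (y.1, y.2.1) ∈ C} := by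
    have := (continuous_Prop.1 hcont).isClosed_compl
    convert this using 1
    ext y
    simp
  have h4 : IsClosedEmbedding fun y : D × J.skel n => (y.1, y.2.1) :=
    (IsClosedEmbedding.id).prodMap ((J.isSubcomplex_skel n).isClosed.isClosedEmbedding_subtypeVal)
  convert h4.isClosedMap _ h3 using 1
  ext ⟨d, x⟩
  constructor
  · exact fun hy => ⟨(d, ⟨x, hC _ hy⟩), hy, rfl⟩
  · rintro ⟨y, hy, e⟩
    exact e ▸ hy

theorem isClosed_prod (J : GCW G X) {D : Type*} [TopologicalSpace D] [LocallyCompactSpace D]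
    (C : Set (D × X))
    (h : ∀ i, IsClosed {y : D × ((G ⧸ J.stab i) × Disk (J.dim i)) |
      (y.1, J.char i y.2) ∈ C}) : IsClosed C := by
  let f : (Σ i : J.cell, (G ⧸ J.stab i) × Disk (J.dim i)) → X := fun s => J.char s.1 s.2
  have hf : IsQuotientMap f := by
    rw [isQuotientMap_iff_isClosed]
    refine ⟨?_, fun A => ⟨fun hA => hA.preimage ?_, fun hA => ?_⟩⟩
    · intro x
      obtain ⟨i, p, hp, rfl⟩ := J.exists_cell x
      exact ⟨⟨i, p⟩, rfl⟩
    · exact continuous_sigma fun i => J.continuous_char i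
    · exact J.isClosed_of_cells (A := univ) (fun _ _ _ _ _ => mem_univ _) (subset_univ _)
        fun i _ => (isClosed_sigma_iff.1 hA) i
  have hcont : Continuous fun y : D × X => y ∉ C := by
    refine hf.continuous_lift_prod_right ?_
    rw [continuous_Prop]
    let e : D × (Σ i : J.cell, (G ⧸ J.stab i) × Disk (J.dim i)) ≃ₜ
        Σ i : J.cell, ((G ⧸ J.stab i) × Disk (J.dim i)) × D :=
      (Homeomorph.prodComm _ _).trans Homeomorph.sigmaProdDistrib
    rw [← e.symm.isOpen_preimage, isOpen_sigma_iff]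
    intro i
    exact (h i).isOpen_compl.preimage continuous_swap
  have := (continuous_Prop.1 hcont).isClosed_compl
  convert this using 1
  ext y
  simp

/-- The product of a finite CW complex with a `G`-CW complex. -/
def prod [CompactSpace K] [T2Space K] (L : FinCW K) (J : GCW G X) : GCW G (Triv.{u} K × X) := by
  let f : ∀ i : L.cell, Disk (L.dim i) × X → Triv.{u} K × X :=
    fun i y => (Triv.mk (L.char i y.1), y.2)
  have hf : ∀ i, IsClosedMap (f i) := by
    intro i
    have h1 : IsProperMap fun y : Disk (L.dim i) × X => (L.char i y.1, y.2) :=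
      (L.continuous_char i).isProperMap.prodMap (isProperMap_id)
    have h2 : IsClosedMap fun y : K × X => ((Triv.mk.{u} y.1, y.2) : Triv.{u} K × X) :=
      ((Homeomorph.ulift.{u} (X := K)).symm.prodCongr (Homeomorph.refl X)).isClosedMap
    exact h2.comp h1.isClosedMap
  have hcell : ∀ (i : L.cell) (j : J.cell) (B : Set (Triv.{u} K × X)),
      IsClosed {p : (G ⧸ J.stab j) × Disk (L.dim i + J.dim j) |
        (Triv.mk (L.char i p.2.fst), J.char j (p.1, p.2.snd)) ∈ B} →
      IsClosed {y : Disk (L.dim i) × ((G ⧸ J.stab j) × Disk (J.dim j)) |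
        f i (y.1, J.char j y.2) ∈ B} := by
    intro i j B h
    have h1 : Continuous fun y : Disk (L.dim i) × ((G ⧸ J.stab j) × Disk (J.dim j)) =>
        (y.2.1, y.1.pair y.2.2) :=
      (continuous_fst.comp continuous_snd).prodMk
        (Disk.continuous_pair.comp (continuous_fst.prodMk (continuous_snd.comp continuous_snd)))
    convert h.preimage h1 using 1
    ext y
    simp [f, Disk.fst_pair, Disk.snd_pair]
  have := L.finite_cell
  exact
  { cell := L.cell × J.cell
    dim := fun i => L.dim i.1 + J.dim i.2
    stab := fun i => J.stab i.2
    isClosed_stab := fun i => J.isClosed_stab i.2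
    char := fun i p => (Triv.mk (L.char i.1 p.2.fst), J.char i.2 (p.1, p.2.snd))
    continuous_char := fun i =>
      (Triv.continuous_mk.comp ((L.continuous_char i.1).comp
        (Disk.continuous_fst.comp continuous_snd))).prodMk
      ((J.continuous_char i.2).comp
        (continuous_fst.prodMk (Disk.continuous_snd.comp continuous_snd)))
    char_smul := fun i g c d => Prod.ext rfl (J.char_smul i.2 g c d.snd)
    exists_cell := by
      rintro ⟨k, x⟩
      obtain ⟨i, d, hd, e⟩ := L.exists_cell k.val
      obtain ⟨j, p, hp, rfl⟩ := J.exists_cell x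
      refine ⟨(i, j), (p.1, d.pair p.2), Disk.norm_pair_lt hd hp, ?_⟩
      simp only [Disk.fst_pair, Disk.snd_pair, e]
      rfl
    cell_unique := fun i j p q hp hq e =>
      Prod.ext
        (L.cell_unique _ _ _ _ ((Disk.norm_lt_iff _).1 hp).1 ((Disk.norm_lt_iff _).1 hq).1
          (congrArg (fun y => y.1.val) e))
        (J.cell_unique _ _ (p.1, p.2.snd) (q.1, q.2.snd) ((Disk.norm_lt_iff _).1 hp).2
          ((Disk.norm_lt_iff _).1 hq).2 (congrArg Prod.snd e))
    char_inj := fun i p q hp hq e => by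
      have h1 := L.char_inj _ _ _ ((Disk.norm_lt_iff _).1 hp).1 ((Disk.norm_lt_iff _).1 hq).1
          (congrArg (fun y => y.1.val) e)
      have h2 := J.char_inj _ (p.1, p.2.snd) (q.1, q.2.snd) ((Disk.norm_lt_iff _).1 hp).2
          ((Disk.norm_lt_iff _).1 hq).2 (congrArg Prod.snd e)
      obtain ⟨h3, h4⟩ := Prod.ext_iff.1 h2
      refine Prod.ext h3 ?_
      rw [← Disk.pair_fst_snd p.2, ← Disk.pair_fst_snd q.2, h1]
      exact congrArg _ h4
    boundary := by
      rintro ⟨i, j⟩ p hp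
      have hlow1 : ∃ (i' : L.cell) (e : Disk (L.dim i')), (L.dim i' < L.dim i ∨
          L.dim i' = L.dim i ∧ ‖p.2.fst.1‖ < 1) ∧ ‖e.1‖ < 1 ∧
          L.char i' e = L.char i p.2.fst := by
        rcases norm_lt_or_eq p.2.fst with h | h
        · exact ⟨i, _, .inr ⟨rfl, h⟩, h, rfl⟩
        · obtain ⟨i', e, h1, h2⟩ := L.boundary i _ h
          exact ⟨i', e, .inl h1, h2⟩
      have hlow2 : ∃ (j' : J.cell) (q : (G ⧸ J.stab j') × Disk (J.dim j')), (J.dim j' < J.dim j ∨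
          J.dim j' = J.dim j ∧ ‖p.2.snd.1‖ < 1) ∧ ‖q.2.1‖ < 1 ∧
          J.char j' q = J.char j (p.1, p.2.snd) := by
        rcases norm_lt_or_eq p.2.snd with h | h
        · exact ⟨j, (p.1, p.2.snd), .inr ⟨rfl, h⟩, h, rfl⟩
        · obtain ⟨j', q, h1, h2⟩ := J.boundary j (p.1, p.2.snd) h
          exact ⟨j', q, .inl h1, h2⟩
      obtain ⟨i', e, hi, he, h1⟩ := hlow1
      obtain ⟨j', q, hj, hq, h2⟩ := hlow2
      refine ⟨(i', j'), (q.1, e.pair q.2), ?_, Disk.norm_pair_lt he hq, ?_⟩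
      · have : ¬ (‖p.2.fst.1‖ < 1 ∧ ‖p.2.snd.1‖ < 1) := fun h =>
          hp.not_lt ((Disk.norm_lt_iff _).2 h)
        show L.dim i' + J.dim j' < L.dim i + J.dim j
        rcases hi with hi | hi <;> rcases hj with hj | hj
        · omega
        · omega
        · omega
        · exact absurd ⟨hi.2, hj.2⟩ this
      · simp only [Disk.fst_pair, Disk.snd_pair, h1]
        exact Prod.ext rfl h2
    closed_of_skeleton := by
      intro n B hB h
      have hB' : B = ⋃ i : {i : L.cell // L.dim i ≤ n},
          f i.1 '' (f i.1 ⁻¹' B ∩ {y | y.2 ∈ J.skel (n - L.dim i.1)}) := by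
        ext y
        simp only [mem_iUnion, mem_image]
        constructor
        · intro hy
          obtain ⟨⟨i, j⟩, p, hi, hp, rfl⟩ := hB y hy
          change L.dim i + J.dim j ≤ n at hi
          exact ⟨⟨i, by omega⟩, (p.2.fst, _), ⟨hy, J.char_mem_skel j (p.1, p.2.snd)
            (by change J.dim j ≤ n - L.dim i; omega)⟩, rfl⟩
        · rintro ⟨i, z, hz, rfl⟩
          exact hz.1
      rw [hB']
      refine isClosed_iUnion_of_finite fun i => hf _ _ ?_
      refine J.isClosed_prod_skel (n - L.dim i.1) _ (fun y hy => hy.2) fun j hj => ?_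
      have hi := i.2
      convert hcell i.1 j B (h (i.1, j) (show L.dim i.1 + J.dim j ≤ n by omega)) using 1
      ext y
      exact ⟨fun hy => hy.1, fun hy => ⟨hy, J.char_mem_skel j _ hj⟩⟩
    closed_of_colimit := by
      intro B h
      have hB' : B = ⋃ i : L.cell, f i '' (f i ⁻¹' B) := by
        ext y
        simp only [mem_iUnion, mem_image]
        constructor
        · intro hy
          obtain ⟨i, d, hd, e⟩ := L.exists_cell y.1.val
          have : f i (d, y.2) = y := Prod.ext (congrArg Triv.mk e) rfl
          exact ⟨i, (d, y.2), by rwa [mem_preimage, this], this⟩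
        · rintro ⟨i, z, hz, rfl⟩
          exact hz
      rw [hB']
      refine isClosed_iUnion_of_finite fun i => hf _ _ (J.isClosed_prod _ fun j => hcell i j B ?_)
      have hc : Continuous fun p : (G ⧸ J.stab j) × Disk (L.dim i + J.dim j) =>
          ((Triv.mk (L.char i p.2.fst), J.char j (p.1, p.2.snd)) : Triv.{u} K × X) :=
        (Triv.continuous_mk.comp ((L.continuous_char i).comp
          (Disk.continuous_fst.comp continuous_snd))).prodMk
        ((J.continuous_char j).comp
          (continuous_fst.prodMk (Disk.continuous_snd.comp continuous_snd)))
      convert (h (L.dim i + J.dim j)).preimage hc using 1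
      ext p
      simp only [mem_preimage, mem_inter_iff, mem_ofPred_eq]
      refine ⟨fun h' => ⟨h', ?_⟩, fun h' => h'.1⟩
      have hlow1 : ∃ (i' : L.cell) (e : Disk (L.dim i')), L.dim i' ≤ L.dim i ∧ ‖e.1‖ < 1 ∧
          L.char i' e = L.char i p.2.fst := by
        rcases norm_lt_or_eq p.2.fst with h | h
        · exact ⟨i, _, le_rfl, h, rfl⟩
        · obtain ⟨i', e, h1, h2⟩ := L.boundary i _ h
          exact ⟨i', e, h1.le, h2⟩
      obtain ⟨i', e, hi, he, h1⟩ := hlow1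
      obtain ⟨j', q, hj, hq, h2⟩ := J.char_mem_skel j (p.1, p.2.snd) le_rfl
      refine ⟨(i', j'), (q.1, e.pair q.2), add_le_add hi hj, Disk.norm_pair_lt he hq, ?_⟩
      simp only [Disk.fst_pair, Disk.snd_pair, h1]
      exact Prod.ext rfl h2 }

end

end GCW

theorem Disk.norm_one (d : Disk 1) : ‖d.1‖ = |d.1 0| := by
  rw [← Real.norm_eq_abs]
  refine le_antisymm ((pi_norm_le_iff_of_nonneg (norm_nonneg _)).2 fun a => ?_)
    (norm_le_pi_norm d.1 0)
  rw [Subsingleton.elim a 0]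

theorem Disk.ext_zero (d e : Disk 0) : d = e :=
  Subtype.ext (Subsingleton.elim _ _)

theorem Disk.ext_one {d e : Disk 1} (h : d.1 0 = e.1 0) : d = e :=
  Subtype.ext (funext fun a => by rw [Subsingleton.elim a 0, h])

/-- The affine homeomorphism from the one-dimensional disk `[-1, 1]` to `[0, 1]`. -/
noncomputable def Disk.toIcc (d : Disk 1) : unitInterval :=
  ⟨(d.1 0 + 1) / 2, by
    have h : |d.1 0| ≤ 1 := by
      rw [← Disk.norm_one]
      exact mem_closedBall_zero_iff.1 d.2
    rw [abs_le] at h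
    constructor <;> linarith⟩

theorem Disk.continuous_toIcc : Continuous Disk.toIcc :=
  continuous_induced_rng.2 ((((continuous_apply 0).comp continuous_subtype_val).add
    continuous_const).div_const 2)

theorem Disk.toIcc_inj {d e : Disk 1} (h : d.toIcc = e.toIcc) : d = e := by
  have := congrArg Subtype.val h
  simp only [Disk.toIcc] at this
  exact Disk.ext_one (by linarith)

theorem Disk.toIcc_lt {d : Disk 1} (h : ‖d.1‖ < 1) :
    0 < (d.toIcc : ℝ) ∧ (d.toIcc : ℝ) < 1 := by
  rw [Disk.norm_one, abs_lt] at h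
  simp only [Disk.toIcc]
  constructor <;> linarith

theorem Disk.toIcc_eq {d : Disk 1} (h : ‖d.1‖ = 1) : d.toIcc = 0 ∨ d.toIcc = 1 := by
  rw [Disk.norm_one, abs_eq zero_le_one] at h
  rcases h with h | h
  · exact .inr (Subtype.ext (by simp [Disk.toIcc, h]))
  · exact .inl (Subtype.ext (by simp [Disk.toIcc, h]))

theorem Disk.exists_toIcc (t : unitInterval) (h0 : t ≠ 0) (h1 : t ≠ 1) :
    ∃ d : Disk 1, ‖d.1‖ < 1 ∧ d.toIcc = t := by
  have h0' : 0 < (t : ℝ) := unitInterval.pos_iff_ne_zero.2 h0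
  have h1' : (t : ℝ) < 1 := unitInterval.lt_one_iff_ne_one.2 h1
  have habs : |2 * (t : ℝ) - 1| < 1 := by
    rw [abs_lt]
    constructor <;> linarith
  have hmem : (fun _ => 2 * (t : ℝ) - 1 : Fin 1 → ℝ) ∈ Metric.closedBall (0 : Fin 1 → ℝ) 1 :=
    mem_closedBall_zero_iff.2 ((pi_norm_le_iff_of_nonneg zero_le_one).2 fun _ => habs.le)
  refine ⟨⟨_, hmem⟩, ?_, Subtype.ext ?_⟩
  · rw [Disk.norm_one]
    exact habs
  · simp only [Disk.toIcc]
    ring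

/-- The CW structure on `[0, 1]` with two vertices (`some false` at `0` and `some true` at `1`)
and one edge `none`. -/
noncomputable def FinCW.interval : FinCW unitInterval where
  cell := Option Bool
  finite_cell := inferInstance
  dim := fun
    | none => 1
    | some _ => 0
  char := fun
    | none => Disk.toIcc
    | some false => fun _ => 0
    | some true => fun _ => 1
  continuous_char := by
    rintro (_ | _ | _)
    · exact Disk.continuous_toIcc
    · exact continuous_const
    · exact continuous_const
  exists_cell := by
    intro t
    by_cases h0 : t = 0
    · exact ⟨some false, Disk.zero 0, GCW.norm_disk_zero _, h0.symm⟩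
    by_cases h1 : t = 1
    · exact ⟨some true, Disk.zero 0, GCW.norm_disk_zero _, h1.symm⟩
    obtain ⟨d, hd, e⟩ := Disk.exists_toIcc t h0 h1
    exact ⟨none, d, hd, e⟩
  cell_unique := by
    have h0 : ∀ d : Disk 1, ‖d.1‖ < 1 → d.toIcc ≠ 0 := fun d hd h => by
      have := (Disk.toIcc_lt hd).1
      simp [h] at this
    have h1 : ∀ d : Disk 1, ‖d.1‖ < 1 → d.toIcc ≠ 1 := fun d hd h => by
      have := (Disk.toIcc_lt hd).2
      simp [h] at this
    rintro (_ | _ | _) (_ | _ | _) d e hd he h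
    · rfl
    · exact absurd h (h0 d hd)
    · exact absurd h (h1 d hd)
    · exact absurd h.symm (h0 e he)
    · rfl
    · exact absurd h zero_ne_one
    · exact absurd h.symm (h1 e he)
    · exact absurd h one_ne_zero
    · rfl
  char_inj := by
    rintro (_ | _ | _) d e hd he h
    · exact Disk.toIcc_inj h
    · exact Disk.ext_zero d e
    · exact Disk.ext_zero d e
  boundary := by
    rintro (_ | _ | _) d hd
    · rcases Disk.toIcc_eq hd with h | h
      · exact ⟨some false, Disk.zero 0, zero_lt_one, GCW.norm_disk_zero _, h.symm⟩
      · exact ⟨some true, Disk.zero 0, zero_lt_one, GCW.norm_disk_zero _, h.symm⟩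
    · exact absurd hd (GCW.norm_disk_zero d).ne
    · exact absurd hd (GCW.norm_disk_zero d).ne

theorem coe_circle_eq {s t : ℝ} (hs : 0 ≤ s ∧ s < 1) (ht : 0 ≤ t ∧ t < 1)
    (h : (s : UnitAddCircle) = t) : s = t :=
  (AddCircle.coe_eq_coe_iff_of_mem_Ico (p := (1 : ℝ)) (a := 0)
    ⟨hs.1, by simpa using hs.2⟩ ⟨ht.1, by simpa using ht.2⟩).1 h

/-- The CW structure on the circle `ℝ / ℤ = [0, 1] / (0 ~ 1)` with one vertex `false` at `0` and
one edge `true`. -/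
noncomputable def FinCW.circle : FinCW UnitAddCircle where
  cell := Bool
  finite_cell := inferInstance
  dim := fun
    | true => 1
    | false => 0
  char := fun
    | true => fun d => ((d.toIcc : ℝ) : UnitAddCircle)
    | false => fun _ => 0
  continuous_char := by
    rintro (_ | _)
    · exact continuous_const
    · exact (AddCircle.continuous_mk' 1).comp (continuous_subtype_val.comp Disk.continuous_toIcc)
  exists_cell := by
    intro x
    obtain ⟨t, ht, rfl⟩ := (AddCircle.coe_image_Ico_eq (1 : ℝ) 0).ge (mem_univ x)
    rw [zero_add] at ht
    by_cases h0 : t = 0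
    · exact ⟨false, Disk.zero 0, GCW.norm_disk_zero _, by rw [h0]; rfl⟩
    obtain ⟨d, hd, e⟩ := Disk.exists_toIcc ⟨t, ht.1, ht.2.le⟩
      (fun h => h0 (congrArg Subtype.val h)) (fun h => ht.2.ne (congrArg Subtype.val h))
    exact ⟨true, d, hd, by simp only [e]⟩
  cell_unique := by
    have h0 : ∀ d : Disk 1, ‖d.1‖ < 1 → ((d.toIcc : ℝ) : UnitAddCircle) ≠ 0 := fun d hd h => by
      have h1 := Disk.toIcc_lt hd
      exact h1.1.ne' (coe_circle_eq ⟨h1.1.le, h1.2⟩ ⟨le_rfl, one_pos⟩ h)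
    rintro (_ | _) (_ | _) d e hd he h
    · rfl
    · exact absurd h.symm (h0 e he)
    · exact absurd h (h0 d hd)
    · rfl
  char_inj := by
    rintro (_ | _) d e hd he h
    · exact Disk.ext_zero d e
    · have h1 := Disk.toIcc_lt hd
      have h2 := Disk.toIcc_lt he
      exact Disk.toIcc_inj (Subtype.ext (coe_circle_eq ⟨h1.1.le, h1.2⟩ ⟨h2.1.le, h2.2⟩ h))
  boundary := by
    rintro (_ | _) d hd
    · exact absurd hd (GCW.norm_disk_zero d).ne
    · refine ⟨false, Disk.zero 0, zero_lt_one, GCW.norm_disk_zero _, ?_⟩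
      rcases Disk.toIcc_eq hd with h | h
      · simp [h]
      · simp only [h]
        exact (AddCircle.coe_period (1 : ℝ)).symm

/-- A `G`-CW complex. The elements of `G` act by homeomorphisms; joint continuity of the action
holds on every equivariant cell, and hence on `X` in the category of compactly generated spaces,
and in the category of all spaces if `G` is locally compact. -/
structure GCWSpace (G : Type u) [Group G] [TopologicalSpace G] where
  carrier : Type u
  [top : TopologicalSpace carrier]
  [act : MulAction G carrier]
  [cont : ContinuousConstSMul G carrier]
  cw : GCW G carrier

attribute [instance] GCWSpace.top GCWSpace.act GCWSpace.cont

/-- A pointed `G`-CW complex: the base point is a subcomplex, that is, a `G`-fixed vertex. -/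
structure PtGCW (G : Type u) [Group G] [TopologicalSpace G] extends GCWSpace G where
  pt : carrier
  isSubcomplex_pt : cw.IsSubcomplex {pt}

/-- A `G`-map. -/
structure GMap {G : Type u} [Group G] [TopologicalSpace G] (X Y : GCWSpace G) where
  toFun : X.carrier → Y.carrier
  continuous_toFun : Continuous toFun
  map_smul : ∀ (g : G) (x : X.carrier), toFun (g • x) = g • toFun x

/-- A pointed `G`-map. -/
structure PtGMap {G : Type u} [Group G] [TopologicalSpace G] (X Y : PtGCW G)
    extends GMap X.toGCWSpace Y.toGCWSpace where
  map_pt : toFun X.pt = Y.pt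

section

variable {G : Type u} [Group G] [TopologicalSpace G]

namespace PtGMap

/-- The identity. -/
def id (X : PtGCW G) : PtGMap X X := ⟨⟨fun x => x, continuous_id, fun _ _ => rfl⟩, rfl⟩

/-- The composition `g ∘ f`. -/
def comp {X Y Z : PtGCW G} (g : PtGMap Y Z) (f : PtGMap X Y) : PtGMap X Z :=
  ⟨⟨fun x => g.toFun (f.toFun x), g.continuous_toFun.comp f.continuous_toFun, fun a x => by
    rw [f.map_smul, g.map_smul]⟩, (congrArg g.toFun f.map_pt).trans g.map_pt⟩

/-- Pointed `G`-homotopy. -/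
def Homotopic {X Y : PtGCW G} (f g : PtGMap X Y) : Prop :=
  ∃ H : unitInterval × X.carrier → Y.carrier, Continuous H ∧
    (∀ (t : unitInterval) (a : G) (x : X.carrier), H (t, a • x) = a • H (t, x)) ∧
    (∀ t, H (t, X.pt) = Y.pt) ∧ (∀ x, H (0, x) = f.toFun x) ∧ ∀ x, H (1, x) = g.toFun x

end PtGMap

namespace GCWSpace

/-- A subcomplex as a `G`-CW complex. -/
def sub (X : GCWSpace G) (A : Set X.carrier) (hA : X.cw.IsSubcomplex A) : GCWSpace G :=
  letI := X.cw.subAction hA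
  { carrier := A
    cont := ⟨fun g => ((continuous_const_smul g).comp continuous_subtype_val).subtype_mk _⟩
    cw := X.cw.sub hA }

/-- The inclusion of a subcomplex. -/
def incl (X : GCWSpace G) (A : Set X.carrier) (hA : X.cw.IsSubcomplex A) :
    GMap (X.sub A hA) X :=
  ⟨Subtype.val, continuous_subtype_val, fun _ _ => rfl⟩

/-- The inclusion of a subcomplex in a larger one. -/
def inclusion (X : GCWSpace G) {A B : Set X.carrier} (hA : X.cw.IsSubcomplex A)
    (hB : X.cw.IsSubcomplex B) (h : A ⊆ B) : GMap (X.sub A hA) (X.sub B hB) :=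
  ⟨Set.inclusion h, continuous_inclusion h, fun _ _ => rfl⟩

/-- The pointed complex `X₊`, that is, `X` with a disjoint base point. -/
def plus (X : GCWSpace G) : PtGCW G where
  carrier := X.carrier ⊕ PUnit.{u + 1}
  cont := ⟨fun g => by
    refine continuous_sum_dom.2 ⟨?_, ?_⟩
    · exact (continuous_inl (Y := PUnit.{u + 1})).comp (continuous_const_smul (T := X.carrier) g)
    · exact (continuous_inr (X := X.carrier) (Y := PUnit.{u + 1})).comp continuous_id⟩
  cw := X.cw.plus
  pt := .inr PUnit.unit
  isSubcomplex_pt := X.cw.isSubcomplex_plus_inr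

/-- The product of a finite CW complex (with trivial action) with a `G`-CW complex. -/
def prod {K : Type} [TopologicalSpace K] [CompactSpace K] [T2Space K] (L : FinCW K)
    (X : GCWSpace G) : GCWSpace G where
  carrier := Triv.{u} K × X.carrier
  cw := X.cw.prod L

end GCWSpace

/-- The map `X₊ → Y₊` induced by `X → Y`. -/
def GMap.plus {X Y : GCWSpace G} (f : GMap X Y) : PtGMap X.plus Y.plus :=
  ⟨⟨Sum.map f.toFun fun x => x, f.continuous_toFun.sumMap continuous_id, by
    rintro g (x | x)
    · exact congrArg Sum.inl (f.map_smul g x)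
    · rfl⟩, rfl⟩

namespace PtGCW

/-- A subcomplex containing the base point, as a pointed `G`-CW complex. -/
def sub (X : PtGCW G) (A : Set X.carrier) (hA : X.cw.IsSubcomplex A) (hpt : X.pt ∈ A) :
    PtGCW G where
  toGCWSpace := X.toGCWSpace.sub A hA
  pt := ⟨X.pt, hpt⟩
  isSubcomplex_pt := fun i p hp h q =>
    Subtype.ext (X.isSubcomplex_pt i.1 p hp (congrArg Subtype.val h) q)

/-- The inclusion of a subcomplex containing the base point. -/
def incl (X : PtGCW G) (A : Set X.carrier) (hA : X.cw.IsSubcomplex A) (hpt : X.pt ∈ A) :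
    PtGMap (X.sub A hA hpt) X :=
  ⟨X.toGCWSpace.incl A hA, rfl⟩

/-- The quotient `X / A` by a subcomplex containing the base point. -/
def quot (X : PtGCW G) (A : Set X.carrier) (hA : X.cw.IsSubcomplex A) (hpt : X.pt ∈ A) :
    PtGCW G :=
  letI := X.cw.quotAction hA
  { carrier := Quotient (GCW.collapse A)
    cont := ⟨fun g => continuous_quot_lift _
      (continuous_quotient_mk'.comp (continuous_const_smul g))⟩
    cw := X.cw.quot hA hpt
    pt := Quotient.mk _ X.pt
    isSubcomplex_pt := X.cw.isSubcomplex_quot hA hpt }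

/-- The projection `X → X / A`. -/
def proj (X : PtGCW G) (A : Set X.carrier) (hA : X.cw.IsSubcomplex A) (hpt : X.pt ∈ A) :
    PtGMap X (X.quot A hA hpt) :=
  ⟨⟨Quotient.mk _, continuous_quotient_mk', fun _ _ => rfl⟩, rfl⟩

variable (G) in
/-- The circle `S¹ = [0, 1] / (0 ~ 1)` with trivial action, pointed at `0`. -/
noncomputable def circle : PtGCW G where
  carrier := Triv.{u} UnitAddCircle
  cw := GCW.triv FinCW.circle
  pt := Triv.mk 0
  isSubcomplex_pt := by
    rintro ⟨_ | _⟩ p hp h q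
    · rfl
    · exact absurd (FinCW.circle.cell_unique true false p.2 (Disk.zero 0) hp
        (GCW.norm_disk_zero _) (congrArg Triv.val h)) (fun hb => Bool.noConfusion hb)

/-- The part `S¹ ∨ X` of `S¹ × X`. -/
def wedgeSet (X : PtGCW G) : Set (Triv.{u} UnitAddCircle × X.carrier) :=
  {p | p.1 = Triv.mk 0 ∨ p.2 = X.pt}

theorem isSubcomplex_wedgeSet (X : PtGCW G) :
    (X.cw.prod FinCW.circle).IsSubcomplex X.wedgeSet := by
  rintro ⟨a, b⟩ p hp h q
  have hp' := (Disk.norm_lt_iff p.2).1 hp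
  rcases h with h | h
  · cases a
    · exact .inl rfl
    · exact absurd (FinCW.circle.cell_unique true false p.2.fst (Disk.zero 0) hp'.1
        (GCW.norm_disk_zero _) (congrArg Triv.val h)) (fun hb => Bool.noConfusion hb)
  · exact .inr (X.isSubcomplex_pt b (p.1, p.2.snd) hp'.2 h (q.1, q.2.snd))

/-- The product `S¹ × X`. -/
noncomputable def circleProd (X : PtGCW G) : PtGCW G where
  toGCWSpace := X.toGCWSpace.prod FinCW.circle
  pt := (Triv.mk 0, X.pt)
  isSubcomplex_pt := by
    rintro ⟨a, b⟩ p hp h q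
    have hp' := (Disk.norm_lt_iff p.2).1 hp
    have h1 := X.isSubcomplex_pt b (p.1, p.2.snd) hp'.2 (congrArg Prod.snd h) (q.1, q.2.snd)
    cases a
    · exact Prod.ext rfl h1
    · exact absurd (FinCW.circle.cell_unique true false p.2.fst (Disk.zero 0) hp'.1
        (GCW.norm_disk_zero _) (congrArg (fun y => y.1.val) h)) (fun hb => Bool.noConfusion hb)

/-- The projection `S¹ × X → S¹`. -/
noncomputable def fstMap (X : PtGCW G) : PtGMap X.circleProd (circle G) :=
  ⟨⟨Prod.fst, continuous_fst, fun _ _ => rfl⟩, rfl⟩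

/-- The projection `S¹ × X → X`. -/
noncomputable def sndMap (X : PtGCW G) : PtGMap X.circleProd X :=
  ⟨⟨Prod.snd, continuous_snd, fun _ _ => rfl⟩, rfl⟩

/-- The reduced suspension `ΣX = S¹ ∧ X = (S¹ × X) / (S¹ ∨ X)`. -/
noncomputable def susp (X : PtGCW G) : PtGCW G :=
  X.circleProd.quot X.wedgeSet X.isSubcomplex_wedgeSet (.inl rfl)

/-- The projection `S¹ × X → S¹ ∧ X`. -/
noncomputable def toSusp (X : PtGCW G) : PtGMap X.circleProd X.susp :=
  X.circleProd.proj X.wedgeSet X.isSubcomplex_wedgeSet (.inl rfl)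

end PtGCW

/-- The map `Σf`. -/
noncomputable def PtGMap.susp {X Y : PtGCW G} (f : PtGMap X Y) : PtGMap X.susp Y.susp :=
  ⟨⟨Quotient.map (fun p => (p.1, f.toFun p.2)) (by
      rintro p q (rfl | ⟨hp, hq⟩)
      · exact .inl rfl
      · exact .inr ⟨hp.imp (fun h => h) fun h => (congrArg f.toFun h).trans f.map_pt,
          hq.imp (fun h => h) fun h => (congrArg f.toFun h).trans f.map_pt⟩),
    continuous_quot_lift _ (continuous_quotient_mk'.comp
      (continuous_fst.prodMk (f.continuous_toFun.comp continuous_snd))), by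
    rintro g ⟨p⟩
    exact congrArg (Quotient.mk _) (Prod.ext rfl (f.map_smul g p.2))⟩,
    congrArg (Quotient.mk _) (Prod.ext rfl f.map_pt)⟩

end

/-- A multiplicative (`ℤ`-graded) reduced `G`-equivariant cohomology theory: a contravariant
homotopy functor from pointed `G`-CW complexes to graded-commutative rings (without unit in
general; the unreduced cohomology `E X = Ẽ X₊` has a natural unit) that is exact on cofibre
sequences `A → X → X / A`, with a class `e ∈ Ẽ¹ S¹` such that `x ↦ e × x` is a natural
isomorphism `Ẽ X → Ẽ (S¹ ∧ X)` of degree one. The cross product `e × x` is the class on `S¹ ∧ X`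
whose pullback to `S¹ × X` is the cup product of the pullbacks of `e` and `x`. -/
structure MultCohomology (G : Type u) [Group G] [TopologicalSpace G] where
  carrier : PtGCW G → Type v
  [ring : ∀ X, NonUnitalRing (carrier X)]
  gr : ∀ X, ℤ → AddSubgroup (carrier X)
  isInternal : ∀ X, DirectSum.IsInternal (gr X)
  mul_mem : ∀ X (m n : ℤ) (x y : carrier X), x ∈ gr X m → y ∈ gr X n → x * y ∈ gr X (m + n)
  graded_comm : ∀ X (m n : ℤ) (x y : carrier X), x ∈ gr X m → y ∈ gr X n →
    x * y = ((m * n).negOnePow : ℤ) • (y * x)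
  map : ∀ {X Y : PtGCW G}, PtGMap X Y → carrier Y →ₙ+* carrier X
  map_mem : ∀ {X Y : PtGCW G} (f : PtGMap X Y) (n : ℤ) (y : carrier Y),
    y ∈ gr Y n → map f y ∈ gr X n
  map_id : ∀ X (x : carrier X), map (PtGMap.id X) x = x
  map_comp : ∀ {X Y Z : PtGCW G} (g : PtGMap Y Z) (f : PtGMap X Y) (z : carrier Z),
    map (g.comp f) z = map f (map g z)
  map_homotopic : ∀ {X Y : PtGCW G} (f g : PtGMap X Y), f.Homotopic g → map f = map g
  exact : ∀ (X : PtGCW G) (A : Set X.carrier) (hA : X.cw.IsSubcomplex A) (hpt : X.pt ∈ A)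
    (x : carrier X), map (X.incl A hA hpt) x = 0 ↔ ∃ y, map (X.proj A hA hpt) y = x
  one : ∀ X : GCWSpace G, carrier X.plus
  one_mem : ∀ X : GCWSpace G, one X ∈ gr X.plus 0
  one_mul : ∀ (X : GCWSpace G) (x : carrier X.plus), one X * x = x
  map_one : ∀ {X Y : GCWSpace G} (f : GMap X Y), map f.plus (one Y) = one X
  e : carrier (PtGCW.circle G)
  e_mem : e ∈ gr (PtGCW.circle G) 1
  susp : ∀ X, carrier X ≃+ carrier X.susp
  susp_mem : ∀ X (n : ℤ) (x : carrier X), x ∈ gr X n → susp X x ∈ gr X.susp (n + 1)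
  susp_natural : ∀ {X Y : PtGCW G} (f : PtGMap X Y) (y : carrier Y),
    susp X (map f y) = map f.susp (susp Y y)
  susp_eq : ∀ X (x : carrier X), map X.toSusp (susp X x) = map X.fstMap e * map X.sndMap x

attribute [instance] MultCohomology.ring

/-- A triad `(X; U, V)`: a `G`-CW complex that is the union of two subcomplexes. -/
structure GCWTriad (G : Type u) [Group G] [TopologicalSpace G] where
  X : GCWSpace G
  U : Set X.carrier
  V : Set X.carrier
  hU : X.cw.IsSubcomplex U
  hV : X.cw.IsSubcomplex V
  union_eq : U ∪ V = univ

namespace GCWTriad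

variable {G : Type u} [Group G] [TopologicalSpace G] (T : GCWTriad G)

/-- `U` as a `G`-CW complex. -/
def spU : GCWSpace G := T.X.sub T.U T.hU

/-- `V` as a `G`-CW complex. -/
def spV : GCWSpace G := T.X.sub T.V T.hV

theorem hW : T.X.cw.IsSubcomplex (T.U ∩ T.V) := T.X.cw.isSubcomplex_inter T.hU T.hV

/-- `W = U ∩ V` as a `G`-CW complex. -/
def spW : GCWSpace G := T.X.sub (T.U ∩ T.V) T.hW

/-- The inclusion `U → X`. -/
def iU : GMap T.spU T.X := T.X.incl T.U T.hU

/-- The inclusion `V → X`. -/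
def iV : GMap T.spV T.X := T.X.incl T.V T.hV

/-- The inclusion `W → U`. -/
def jU : GMap T.spW T.spU := T.X.inclusion T.hW T.hU inter_subset_left

/-- The inclusion `W → V`. -/
def jV : GMap T.spW T.spV := T.X.inclusion T.hW T.hV inter_subset_right

/-- The double mapping cylinder `(U × {0}) ∪ (W × [0, 1]) ∪ (V × {1})`, as a subset of
`[0, 1] × X`. -/
def cylSet : Set (Triv.{u} unitInterval × T.X.carrier) :=
  {p | (p.1 = Triv.mk 0 ∧ p.2 ∈ T.U) ∨ p.2 ∈ T.U ∩ T.V ∨ (p.1 = Triv.mk 1 ∧ p.2 ∈ T.V)}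

theorem isSubcomplex_cylSet : (T.X.cw.prod FinCW.interval).IsSubcomplex T.cylSet := by
  rintro ⟨a, b⟩ p hp h q
  have hp' := (Disk.norm_lt_iff p.2).1 hp
  rcases h with ⟨h, hx⟩ | hx | ⟨h, hx⟩
  · have ha := FinCW.interval.cell_unique a (some false) p.2.fst (Disk.zero 0) hp'.1
      (GCW.norm_disk_zero _) (congrArg Triv.val h)
    subst ha
    exact .inl ⟨rfl, T.hU b (p.1, p.2.snd) hp'.2 hx (q.1, q.2.snd)⟩
  · exact .inr (.inl (T.hW b (p.1, p.2.snd) hp'.2 hx (q.1, q.2.snd)))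
  · have ha := FinCW.interval.cell_unique a (some true) p.2.fst (Disk.zero 0) hp'.1
      (GCW.norm_disk_zero _) (congrArg Triv.val h)
    subst ha
    exact .inr (.inr ⟨rfl, T.hV b (p.1, p.2.snd) hp'.2 hx (q.1, q.2.snd)⟩)

/-- The double mapping cylinder `X'` of the inclusions of `W` in `U` and `V`. -/
noncomputable def cyl : GCWSpace G := (T.X.prod FinCW.interval).sub T.cylSet T.isSubcomplex_cylSet

/-- The coordinate in `[0, 1]` of a point of `X'`. -/
noncomputable def cylCoord (p : T.cyl.carrier) : unitInterval := p.1.1.val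

/-- The image in `X` of a point of `X'`. -/
noncomputable def cylPt (p : T.cyl.carrier) : T.X.carrier := p.1.2

theorem continuous_cylCoord : Continuous T.cylCoord :=
  Triv.continuous_val.comp (continuous_fst.comp continuous_subtype_val)

theorem continuous_cylPt : Continuous T.cylPt := continuous_snd.comp continuous_subtype_val

theorem cylPt_smul (g : G) (p : T.cyl.carrier) : T.cylPt (g • p) = g • T.cylPt p := rfl

theorem cylCoord_smul (g : G) (p : T.cyl.carrier) : T.cylCoord (g • p) = T.cylCoord p := rfl

theorem cyl_cases (p : T.cyl.carrier) : (T.cylCoord p = 0 ∧ T.cylPt p ∈ T.U) ∨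
    T.cylPt p ∈ T.U ∩ T.V ∨ (T.cylCoord p = 1 ∧ T.cylPt p ∈ T.V) :=
  p.2.imp (fun h => ⟨congrArg Triv.val h.1, h.2⟩)
    (Or.imp (fun h => h) fun h => ⟨congrArg Triv.val h.1, h.2⟩)

/-- The map `X' → X` that collapses the direction of the interval. -/
noncomputable def cylToX : GMap T.cyl T.X := ⟨T.cylPt, T.continuous_cylPt, T.cylPt_smul⟩

/-- The point `[t, w]` of `ΣW₊`. -/
noncomputable def suspMk (t : unitInterval) (w : T.spW.carrier) : T.spW.plus.susp.carrier :=
  T.spW.plus.toSusp.toFun (Triv.mk ((t : ℝ) : UnitAddCircle), .inl w)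

theorem suspMk_zero (w : T.spW.carrier) : T.suspMk 0 w = T.spW.plus.susp.pt :=
  GCW.mk_eq_iff.2 (.inr ⟨.inl rfl, .inl rfl⟩)

theorem suspMk_one (w : T.spW.carrier) : T.suspMk 1 w = T.spW.plus.susp.pt :=
  GCW.mk_eq_iff.2 (.inr ⟨.inl (congrArg Triv.mk (AddCircle.coe_period (1 : ℝ))), .inl rfl⟩)

theorem suspMk_smul (g : G) (t : unitInterval) (w : T.spW.carrier) :
    T.suspMk t (g • w) = g • T.suspMk t w := rfl

theorem continuous_suspMk : Continuous fun y : unitInterval × T.spW.carrier =>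
    T.suspMk y.1 y.2 :=
  T.spW.plus.toSusp.continuous_toFun.comp
    ((Triv.continuous_mk.comp ((AddCircle.continuous_mk' 1).comp
      (continuous_subtype_val.comp continuous_fst))).prodMk (continuous_inl.comp continuous_snd))

open Classical in
/-- The map of sets `X' → ΣW₊`, `(t, w) ↦ [t, w]`, that collapses both ends `U` and `V`. -/
noncomputable def pinchFun (p : T.cyl.carrier) : T.spW.plus.susp.carrier :=
  if h : T.cylPt p ∈ T.U ∩ T.V then T.suspMk (T.cylCoord p) ⟨T.cylPt p, h⟩
  else T.spW.plus.susp.pt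

theorem continuous_pinchFun : Continuous T.pinchFun := by
  let A : Set T.cyl.carrier := {p | T.cylPt p ∈ T.U ∩ T.V}
  let B : Set T.cyl.carrier :=
    {p | (T.cylCoord p = 0 ∧ T.cylPt p ∈ T.U) ∨ (T.cylCoord p = 1 ∧ T.cylPt p ∈ T.V)}
  have hA : IsClosed A := T.hW.isClosed.preimage T.continuous_cylPt
  have hB : IsClosed B :=
    ((isClosed_singleton.preimage T.continuous_cylCoord).inter
      (T.hU.isClosed.preimage T.continuous_cylPt)).union
    ((isClosed_singleton.preimage T.continuous_cylCoord).inter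
      (T.hV.isClosed.preimage T.continuous_cylPt))
  have hAB : A ∪ B = univ := by
    refine eq_univ_of_forall fun p => ?_
    rcases T.cyl_cases p with h | h | h
    · exact .inr (.inl h)
    · exact .inl h
    · exact .inr (.inr h)
  rw [← continuousOn_univ, ← hAB]
  refine ContinuousOn.union_of_isClosed ?_ ?_ hA hB
  · rw [continuousOn_iff_continuous_domRestrict]
    have : A.domRestrict T.pinchFun =
        fun p : A => T.suspMk (T.cylCoord p.1) ⟨T.cylPt p.1, p.2⟩ :=
      funext fun p => dif_pos p.2
    rw [this]
    exact T.continuous_suspMk.comp ((T.continuous_cylCoord.comp continuous_subtype_val).prodMk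
      ((T.continuous_cylPt.comp continuous_subtype_val).subtype_mk _))
  · refine (continuousOn_const (c := T.spW.plus.susp.pt)).congr fun p hp => ?_
    by_cases h : T.cylPt p ∈ T.U ∩ T.V
    · refine (dif_pos h).trans ?_
      rcases hp with hp | hp
      · rw [hp.1]
        exact T.suspMk_zero _
      · rw [hp.1]
        exact T.suspMk_one _
    · exact dif_neg h

theorem pinchFun_smul (g : G) (p : T.cyl.carrier) :
    T.pinchFun (g • p) = g • T.pinchFun p := by
  by_cases h : T.cylPt p ∈ T.U ∩ T.V
  · have h' : T.cylPt (g • p) ∈ T.U ∩ T.V := T.hW.smul_mem g h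
    refine (dif_pos h').trans (Eq.trans ?_ (congrArg (g • ·) (dif_pos h)).symm)
    exact T.suspMk_smul g (T.cylCoord p) ⟨T.cylPt p, h⟩
  · have h' : T.cylPt (g • p) ∉ T.U ∩ T.V := fun h' => h ((T.hW.smul_mem_iff g).1 h')
    have e : T.pinchFun p = T.spW.plus.susp.pt := dif_neg h
    rw [e]
    exact dif_neg h'

/-- The collapse `X'₊ → ΣW₊` of the ends `U` and `V` of the double mapping cylinder. -/
noncomputable def pinch : PtGMap T.cyl.plus T.spW.plus.susp :=
  ⟨⟨Sum.elim T.pinchFun fun _ => T.spW.plus.susp.pt,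
    T.continuous_pinchFun.sumElim continuous_const, by
    rintro g (p | p)
    · exact T.pinchFun_smul g p
    · rfl⟩, rfl⟩

end GCWTriad

namespace MultCohomology

variable {G : Type u} [Group G] [TopologicalSpace G] (E : MultCohomology.{u, v} G)

/-- The unreduced cohomology ring `E X = Ẽ X₊`. -/
abbrev coh (X : GCWSpace G) : Type v := E.carrier X.plus

/-- The part `Eⁿ X` of degree `n`. -/
abbrev deg (X : GCWSpace G) (n : ℤ) : AddSubgroup (E.coh X) := E.gr X.plus n

/-- The ring homomorphism `f* : E Y → E X`. -/
abbrev pull {X Y : GCWSpace G} (f : GMap X Y) : E.coh Y →ₙ+* E.coh X := E.map f.plus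

/-- The subring of elements of even degree. -/
def even (X : GCWSpace G) : NonUnitalSubring (E.coh X) where
  toAddSubmonoid := (⨆ k : ℤ, E.deg X (2 * k)).toAddSubmonoid
  neg_mem' := fun h => neg_mem (S := AddSubgroup (E.coh X)) h
  mul_mem' := by
    intro a b ha hb
    change a * b ∈ ⨆ k : ℤ, E.deg X (2 * k)
    change a ∈ ⨆ k : ℤ, E.deg X (2 * k) at ha
    change b ∈ ⨆ k : ℤ, E.deg X (2 * k) at hb
    refine AddSubgroup.iSup_induction _ (C := fun a => a * b ∈ ⨆ k : ℤ, E.deg X (2 * k)) ha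
      (fun i x hx => ?_) ?_ fun x y hx hy => ?_
    · refine AddSubgroup.iSup_induction _
        (C := fun b => x * b ∈ ⨆ k : ℤ, E.deg X (2 * k)) hb (fun j y hy => ?_) ?_
        fun y z hy hz => ?_
      · refine AddSubgroup.mem_iSup_of_mem (i + j) ?_
        rw [mul_add]
        exact E.mul_mem _ _ _ _ _ hx hy
      · rw [mul_zero]
        exact zero_mem _
      · rw [mul_add]
        exact add_mem hy hz
    · rw [zero_mul]
      exact zero_mem _
    · rw [add_mul]
      exact add_mem hx hy

/-- The subgroup of elements of odd degree. -/
def odd (X : GCWSpace G) : AddSubgroup (E.coh X) := ⨆ k : ℤ, E.deg X (2 * k + 1)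

variable (T : GCWTriad G)

/-- The fibre product ring `E U ×_{E W} E V`. -/
def fibreProduct : NonUnitalSubring (E.coh T.spU × E.coh T.spV) :=
  NonUnitalRingHom.eqLocus ((E.pull T.jU).comp (NonUnitalRingHom.fst _ _))
    ((E.pull T.jV).comp (NonUnitalRingHom.snd _ _))

/-- The subgroup `im j_U* + im j_V*` of `E W`. -/
def imSum : AddSubgroup (E.coh T.spW) :=
  AddMonoidHom.range (E.pull T.jU : E.coh T.spU →+ E.coh T.spW) ⊔
    AddMonoidHom.range (E.pull T.jV : E.coh T.spV →+ E.coh T.spW)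

/-- The property of being the connecting map `δ : E W → E X` (of degree one) of the Mayer-Vietoris
sequence of the triad: the composite of the suspension isomorphism `E W → Ẽ ΣW₊`, the pullback
along the collapse `X'₊ → ΣW₊`, and the inverse of the isomorphism `E X → E X'` induced by the
homotopy equivalence `X' → X`. -/
def IsConnecting (δ : E.coh T.spW →+ E.coh T.X) : Prop :=
  ∀ w, E.pull T.cylToX (δ w) = E.map T.pinch (E.susp T.spW.plus w)

end MultCohomology

/-! The core is the exact Mayer–Vietoris sequence `E W → E X → E U ⊕ E V → E W`, whose first map is
`δ`, of degree one. When `E U`, `E V`, `E W` are concentrated in even degrees it breaks up. The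
image of `δ` is odd, so an even class that dies on `U` and on `V` is zero, and any compatible pair
of classes comes from an even class. An odd class restricts to zero on `U` and `V`, hence is `δ w`,
with `w` unique modulo `imSum`. Exactness is carried by `exists_mvConnect_iff`,
`mvConnect_eq_zero_iff` and `exists_pull_eq`.

The axioms only give exactness in the middle of a cofibre sequence, so the long exact sequence of a
pair `(Y, B)` is derived by the Puppe argument. The mapping cone `M` of `B ⊂ Y` is homotopy
equivalent to `Y / B`, its quotient by `Y` is `ΣB`, and coning off `Y` in `M` gives the next term.
The geometric input is the equivariant homotopy extension property, in the form of a retraction of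
`[0, 1] × X` onto `{1} × X ∪ [0, 1] × A` built cell by cell (`GCW.retract`). The same retraction
gives a section up to homotopy of `X' → X`. With the homeomorphism `V / W ≅ X / U`, the connecting
map is then the composite of `E W → Ẽ (V / W) ≅ Ẽ (X / U) → E X` (`isConnecting_mvConnect`).

For products, the collapse `X'₊ → ΣW₊` is factored through `L = X₊ ∪ S¹ × W₊` inside `S¹ × X₊`
(`pinch_eq_loop`). On `L` live both the pullback of `x ∈ E X` and the pullback of the suspension of
`w`. Their product vanishes on `X₊ ∨ S¹`, so it comes from `L / (X₊ ∨ S¹) = ΣW₊`. A class on `ΣW₊`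
is determined by its pullback to `S¹ × W₊` (`map_toSusp_injective`), where the suspension of `w`
becomes the product of `e` and `w`. Hence `x · δ w = δ (x|W · w)` for even `x`, with no sign because
`x` commutes with `e`, and `x · δ w = 0` whenever `x|W = 0`. An odd `x` restricts to zero on `W`, so
odd classes multiply to zero and the module statement holds for all `x`. -/

/-! ### Radial retraction of a cylinder on a disk -/

namespace Disk

variable {n : ℕ}

/-- The scaling factor of the radial projection of `[0, 1] × Dⁿ` from the point `(-1, 0)`. -/
noncomputable def pushScale (p : unitInterval × Disk n) : ℝ := max (((p.1 : ℝ) + 1) / 2) ‖p.2.1‖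

theorem pushScale_pos (p : unitInterval × Disk n) : 0 < pushScale p :=
  lt_max_of_lt_left (by linarith [p.1.2.1])

theorem pushScale_le_one (p : unitInterval × Disk n) : pushScale p ≤ 1 :=
  max_le (by linarith [p.1.2.2]) (mem_closedBall_zero_iff.1 p.2.2)

/-- The radial retraction of `[0, 1] × Dⁿ` onto `{1} × Dⁿ ∪ [0, 1] × ∂Dⁿ`. -/
noncomputable def push (p : unitInterval × Disk n) : unitInterval × Disk n :=
  (⟨((p.1 : ℝ) + 1) / pushScale p - 1, by
    constructor
    · rw [sub_nonneg, le_div_iff₀ (pushScale_pos p)]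
      linarith [pushScale_le_one p, p.1.2.1]
    · rw [sub_le_iff_le_add, div_le_iff₀ (pushScale_pos p)]
      have h : ((p.1 : ℝ) + 1) / 2 ≤ pushScale p := le_max_left _ _
      linarith⟩,
   ⟨(pushScale p)⁻¹ • p.2.1, by
    rw [mem_closedBall_zero_iff, norm_smul, norm_inv, Real.norm_of_nonneg (pushScale_pos p).le,
      inv_mul_le_iff₀ (pushScale_pos p), mul_one]
    exact le_max_right _ _⟩)

theorem continuous_push : Continuous (push : unitInterval × Disk n → unitInterval × Disk n) := by
  have hc : Continuous (pushScale : unitInterval × Disk n → ℝ) := by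
    unfold pushScale
    fun_prop
  have hne : ∀ p : unitInterval × Disk n, pushScale p ≠ 0 := fun p => (pushScale_pos p).ne'
  refine Continuous.prodMk (Continuous.subtype_mk ?_ _) (Continuous.subtype_mk ?_ _)
  · exact (((continuous_subtype_val.comp _root_.continuous_fst).add continuous_const).div hc
      hne).sub continuous_const
  · exact (hc.inv₀ hne).smul (continuous_subtype_val.comp _root_.continuous_snd)

theorem push_of_pushScale {p : unitInterval × Disk n} (h : pushScale p = 1) : push p = p :=
  Prod.ext (Subtype.ext (by simp [push, h])) (Subtype.ext (by simp [push, h]))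

theorem push_one (d : Disk n) : push (1, d) = (1, d) :=
  push_of_pushScale (le_antisymm (pushScale_le_one _) (le_max_of_le_left (by norm_num)))

theorem push_of_norm {p : unitInterval × Disk n} (h : ‖p.2.1‖ = 1) : push p = p :=
  push_of_pushScale (le_antisymm (pushScale_le_one _) (le_max_of_le_right h.ge))

/-- Whichever term attains the maximum in `pushScale` decides the face through which the ray from
`(-1, 0)` leaves the cylinder: the top or the side. -/
theorem push_mem (p : unitInterval × Disk n) : (push p).1 = 1 ∨ ‖(push p).2.1‖ = 1 := by
  rcases max_choice (((p.1 : ℝ) + 1) / 2) ‖p.2.1‖ with h | h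
  · left
    have h' : pushScale p = ((p.1 : ℝ) + 1) / 2 := h
    have h0 := pushScale_pos p
    refine Subtype.ext ?_
    change ((p.1 : ℝ) + 1) / pushScale p - 1 = 1
    rw [sub_eq_iff_eq_add, div_eq_iff h0.ne', h']
    ring
  · right
    have h' : pushScale p = ‖p.2.1‖ := h
    have h0 := pushScale_pos p
    change ‖(pushScale p)⁻¹ • p.2.1‖ = 1
    rw [norm_smul, norm_inv, Real.norm_of_nonneg h0.le, ← h', inv_mul_cancel₀ h0.ne']

end Disk

/-! ### Equivariant homotopy extension: retracting `[0, 1] × X` onto `{1} × X ∪ [0, 1] × A` -/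

namespace GCW

variable {G : Type u} [Group G] [TopologicalSpace G]
  {X : Type u} [TopologicalSpace X] [MulAction G X] (K : GCW G X)

theorem exists_carrier (x : X) : ∃ s : Σ i : K.cell, (G ⧸ K.stab i) × Disk (K.dim i),
    ‖s.2.2.1‖ < 1 ∧ K.char s.1 s.2 = x := by
  obtain ⟨i, p, h⟩ := K.exists_cell x
  exact ⟨⟨i, p⟩, h⟩

/-- The open cell containing `x`, with the coordinates of `x` in this cell. -/
noncomputable def carrierCell (x : X) : Σ i : K.cell, (G ⧸ K.stab i) × Disk (K.dim i) :=
  (K.exists_carrier x).choose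

theorem norm_carrierCell (x : X) : ‖(K.carrierCell x).2.2.1‖ < 1 :=
  (K.exists_carrier x).choose_spec.1

theorem char_carrierCell (x : X) : K.char (K.carrierCell x).1 (K.carrierCell x).2 = x :=
  (K.exists_carrier x).choose_spec.2

/-- The choice made in `carrierCell` is forced, because open cells are disjoint and characteristic
maps are injective on them. -/
theorem carrierCell_char (i : K.cell) (p : (G ⧸ K.stab i) × Disk (K.dim i)) (hp : ‖p.2.1‖ < 1) :
    K.carrierCell (K.char i p) = ⟨i, p⟩ := by
  have h1 := K.norm_carrierCell (K.char i p)
  have h2 := K.char_carrierCell (K.char i p)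
  generalize K.carrierCell (K.char i p) = s at h1 h2
  obtain ⟨j, q⟩ := s
  obtain rfl := K.cell_unique _ _ _ _ h1 hp h2
  obtain rfl := K.char_inj _ _ _ h1 hp h2
  rfl

/-- The radial retraction applied to the disk coordinate of a cell. -/
noncomputable def cellPush (i : K.cell) (y : unitInterval × ((G ⧸ K.stab i) × Disk (K.dim i))) :
    unitInterval × ((G ⧸ K.stab i) × Disk (K.dim i)) :=
  ((Disk.push (y.1, y.2.2)).1, (y.2.1, (Disk.push (y.1, y.2.2)).2))

theorem continuous_cellPush (i : K.cell) : Continuous (K.cellPush i) := by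
  have h : Continuous fun y : unitInterval × ((G ⧸ K.stab i) × Disk (K.dim i)) =>
      Disk.push (y.1, y.2.2) :=
    Disk.continuous_push.comp (continuous_fst.prodMk (continuous_snd.comp continuous_snd))
  exact (continuous_fst.comp h).prodMk
    ((continuous_fst.comp continuous_snd).prodMk (continuous_snd.comp h))

/-- The characteristic map of `[0, 1]` times a cell. -/
def cylChar (i : K.cell) (y : unitInterval × ((G ⧸ K.stab i) × Disk (K.dim i))) :
    unitInterval × X :=
  (y.1, K.char i y.2)

theorem continuous_cylChar (i : K.cell) : Continuous (K.cylChar i) :=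
  continuous_fst.prodMk ((K.continuous_char i).comp continuous_snd)

open Classical in
/-- The map that pushes the cells outside `A` one step towards `{1} × X ∪ [0, 1] × A`. -/
noncomputable def stepPush (A : Set X) (y : unitInterval × X) : unitInterval × X :=
  if y.2 ∈ A then y
  else K.cylChar (K.carrierCell y.2).1 (K.cellPush _ (y.1, (K.carrierCell y.2).2))

/-- The target of the retraction. -/
def pushFix (A : Set X) : Set (unitInterval × X) := {y | y.1 = 1 ∨ y.2 ∈ A}

variable {K} {A : Set X}

theorem stepPush_of_mem {y : unitInterval × X} (h : y.2 ∈ A) : K.stepPush A y = y := if_pos h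

theorem stepPush_of_pushFix {y : unitInterval × X} (h : y ∈ pushFix A) : K.stepPush A y = y := by
  by_cases hA : y.2 ∈ A
  · exact stepPush_of_mem hA
  · have h1 := h.resolve_right hA
    obtain ⟨t, x⟩ := y
    change t = 1 at h1
    subst h1
    rw [stepPush, if_neg hA]
    simp only [cellPush, cylChar, Disk.push_one]
    exact Prod.ext rfl (K.char_carrierCell x)

theorem stepPush_char {i : K.cell} (y : unitInterval × ((G ⧸ K.stab i) × Disk (K.dim i)))
    (hy : ‖y.2.2.1‖ < 1) (hA : K.char i y.2 ∉ A) :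
    K.stepPush A (K.cylChar i y) = K.cylChar i (K.cellPush i y) := by
  refine (if_neg hA).trans ?_
  simp only [cylChar]
  rw [K.carrierCell_char i y.2 hy]

theorem cellPush_of_norm {i : K.cell} {y : unitInterval × ((G ⧸ K.stab i) × Disk (K.dim i))}
    (hy : ‖y.2.2.1‖ = 1) : K.cellPush i y = y := by
  have : Disk.push (y.1, y.2.2) = (y.1, y.2.2) := Disk.push_of_norm hy
  simp only [cellPush, this]

/-- The push changes only the height and the disk coordinate, while `G` acts only on the coset
coordinate. -/
theorem stepPush_smul (hA : K.IsSubcomplex A) (t : unitInterval) (g : G) (x : X) :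
    K.stepPush A (t, g • x) = ((K.stepPush A (t, x)).1, g • (K.stepPush A (t, x)).2) := by
  by_cases h : x ∈ A
  · rw [stepPush_of_mem (y := (t, x)) h, stepPush_of_mem (y := (t, g • x)) (hA.smul_mem g h)]
  · obtain ⟨i, ⟨c, d⟩, hd, rfl⟩ := K.exists_cell x
    have h' : K.char i (g • c, d) ∉ A := by
      rw [K.char_smul]
      exact fun h' => h ((hA.smul_mem_iff g).1 h')
    have h1 := stepPush_char (t, (c, d)) hd h
    have h2 := stepPush_char (t, (g • c, d)) hd h'
    simp only [cylChar, cellPush] at h1 h2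
    rw [← K.char_smul, h1, h2, K.char_smul]

/-- A step moves a point inside a single closed cell, hence inside every subcomplex containing that
point. -/
theorem stepPush_mem {C : Set X} (hC : K.IsSubcomplex C) {y : unitInterval × X} (hy : y.2 ∈ C) :
    (K.stepPush A y).2 ∈ C := by
  obtain ⟨t, x⟩ := y
  by_cases h : x ∈ A
  · rwa [stepPush_of_mem (y := (t, x)) h]
  · obtain ⟨i, p, hp, rfl⟩ := K.exists_cell x
    rw [show ((t, K.char i p) : unitInterval × X) = K.cylChar i (t, p) from rfl,
      stepPush_char (t, p) hp h]
    exact hC i p hp hy _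

theorem char_mem_skel_pred (i : K.cell) (p : (G ⧸ K.stab i) × Disk (K.dim i)) (h : ‖p.2.1‖ = 1)
    {n : ℕ} (hn : K.dim i ≤ n + 1) : K.char i p ∈ K.skel n := by
  obtain ⟨j, q, hj, hq, e⟩ := K.boundary i p h
  exact ⟨j, q, by omega, hq, e⟩

theorem iterate_stepPush_of_pushFix (m : ℕ) {y : unitInterval × X} (h : y ∈ pushFix A) :
    (K.stepPush A)^[m] y = y :=
  Function.iterate_fixed (stepPush_of_pushFix h) m

/-- Each step either reaches the target or lands on the boundary of the current cell, that is, in a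
lower skeleton. So `n + 1` steps are enough on the `n`-skeleton. -/
theorem iterate_stepPush_mem (n : ℕ) (y : unitInterval × X) (hy : y.2 ∈ K.skel n) :
    (K.stepPush A)^[n + 1] y ∈ pushFix A := by
  induction n generalizing y with
  | zero =>
    obtain ⟨t, x⟩ := y
    obtain ⟨i, p, hi, hp, rfl⟩ := hy
    by_cases h : K.char i p ∈ A
    · rw [iterate_stepPush_of_pushFix _ (.inr h)]
      exact .inr h
    · rw [Function.iterate_one]
      refine .inl ?_
      rw [show ((t, K.char i p) : unitInterval × X) = K.cylChar i (t, p) from rfl,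
        stepPush_char (t, p) hp h]
      -- A cell of dimension zero has no boundary, so the push must end on the face at height one.
      refine (Disk.push_mem (t, p.2)).resolve_right fun h1 => ?_
      obtain ⟨j, -, hj, -⟩ := K.boundary i (p.1, (Disk.push (t, p.2)).2) h1
      omega
  | succ n ih =>
    obtain ⟨t, x⟩ := y
    obtain ⟨i, p, hi, hp, rfl⟩ := hy
    by_cases h : K.char i p ∈ A
    · rw [iterate_stepPush_of_pushFix _ (.inr h)]
      exact .inr h
    · rw [Function.iterate_succ_apply,
        show ((t, K.char i p) : unitInterval × X) = K.cylChar i (t, p) from rfl,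
        stepPush_char (t, p) hp h]
      rcases Disk.push_mem (t, p.2) with h1 | h1
      · have h2 : K.cylChar i (K.cellPush i (t, p)) ∈ pushFix A := .inl h1
        rwa [iterate_stepPush_of_pushFix _ h2]
      · exact ih _ (K.char_mem_skel_pred i (p.1, (Disk.push (t, p.2)).2) h1 hi)

theorem iterate_stepPush_eq {m n : ℕ} (h : n + 1 ≤ m) {y : unitInterval × X}
    (hy : y.2 ∈ K.skel n) : (K.stepPush A)^[m] y = (K.stepPush A)^[n + 1] y := by
  obtain ⟨k, rfl⟩ := Nat.exists_eq_add_of_le' h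
  rw [Function.iterate_add_apply]
  exact iterate_stepPush_of_pushFix k (iterate_stepPush_mem n y hy)

variable (K A) in
/-- The retraction of `[0, 1] × X` onto `{1} × X ∪ [0, 1] × A`. -/
noncomputable def retract (y : unitInterval × X) : unitInterval × X :=
  (K.stepPush A)^[K.dim (K.carrierCell y.2).1 + 1] y

theorem mem_skel_carrierCell (x : X) : x ∈ K.skel (K.dim (K.carrierCell x).1) :=
  ⟨_, _, le_rfl, K.norm_carrierCell x, K.char_carrierCell x⟩

/-- The number of steps in `retract` varies with the point. Extra steps do nothing once the target
is reached, so one count serves a whole skeleton. -/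
theorem retract_eq {n : ℕ} {y : unitInterval × X} (hy : y.2 ∈ K.skel n) :
    K.retract A y = (K.stepPush A)^[n + 1] y := by
  rcases le_total (K.dim (K.carrierCell y.2).1) n with h | h
  · exact (iterate_stepPush_eq (by omega) (mem_skel_carrierCell y.2)).symm
  · exact iterate_stepPush_eq (by omega) hy

theorem exists_mem_skel (x : X) : ∃ n, x ∈ K.skel n := ⟨_, mem_skel_carrierCell x⟩

theorem skel_mono {m n : ℕ} (h : m ≤ n) : K.skel m ⊆ K.skel n := by
  rintro x ⟨i, p, hi, hp⟩
  exact ⟨i, p, hi.trans h, hp⟩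

theorem retract_mem (y : unitInterval × X) : K.retract A y ∈ pushFix A :=
  iterate_stepPush_mem _ _ (mem_skel_carrierCell y.2)

theorem retract_of_pushFix {y : unitInterval × X} (h : y ∈ pushFix A) : K.retract A y = y :=
  iterate_stepPush_of_pushFix _ h

theorem retract_stepPush (y : unitInterval × X) : K.retract A (K.stepPush A y) = K.retract A y := by
  obtain ⟨m, hm⟩ := K.exists_mem_skel y.2
  obtain ⟨n, hn⟩ := K.exists_mem_skel (K.stepPush A y).2
  rw [retract_eq (skel_mono (le_max_right m n) hn), retract_eq (skel_mono (le_max_left m n) hm),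
    ← Function.iterate_succ_apply]
  exact iterate_stepPush_eq (by omega) (skel_mono (le_max_left m n) hm)

/-- In the interior of the cell one step is absorbed into the iteration; on the boundary the push is
the identity. A single `stepPush` need not be continuous, as points on the boundary of a cell are
moved inside lower cells, but the right-hand side only involves the continuous `cellPush` on the
closed cell. -/
theorem retract_char (hA : K.IsSubcomplex A) (i : K.cell) (hi : ¬ ∀ q, K.char i q ∈ A)
    (y : unitInterval × ((G ⧸ K.stab i) × Disk (K.dim i))) :
    K.retract A (K.cylChar i y) = K.retract A (K.cylChar i (K.cellPush i y)) := by
  rcases norm_lt_or_eq y.2.2 with h | h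
  · rw [← stepPush_char y h fun h' => hi (hA i _ h h'), retract_stepPush]
  · rw [cellPush_of_norm h]

theorem retract_smul (hA : K.IsSubcomplex A) (t : unitInterval) (g : G) (x : X) :
    K.retract A (t, g • x) = ((K.retract A (t, x)).1, g • (K.retract A (t, x)).2) := by
  obtain ⟨n, hn⟩ := K.exists_mem_skel x
  rw [retract_eq (y := (t, x)) hn,
    retract_eq (y := (t, g • x)) ((K.isSubcomplex_skel n).smul_mem g hn)]
  generalize n + 1 = m
  clear hn
  induction m generalizing t x with
  | zero => rfl
  | succ m ih => rw [Function.iterate_succ_apply, stepPush_smul hA, ih, Function.iterate_succ_apply]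

theorem retract_mem_subcomplex {C : Set X} (hC : K.IsSubcomplex C) {y : unitInterval × X}
    (hy : y.2 ∈ C) : (K.retract A y).2 ∈ C := by
  unfold retract
  generalize K.dim (K.carrierCell y.2).1 + 1 = m
  induction m generalizing y with
  | zero => exact hy
  | succ m ih =>
    rw [Function.iterate_succ_apply]
    exact ih (stepPush_mem hC hy)

/-- Since `[0, 1]` is locally compact, its product with a skeleton still carries the topology
determined by the cells. -/
theorem continuousOn_retract_skel (n : ℕ)
    (h : ∀ i, K.dim i ≤ n → Continuous fun y => K.retract A (K.cylChar i y)) :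
    ContinuousOn (K.retract A) {y | y.2 ∈ K.skel n} := by
  rw [continuousOn_iff_isClosed]
  intro C hC
  refine ⟨K.retract A ⁻¹' C ∩ {y | y.2 ∈ K.skel n}, ?_, by rw [inter_assoc, inter_self]⟩
  refine K.isClosed_prod_skel n _ (fun y hy => hy.2) fun i hi => ?_
  convert hC.preimage (h i hi) using 1
  ext y
  exact ⟨fun hy => hy.1, fun hy => ⟨hy, K.char_mem_skel i _ hi⟩⟩

/-- Induction on the dimension of the cell. After `cellPush` a point is either at height one, where
`retract` is the identity, or over the boundary of the cell, where continuity on the lower skeleton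
applies. These two closed sets cover the cylinder on the cell. -/
theorem continuous_retract_char (hA : K.IsSubcomplex A) (i : K.cell) :
    Continuous fun y => K.retract A (K.cylChar i y) := by
  obtain ⟨n, hn⟩ : ∃ n, n = K.dim i := ⟨_, rfl⟩
  induction n using Nat.strong_induction_on generalizing i with
  | _ n ih =>
    by_cases hi : ∀ q, K.char i q ∈ A
    · have : (fun y => K.retract A (K.cylChar i y)) = K.cylChar i :=
        funext fun y => retract_of_pushFix (.inr (hi y.2))
      rw [this]
      exact K.continuous_cylChar i
    · rw [show (fun y => K.retract A (K.cylChar i y)) =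
        fun y => K.retract A (K.cylChar i (K.cellPush i y)) from funext (retract_char hA i hi)]
      let P : Set (unitInterval × ((G ⧸ K.stab i) × Disk (K.dim i))) :=
        {y | (K.cellPush i y).1 = 1}
      let Q : Set (unitInterval × ((G ⧸ K.stab i) × Disk (K.dim i))) :=
        {y | ‖(K.cellPush i y).2.2.1‖ = 1}
      have hP : IsClosed P :=
        isClosed_singleton.preimage (continuous_fst.comp (K.continuous_cellPush i))
      have hQ : IsClosed Q := isClosed_singleton.preimage (continuous_norm.comp
        (continuous_subtype_val.comp (continuous_snd.comp (continuous_snd.comp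
          (K.continuous_cellPush i)))))
      have hPQ : P ∪ Q = univ := eq_univ_of_forall fun y => Disk.push_mem (y.1, y.2.2)
      rw [← continuousOn_univ, ← hPQ]
      refine ContinuousOn.union_of_isClosed ?_ ?_ hP hQ
      · refine ((K.continuous_cylChar i).comp (K.continuous_cellPush i)).continuousOn.congr
          fun y hy => ?_
        exact retract_of_pushFix (.inl hy)
      -- Dimension zero is split off because `n - 1` would be truncated; there `Q` is empty.
      · rcases Nat.eq_zero_or_pos n with h0 | hpos
        · refine continuousOn_of_forall_continuousAt fun y hy => ?_
          obtain ⟨j, -, hj, -⟩ := K.boundary i (K.cellPush i y).2 hy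
          omega
        · refine (K.continuousOn_retract_skel (n - 1) fun j hj => ih _ (by omega) j rfl).comp
            ((K.continuous_cylChar i).comp (K.continuous_cellPush i)).continuousOn fun y hy => ?_
          exact K.char_mem_skel_pred i _ hy (by omega)

theorem continuous_retract (hA : K.IsSubcomplex A) : Continuous (K.retract A) := by
  rw [continuous_iff_isClosed]
  intro C hC
  exact K.isClosed_prod _ fun i => hC.preimage (continuous_retract_char hA i)

end GCW

/-! ### Permanence properties of subcomplexes -/

namespace GCW

section

variable {G : Type u} [Group G] [TopologicalSpace G]
  {X : Type u} [TopologicalSpace X] [MulAction G X] {K : GCW G X}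

theorem IsSubcomplex.union {A B : Set X} (hA : K.IsSubcomplex A) (hB : K.IsSubcomplex B) :
    K.IsSubcomplex (A ∪ B) :=
  fun i p hp h q => h.imp (fun h => hA i p hp h q) fun h => hB i p hp h q

theorem isSubcomplex_univ : K.IsSubcomplex univ := fun _ _ _ _ _ => trivial

theorem IsSubcomplex.preimage_val {A B : Set X} (hA : K.IsSubcomplex A) (hB : K.IsSubcomplex B) :
    @IsSubcomplex G _ _ A _ (K.subAction hA) (K.sub hA) (Subtype.val ⁻¹' B) :=
  fun i p hp h q => hB i.1 p hp h q

theorem IsSubcomplex.image_mk {A B : Set X} (hA : K.IsSubcomplex A) {a : X} (ha : a ∈ A)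
    (hB : K.IsSubcomplex B) :
    @IsSubcomplex G _ _ _ _ (K.quotAction hA) (K.quot hA ha) (Quotient.mk (collapse A) '' B) := by
  rintro (i | i) p hp ⟨x, hx, e⟩ q
  · rcases mk_eq_iff.1 e with e | e
    · exact ⟨_, hB i.1 p hp (e ▸ hx) q, rfl⟩
    · exact absurd (hA i.1 p hp e.2) i.2
  · exact ⟨x, hx, e⟩

theorem IsSubcomplex.inl_union {A : Set X} (hA : K.IsSubcomplex A) :
    K.plus.IsSubcomplex (Sum.inl '' A ∪ {.inr PUnit.unit}) := by
  rintro (i | i) p hp h q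
  · rcases h with ⟨x, hx, e⟩ | h
    · refine .inl ⟨_, hA i p hp ?_ q, rfl⟩
      rwa [Sum.inl_injective e] at hx
    · exact absurd h Sum.inl_ne_inr
  · exact .inr rfl

theorem IsSubcomplex.prod {L : Type} [TopologicalSpace L] [CompactSpace L] [T2Space L]
    {F : FinCW L} {A : Set (Triv.{u} L)} {B : Set X} (hA : (GCW.triv (G := G) F).IsSubcomplex A)
    (hB : K.IsSubcomplex B) : (K.prod F).IsSubcomplex (A ×ˢ B) := by
  rintro ⟨a, b⟩ p hp h q
  have hp' := (Disk.norm_lt_iff p.2).1 hp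
  exact ⟨hA ⟨a⟩ (QuotientGroup.mk 1, p.2.fst) hp'.1 h.1 (QuotientGroup.mk 1, q.2.fst),
    hB b (p.1, p.2.snd) hp'.2 h.2 (q.1, q.2.snd)⟩

theorem isSubcomplex_interval_zero :
    (GCW.triv (G := G) FinCW.interval).IsSubcomplex {Triv.mk 0} := by
  rintro ⟨a⟩ p hp h q
  obtain rfl := FinCW.interval.cell_unique a (some false) p.2 (Disk.zero 0) hp
    (norm_disk_zero _) (congrArg Triv.val h)
  rfl

theorem isSubcomplex_interval_one :
    (GCW.triv (G := G) FinCW.interval).IsSubcomplex {Triv.mk 1} := by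
  rintro ⟨a⟩ p hp h q
  obtain rfl := FinCW.interval.cell_unique a (some true) p.2 (Disk.zero 0) hp
    (norm_disk_zero _) (congrArg Triv.val h)
  rfl

theorem isSubcomplex_circle_zero :
    (GCW.triv (G := G) FinCW.circle).IsSubcomplex {Triv.mk 0} := by
  rintro ⟨a⟩ p hp h q
  obtain rfl := FinCW.circle.cell_unique a false p.2 (Disk.zero 0) hp
    (norm_disk_zero _) (congrArg Triv.val h)
  rfl

end

end GCW

/-! ### Quotients, homotopies and closed embeddings of pointed complexes -/

namespace PtGCW

variable {G : Type u} [Group G] [TopologicalSpace G]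

theorem smul_pt (X : PtGCW G) (g : G) : g • X.pt = X.pt :=
  X.isSubcomplex_pt.smul_mem g (mem_singleton _)

theorem isQuotientMap_proj (X : PtGCW G) (A : Set X.carrier) (hA : X.cw.IsSubcomplex A)
    (hpt : X.pt ∈ A) : IsQuotientMap (X.proj A hA hpt).toFun := isQuotientMap_quotient_mk'

theorem proj_eq_iff {X : PtGCW G} {A : Set X.carrier} {hA : X.cw.IsSubcomplex A}
    {hpt : X.pt ∈ A} {x y : X.carrier} :
    (X.proj A hA hpt).toFun x = (X.proj A hA hpt).toFun y ↔ x = y ∨ (x ∈ A ∧ y ∈ A) :=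
  GCW.mk_eq_iff

theorem proj_eq_pt_iff {X : PtGCW G} {A : Set X.carrier} {hA : X.cw.IsSubcomplex A}
    {hpt : X.pt ∈ A} {x : X.carrier} :
    (X.proj A hA hpt).toFun x = (X.quot A hA hpt).pt ↔ x ∈ A := by
  refine proj_eq_iff.trans ⟨fun h => ?_, fun h => .inr ⟨h, hpt⟩⟩
  rcases h with rfl | h
  · exact hpt
  · exact h.1

/-- The saturation of a closed set `F` is `F` if it misses `A` and `F ∪ A` otherwise; both are
closed because subcomplexes are. -/
theorem isClosedMap_proj (X : PtGCW G) (A : Set X.carrier) (hA : X.cw.IsSubcomplex A)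
    (hpt : X.pt ∈ A) : IsClosedMap (X.proj A hA hpt).toFun := by
  intro F hF
  rw [← (X.isQuotientMap_proj A hA hpt).isClosed_preimage]
  by_cases h : (F ∩ A).Nonempty
  · obtain ⟨a, ha, ha'⟩ := h
    convert hF.union hA.isClosed using 1
    ext x
    constructor
    · rintro ⟨y, hy, e⟩
      rcases proj_eq_iff.1 e with rfl | e
      · exact .inl hy
      · exact .inr e.2
    · rintro (hx | hx)
      · exact ⟨x, hx, rfl⟩
      · exact ⟨a, ha, proj_eq_iff.2 (.inr ⟨ha', hx⟩)⟩
  · convert hF using 1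
    ext x
    constructor
    · rintro ⟨y, hy, e⟩
      rcases proj_eq_iff.1 e with rfl | e
      · exact hy
      · exact absurd ⟨y, hy, e.1⟩ h
    · exact fun hx => ⟨x, hx, rfl⟩

theorem isSubcomplex_image_proj {X : PtGCW G} {A B : Set X.carrier} (hA : X.cw.IsSubcomplex A)
    (hpt : X.pt ∈ A) (hB : X.cw.IsSubcomplex B) :
    (X.quot A hA hpt).cw.IsSubcomplex ((X.proj A hA hpt).toFun '' B) :=
  hA.image_mk hpt hB

/-- The product `[0, 1] × X`, pointed at `(0, pt)`. -/
noncomputable def intervalProd (X : PtGCW G) : PtGCW G where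
  toGCWSpace := X.toGCWSpace.prod FinCW.interval
  pt := (Triv.mk 0, X.pt)
  isSubcomplex_pt := by
    have := GCW.isSubcomplex_interval_zero.prod X.isSubcomplex_pt
    rwa [singleton_prod_singleton] at this

end PtGCW

namespace PtGMap

variable {G : Type u} [Group G] [TopologicalSpace G] {X Y Q T : PtGCW G}

instance : CoeFun (PtGMap X Y) fun _ => X.carrier → Y.carrier := ⟨fun f => f.toFun⟩

theorem ext {f g : PtGMap X Y} (h : ∀ x, f x = g x) : f = g := by
  obtain ⟨⟨f, _, _⟩, _⟩ := f
  obtain ⟨⟨g, _, _⟩, _⟩ := g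
  obtain rfl : f = g := funext h
  rfl

theorem continuous (f : PtGMap X Y) : Continuous f := f.continuous_toFun

/-- The constant map to the base point. -/
def const (X Y : PtGCW G) : PtGMap X Y :=
  ⟨⟨fun _ => Y.pt, continuous_const, fun g _ => (Y.smul_pt g).symm⟩, rfl⟩

/-- The inverse of a pointed `G`-map that is a homeomorphism. -/
noncomputable def inv (f : PtGMap X Y) (h : IsHomeomorph f) : PtGMap Y X :=
  ⟨⟨(h.homeomorph f).symm, (h.homeomorph f).symm.continuous, fun g y => by
    apply h.injective
    rw [f.map_smul]
    exact ((h.homeomorph f).apply_symm_apply _).trans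
      (congrArg (g • ·) ((h.homeomorph f).apply_symm_apply y).symm)⟩, by
    apply h.injective
    exact ((h.homeomorph f).apply_symm_apply _).trans f.map_pt.symm⟩

theorem apply_inv (f : PtGMap X Y) (h : IsHomeomorph f) (y : Y.carrier) : f (f.inv h y) = y :=
  (h.homeomorph f).apply_symm_apply y

theorem inv_apply (f : PtGMap X Y) (h : IsHomeomorph f) (x : X.carrier) : f.inv h (f x) = x :=
  (h.homeomorph f).symm_apply_apply x

/-- The map induced on the target of a quotient map. -/
noncomputable def desc (k : PtGMap X Q) (hk : IsQuotientMap k) (F : PtGMap X T)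
    (h : ∀ x y, k x = k y → F x = F y) : PtGMap Q T :=
  have h' : ∀ x, F (Function.surjInv hk.surjective (k x)) = F x := fun _ =>
    h _ _ (Function.surjInv_eq hk.surjective _)
  ⟨⟨fun q => F (Function.surjInv hk.surjective q), by
    rw [hk.continuous_iff]
    exact F.continuous.congr fun x => (h' x).symm, fun g q => by
    obtain ⟨x, rfl⟩ := hk.surjective q
    rw [← k.map_smul, h', h', F.map_smul]⟩, by
    rw [← k.map_pt]
    exact (h' _).trans F.map_pt⟩

@[simp] theorem desc_apply (k : PtGMap X Q) (hk : IsQuotientMap k) (F : PtGMap X T)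
    (h : ∀ x y, k x = k y → F x = F y) (x : X.carrier) : desc k hk F h (k x) = F x :=
  h _ _ (Function.surjInv_eq hk.surjective _)

theorem desc_comp (k : PtGMap X Q) (hk : IsQuotientMap k) (F : PtGMap X T)
    (h : ∀ x y, k x = k y → F x = F y) : (desc k hk F h).comp k = F :=
  ext (desc_apply k hk F h)

/-- The map induced on the quotient by a subcomplex. -/
noncomputable def quotLift {A : Set X.carrier} (hA : X.cw.IsSubcomplex A) (hpt : X.pt ∈ A)
    (F : PtGMap X T) (h : ∀ a ∈ A, F a = T.pt) : PtGMap (X.quot A hA hpt) T :=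
  desc (X.proj A hA hpt) (X.isQuotientMap_proj A hA hpt) F fun x y e =>
    (PtGCW.proj_eq_iff.1 e).elim (fun e => congrArg _ e) fun e => (h x e.1).trans (h y e.2).symm

@[simp] theorem quotLift_apply {A : Set X.carrier} (hA : X.cw.IsSubcomplex A) (hpt : X.pt ∈ A)
    (F : PtGMap X T) (h : ∀ a ∈ A, F a = T.pt) (x : X.carrier) :
    quotLift hA hpt F h (X.proj A hA hpt x) = F x :=
  desc_apply _ _ _ _ x

theorem quotLift_comp {A : Set X.carrier} (hA : X.cw.IsSubcomplex A) (hpt : X.pt ∈ A)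
    (F : PtGMap X T) (h : ∀ a ∈ A, F a = T.pt) :
    (quotLift hA hpt F h).comp (X.proj A hA hpt) = F :=
  ext (quotLift_apply hA hpt F h)

/-- The product of a quotient map with the locally compact space `[0, 1]` is again a quotient map,
so a homotopy compatible with the identifications descends. -/
theorem homotopic_of_isQuotientMap (k : PtGMap X Q) (hk : IsQuotientMap k) (f g : PtGMap Q T)
    (H : unitInterval × X.carrier → T.carrier) (hH : Continuous H)
    (hsmul : ∀ t (a : G) x, H (t, a • x) = a • H (t, x)) (hpt : ∀ t, H (t, X.pt) = T.pt)
    (h0 : ∀ x, H (0, x) = f (k x)) (h1 : ∀ x, H (1, x) = g (k x))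
    (h : ∀ t x y, k x = k y → H (t, x) = H (t, y)) : f.Homotopic g := by
  have h' : ∀ t x, H (t, Function.surjInv hk.surjective (k x)) = H (t, x) := fun t x =>
    h t _ _ (Function.surjInv_eq hk.surjective _)
  refine ⟨fun p => H (p.1, Function.surjInv hk.surjective p.2), ?_, ?_, ?_, ?_, ?_⟩
  · refine hk.continuous_lift_prod_right (hH.congr fun p => ?_)
    exact (h' p.1 p.2).symm
  · intro t a q
    obtain ⟨x, rfl⟩ := hk.surjective q
    simp only [← k.map_smul, h', hsmul]
  · intro t
    simp only [← k.map_pt, h', hpt]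
  · intro q
    obtain ⟨x, rfl⟩ := hk.surjective q
    simp only [h', h0]
  · intro q
    obtain ⟨x, rfl⟩ := hk.surjective q
    simp only [h', h1]

/-- A closed embedding onto a subcomplex. -/
structure IsCofib (f : PtGMap X Y) : Prop where
  isClosedEmbedding : IsClosedEmbedding f
  isSubcomplex : Y.cw.IsSubcomplex (range f)

theorem pt_mem_range (f : PtGMap X Y) : Y.pt ∈ range f := ⟨_, f.map_pt⟩

/-- The corestriction of a map to a subcomplex. -/
def codRestrict (f : PtGMap X Y) (B : Set Y.carrier) (hB : Y.cw.IsSubcomplex B) (hpt : Y.pt ∈ B)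
    (h : ∀ x, f x ∈ B) : PtGMap X (Y.sub B hB hpt) :=
  ⟨⟨fun x => ⟨f x, h x⟩, f.continuous.subtype_mk _, fun g x => Subtype.ext (f.map_smul g x)⟩,
    Subtype.ext f.map_pt⟩

end PtGMap

/-! ### First consequences of the exactness axiom -/

namespace MultCohomology

variable {G : Type u} [Group G] [TopologicalSpace G] (E : MultCohomology.{u, v} G)
  {X Y Q B : PtGCW G}

theorem map_inv_map (f : PtGMap X Y) (h : IsHomeomorph f) (y : E.carrier Y) :
    E.map (f.inv h) (E.map f y) = y := by
  rw [← E.map_comp, show f.comp (f.inv h) = PtGMap.id Y from PtGMap.ext (f.apply_inv h), E.map_id]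

theorem map_map_inv (f : PtGMap X Y) (h : IsHomeomorph f) (x : E.carrier X) :
    E.map f (E.map (f.inv h) x) = x := by
  rw [← E.map_comp, show (f.inv h).comp f = PtGMap.id X from PtGMap.ext (f.inv_apply h), E.map_id]

theorem map_bijective (f : PtGMap X Y) (h : IsHomeomorph f) : Function.Bijective (E.map f) :=
  ⟨Function.LeftInverse.injective (E.map_inv_map f h),
    Function.RightInverse.surjective (E.map_map_inv f h)⟩

/-- The reduced cohomology of a point vanishes: `Y → Y / pt` has a left inverse, so every class on
`Y` is pulled back from `Y / pt`, and exactness makes its restriction to the point zero. -/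
theorem map_const (x : E.carrier Y) : E.map (PtGMap.const X Y) x = 0 := by
  let i := Y.incl {Y.pt} Y.isSubcomplex_pt rfl
  let q := Y.proj {Y.pt} Y.isSubcomplex_pt rfl
  let r : PtGMap _ Y := PtGMap.quotLift (A := {Y.pt}) Y.isSubcomplex_pt rfl (PtGMap.id Y)
    fun a ha => ha
  have hr : r.comp q = PtGMap.id Y := PtGMap.quotLift_comp _ _ _ _
  have hi : E.map i x = 0 := by
    refine (E.exact _ _ _ _ x).2 ⟨E.map r x, ?_⟩
    change E.map q _ = x
    rw [← E.map_comp, hr, E.map_id]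
  have hc : PtGMap.const X Y = i.comp (PtGMap.const X _) := rfl
  rw [hc, E.map_comp, hi, map_zero]

theorem map_eq_zero_of_forall (f : PtGMap X Y) (h : ∀ x, f x = Y.pt) (y : E.carrier Y) :
    E.map f y = 0 := by
  rw [show f = PtGMap.const X Y from PtGMap.ext h, E.map_const]

theorem map_eq_zero_of_homotopic (f : PtGMap X Y) (h : f.Homotopic (PtGMap.const X Y))
    (y : E.carrier Y) : E.map f y = 0 := by
  rw [E.map_homotopic _ _ h, E.map_const]

theorem isHomeomorph_codRestrict {f : PtGMap B X} (hf : f.IsCofib) :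
    IsHomeomorph (f.codRestrict (range f) hf.isSubcomplex f.pt_mem_range mem_range_self) := by
  refine (hf.isClosedEmbedding.toIsEmbedding.toHomeomorph).isHomeomorph

/-- Exactness for a sequence `A → X → Q` with `Q` isomorphic to `X / A`. -/
theorem exact_of_isQuotientMap {A : Set X.carrier} (hA : X.cw.IsSubcomplex A) (hpt : X.pt ∈ A)
    (k : PtGMap X Q) (hk : IsQuotientMap k) (h : ∀ x y, k x = k y ↔ x = y ∨ (x ∈ A ∧ y ∈ A))
    (x : E.carrier X) : E.map (X.incl A hA hpt) x = 0 ↔ ∃ q, E.map k q = x := by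
  rw [E.exact]
  let p := X.proj A hA hpt
  have hp := X.isQuotientMap_proj A hA hpt
  let a : PtGMap _ Q := PtGMap.desc p hp k fun x y e => (h x y).2 (PtGCW.proj_eq_iff.1 e)
  let b : PtGMap Q _ := PtGMap.desc k hk p fun x y e => PtGCW.proj_eq_iff.2 ((h x y).1 e)
  have ha : a.comp p = k := PtGMap.desc_comp _ _ _ _
  have hb : b.comp k = p := PtGMap.desc_comp _ _ _ _
  constructor
  · rintro ⟨y, rfl⟩
    refine ⟨E.map b y, ?_⟩
    rw [← E.map_comp, hb]
  · rintro ⟨y, rfl⟩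
    refine ⟨E.map a y, ?_⟩
    rw [← E.map_comp]
    exact congrArg (fun f => E.map f y) ha

/-- Exactness for a sequence `B → X → Q` isomorphic to a cofibre sequence. -/
theorem exact_of_isCofib (f : PtGMap B X) (hf : f.IsCofib) (k : PtGMap X Q)
    (hk : IsQuotientMap k) (h : ∀ x y, k x = k y ↔ x = y ∨ (x ∈ range f ∧ y ∈ range f))
    (x : E.carrier X) : E.map f x = 0 ↔ ∃ q, E.map k q = x := by
  rw [← E.exact_of_isQuotientMap hf.isSubcomplex f.pt_mem_range k hk h]
  have hb := E.map_bijective _ (isHomeomorph_codRestrict hf)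
  rw [← map_eq_zero_iff _ hb.injective, ← E.map_comp]
  rfl

end MultCohomology

/-! ### Suspensions as quotients of `[0, 1] × X`, and their reparametrizations -/

instance Triv.compactSpace {K : Type} [TopologicalSpace K] [CompactSpace K] :
    CompactSpace (Triv.{u} K) := inferInstanceAs (CompactSpace (ULift.{u} K))

instance Triv.t2Space {K : Type} [TopologicalSpace K] [T2Space K] : T2Space (Triv.{u} K) :=
  inferInstanceAs (T2Space (ULift.{u} K))

theorem coe_circle_eq_of_unitInterval {s t : unitInterval}
    (h : ((s : ℝ) : UnitAddCircle) = (t : ℝ)) :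
    s = t ∨ ((s = 0 ∨ s = 1) ∧ (t = 0 ∨ t = 1)) := by
  have h1 : (((1 : unitInterval) : ℝ) : UnitAddCircle) = ((0 : ℝ) : UnitAddCircle) :=
    AddCircle.coe_period (1 : ℝ)
  have key : ∀ s : unitInterval, s ≠ 1 → 0 ≤ (s : ℝ) ∧ (s : ℝ) < 1 := fun s hs =>
    ⟨s.2.1, unitInterval.lt_one_iff_ne_one.2 hs⟩
  by_cases hs : s = 1 <;> by_cases ht : t = 1
  · exact .inl (hs.trans ht.symm)
  · refine .inr ⟨.inr hs, .inl ?_⟩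
    rw [hs, h1] at h
    exact Subtype.ext (coe_circle_eq ⟨le_rfl, one_pos⟩ (key t ht) h).symm
  · refine .inr ⟨.inl ?_, .inr ht⟩
    rw [ht, h1] at h
    exact Subtype.ext (coe_circle_eq (key s hs) ⟨le_rfl, one_pos⟩ h)
  · exact .inl (Subtype.ext (coe_circle_eq (key s hs) (key t ht) h))

variable {G : Type u} [Group G] [TopologicalSpace G]

namespace GMap

variable {X : GCWSpace G} {T : PtGCW G}

open Classical in
/-- The extension by the base point of an equivariant map on a closed subset. -/
noncomputable def extend {P Q : Set X.carrier} (hP : IsClosed P) (hQ : IsClosed Q)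
    (hPQ : ∀ x, x ∈ P ∨ x ∈ Q) (hPs : ∀ (g : G) x, g • x ∈ P ↔ x ∈ P)
    (f : P → T.carrier) (hf : Continuous f)
    (hfs : ∀ (g : G) x (h : x ∈ P) (h' : g • x ∈ P), f ⟨g • x, h'⟩ = g • f ⟨x, h⟩)
    (hfQ : ∀ x (h : x ∈ P), x ∈ Q → f ⟨x, h⟩ = T.pt) : GMap X T.toGCWSpace :=
  have h1 : ∀ x, x ∈ Q → (if h : x ∈ P then f ⟨x, h⟩ else T.pt) = T.pt := fun x hx => by
    split_ifs with h
    · exact hfQ x h hx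
    · rfl
  ⟨fun x => if h : x ∈ P then f ⟨x, h⟩ else T.pt, by
    rw [← continuousOn_univ, ← eq_univ_of_forall (s := P ∪ Q) hPQ]
    refine ContinuousOn.union_of_isClosed ?_ (continuousOn_const.congr h1) hP hQ
    rw [continuousOn_iff_continuous_domRestrict]
    exact hf.congr fun x => by rw [Set.domRestrict_apply, dif_pos x.2], fun g x => by
    by_cases h : x ∈ P
    · rw [dif_pos h, dif_pos ((hPs g x).2 h), hfs]
    · rw [dif_neg h, dif_neg fun h' => h ((hPs g x).1 h'), T.smul_pt]⟩

theorem extend_of_mem {P Q : Set X.carrier} {hP : IsClosed P} {hQ : IsClosed Q}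
    {hPQ : ∀ x, x ∈ P ∨ x ∈ Q} {hPs : ∀ (g : G) x, g • x ∈ P ↔ x ∈ P}
    {f : P → T.carrier} {hf : Continuous f}
    {hfs : ∀ (g : G) x (h : x ∈ P) (h' : g • x ∈ P), f ⟨g • x, h'⟩ = g • f ⟨x, h⟩}
    {hfQ : ∀ x (h : x ∈ P), x ∈ Q → f ⟨x, h⟩ = T.pt} {x : X.carrier} (h : x ∈ P) :
    (extend hP hQ hPQ hPs f hf hfs hfQ).toFun x = f ⟨x, h⟩ := dif_pos h

theorem extend_eq_pt {P Q : Set X.carrier} {hP : IsClosed P} {hQ : IsClosed Q}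
    {hPQ : ∀ x, x ∈ P ∨ x ∈ Q} {hPs : ∀ (g : G) x, g • x ∈ P ↔ x ∈ P}
    {f : P → T.carrier} {hf : Continuous f}
    {hfs : ∀ (g : G) x (h : x ∈ P) (h' : g • x ∈ P), f ⟨g • x, h'⟩ = g • f ⟨x, h⟩}
    {hfQ : ∀ x (h : x ∈ P), x ∈ Q → f ⟨x, h⟩ = T.pt} {x : X.carrier} (hx : x ∈ Q) :
    (extend hP hQ hPQ hPs f hf hfs hfQ).toFun x = T.pt := by
  by_cases h : x ∈ P
  · rw [extend_of_mem h, hfQ x h hx]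
  · exact dif_neg h

/-- The extension to `X₊` of a map from `X` to a pointed complex. -/
def plusLift (f : GMap X T.toGCWSpace) : PtGMap X.plus T :=
  ⟨⟨Sum.elim f.toFun fun _ => T.pt, f.continuous_toFun.sumElim continuous_const, by
    rintro g (x | x)
    · exact f.map_smul g x
    · exact (T.smul_pt g).symm⟩, rfl⟩

end GMap

namespace PtGCW

/-- The map `[0, 1] × X → S¹ × X`. -/
noncomputable def cylToCircleProd (X : PtGCW G) : PtGMap X.intervalProd X.circleProd :=
  ⟨⟨fun p => (Triv.mk ((p.1.val : ℝ) : UnitAddCircle), p.2),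
    (Triv.continuous_mk.comp ((AddCircle.continuous_mk' 1).comp
      (continuous_subtype_val.comp (Triv.continuous_val.comp continuous_fst)))).prodMk
      continuous_snd, fun _ _ => rfl⟩, rfl⟩

/-- The map `[0, 1] × X → ΣX`. -/
noncomputable def cylToSusp (X : PtGCW G) : PtGMap X.intervalProd X.susp :=
  X.toSusp.comp X.cylToCircleProd

/-- The map `[0, 1] → S¹` goes from a compact to a Hausdorff space and is therefore proper, so its
product with an arbitrary space is closed. -/
theorem isQuotientMap_cylToCircleProd (X : PtGCW G) : IsQuotientMap X.cylToCircleProd := by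
  have h : Continuous fun t : Triv.{u} unitInterval =>
      (Triv.mk.{u} (((t.val : unitInterval) : ℝ) : UnitAddCircle)) :=
    Triv.continuous_mk.comp ((AddCircle.continuous_mk' 1).comp
      (continuous_subtype_val.comp Triv.continuous_val))
  have h1 : IsClosedMap X.cylToCircleProd :=
    (h.isProperMap.prodMap (isProperMap_id (X := X.carrier))).isClosedMap
  refine h1.isQuotientMap X.cylToCircleProd.continuous ?_
  rintro ⟨θ, x⟩
  obtain ⟨t, ht, e⟩ := (AddCircle.coe_image_Ico_eq (1 : ℝ) 0).ge (mem_univ θ.val)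
  rw [zero_add] at ht
  exact ⟨(Triv.mk ⟨t, ht.1, ht.2.le⟩, x), Prod.ext (congrArg Triv.mk e) rfl⟩

theorem isQuotientMap_toSusp (X : PtGCW G) : IsQuotientMap X.toSusp :=
  X.circleProd.isQuotientMap_proj X.wedgeSet X.isSubcomplex_wedgeSet (.inl rfl)

theorem isQuotientMap_cylToSusp (X : PtGCW G) : IsQuotientMap X.cylToSusp :=
  X.isQuotientMap_toSusp.comp X.isQuotientMap_cylToCircleProd

theorem toSusp_eq_iff {X : PtGCW G} {p q : X.circleProd.carrier} :
    X.toSusp p = X.toSusp q ↔ p = q ∨ (p ∈ X.wedgeSet ∧ q ∈ X.wedgeSet) := GCW.mk_eq_iff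

theorem toSusp_eq_pt_iff {X : PtGCW G} {p : X.circleProd.carrier} :
    X.toSusp p = X.susp.pt ↔ p ∈ X.wedgeSet :=
  proj_eq_pt_iff (X := X.circleProd) (hA := X.isSubcomplex_wedgeSet) (hpt := .inl rfl)

theorem cylToSusp_eq_pt_iff {X : PtGCW G} {t : unitInterval} {x : X.carrier} :
    X.cylToSusp (Triv.mk t, x) = X.susp.pt ↔ t = 0 ∨ t = 1 ∨ x = X.pt := by
  refine toSusp_eq_pt_iff.trans ⟨fun h => ?_, fun h => ?_⟩
  · rcases h with h | h
    · rcases coe_circle_eq_of_unitInterval (s := t) (t := 0) (congrArg Triv.val h) with h | h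
      · exact .inl h
      · exact h.1.imp_right .inl
    · exact .inr (.inr h)
  · rcases h with rfl | rfl | h
    · exact .inl rfl
    · exact .inl (congrArg Triv.mk (AddCircle.coe_period (1 : ℝ)))
    · exact .inr h

theorem cylToSusp_eq {X : PtGCW G} {t t' : unitInterval} {x x' : X.carrier}
    (h : X.cylToSusp (Triv.mk t, x) = X.cylToSusp (Triv.mk t', x')) :
    (t = t' ∧ x = x') ∨
      (X.cylToSusp (Triv.mk t, x) = X.susp.pt ∧ X.cylToSusp (Triv.mk t', x') = X.susp.pt) := by
  rcases toSusp_eq_iff.1 h with e | e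
  · rcases coe_circle_eq_of_unitInterval (congrArg (fun y => y.1.val) e) with e' | e'
    · exact .inl ⟨e', congrArg Prod.snd e⟩
    · exact .inr ⟨cylToSusp_eq_pt_iff.2 (or_assoc.1 (.inl e'.1)),
        cylToSusp_eq_pt_iff.2 (or_assoc.1 (.inl e'.2))⟩
  · exact .inr ⟨toSusp_eq_pt_iff.2 e.1, toSusp_eq_pt_iff.2 e.2⟩

/-- The map out of `ΣX` given by a map on `[0, 1] × X`. -/
noncomputable def suspLift {X T : PtGCW G} (F : PtGMap X.intervalProd T)
    (h0 : ∀ x, F (Triv.mk 0, x) = T.pt) (h1 : ∀ x, F (Triv.mk 1, x) = T.pt)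
    (hpt : ∀ t, F (Triv.mk t, X.pt) = T.pt) : PtGMap X.susp T :=
  PtGMap.desc X.cylToSusp X.isQuotientMap_cylToSusp F (by
    have key : ∀ t x, X.cylToSusp (Triv.mk t, x) = X.susp.pt → F (Triv.mk t, x) = T.pt := by
      intro t x h
      rcases cylToSusp_eq_pt_iff.1 h with rfl | rfl | rfl
      · exact h0 x
      · exact h1 x
      · exact hpt t
    rintro ⟨⟨t⟩, x⟩ ⟨⟨t'⟩, x'⟩ h
    rcases cylToSusp_eq h with ⟨rfl, rfl⟩ | ⟨e, e'⟩
    · rfl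
    · exact (key t x e).trans (key t' x' e').symm)

theorem suspLift_apply {X T : PtGCW G} (F : PtGMap X.intervalProd T)
    (h0 : ∀ x, F (Triv.mk 0, x) = T.pt) (h1 : ∀ x, F (Triv.mk 1, x) = T.pt)
    (hpt : ∀ t, F (Triv.mk t, X.pt) = T.pt) (p : X.intervalProd.carrier) :
    suspLift F h0 h1 hpt (X.cylToSusp p) = F p := PtGMap.desc_apply _ _ _ _ p

theorem susp_map_cylToSusp {X Y : PtGCW G} (f : PtGMap X Y) (t : unitInterval) (x : X.carrier) :
    f.susp (X.cylToSusp (Triv.mk t, x)) = Y.cylToSusp (Triv.mk t, f x) := rfl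

/-- The map `Σφ : ΣX → ΣX` that reparametrizes the suspension coordinate. -/
noncomputable def reparam (X : PtGCW G) (φ : C(unitInterval, unitInterval))
    (h0 : φ 0 = 0 ∨ φ 0 = 1) (h1 : φ 1 = 0 ∨ φ 1 = 1) : PtGMap X.susp X.susp :=
  suspLift ⟨⟨fun p => X.cylToSusp (Triv.mk (φ p.1.val), p.2),
    X.cylToSusp.continuous.comp ((Triv.continuous_mk.comp (φ.continuous.comp
      (Triv.continuous_val.comp continuous_fst))).prodMk continuous_snd), fun _ _ => rfl⟩,
    cylToSusp_eq_pt_iff.2 (.inr (.inr rfl))⟩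
    (fun _ => cylToSusp_eq_pt_iff.2 (or_assoc.1 (.inl h0)))
    (fun _ => cylToSusp_eq_pt_iff.2 (or_assoc.1 (.inl h1)))
    (fun _ => cylToSusp_eq_pt_iff.2 (.inr (.inr rfl)))

theorem reparam_apply (X : PtGCW G) (φ : C(unitInterval, unitInterval))
    (h0 : φ 0 = 0 ∨ φ 0 = 1) (h1 : φ 1 = 0 ∨ φ 1 = 1) (t : unitInterval) (x : X.carrier) :
    X.reparam φ h0 h1 (X.cylToSusp (Triv.mk t, x)) = X.cylToSusp (Triv.mk (φ t), x) :=
  suspLift_apply _ _ _ _ _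

theorem susp_comp_reparam {X Y : PtGCW G} (f : PtGMap X Y) (φ : C(unitInterval, unitInterval))
    (h0 : φ 0 = 0 ∨ φ 0 = 1) (h1 : φ 1 = 0 ∨ φ 1 = 1) :
    f.susp.comp (X.reparam φ h0 h1) = (Y.reparam φ h0 h1).comp f.susp := by
  refine PtGMap.ext fun y => ?_
  obtain ⟨⟨⟨t⟩, x⟩, rfl⟩ := X.isQuotientMap_cylToSusp.surjective y
  change f.susp (X.reparam φ h0 h1 (X.cylToSusp (Triv.mk t, x))) =
    Y.reparam φ h0 h1 (Y.cylToSusp (Triv.mk t, f x))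
  rw [reparam_apply, reparam_apply, susp_map_cylToSusp]

theorem reparam_id (X : PtGCW G) :
    X.reparam (ContinuousMap.id _) (.inl rfl) (.inr rfl) = PtGMap.id X.susp := by
  refine PtGMap.ext fun y => ?_
  obtain ⟨⟨⟨t⟩, x⟩, rfl⟩ := X.isQuotientMap_cylToSusp.surjective y
  exact reparam_apply X _ _ _ t x

/-- The straight-line homotopy between `φ` and `ψ` is constant at both endpoints and therefore
descends to the suspension. Only the endpoint values of a reparametrization matter. -/
theorem reparam_homotopic (X : PtGCW G) (φ ψ : C(unitInterval, unitInterval))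
    (h0 : φ 0 = 0 ∨ φ 0 = 1) (h1 : φ 1 = 0 ∨ φ 1 = 1) (h0' : ψ 0 = φ 0) (h1' : ψ 1 = φ 1) :
    (X.reparam φ h0 h1).Homotopic (X.reparam ψ (h0' ▸ h0) (h1' ▸ h1)) := by
  let m : unitInterval × unitInterval → unitInterval := fun p =>
    ⟨(1 - (p.1 : ℝ)) * (φ p.2 : ℝ) + (p.1 : ℝ) * (ψ p.2 : ℝ), by
      have := (convex_Icc (0 : ℝ) 1) (φ p.2).2 (ψ p.2).2 (sub_nonneg.2 p.1.2.2) p.1.2.1 (by ring)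
      simpa using this⟩
  have hm : Continuous m := Continuous.subtype_mk (by fun_prop) _
  have hm0 : ∀ t, m (0, t) = φ t := fun t => Subtype.ext (by simp [m])
  have hm1 : ∀ t, m (1, t) = ψ t := fun t => Subtype.ext (by simp [m])
  have hm0' : ∀ s, m (s, 0) = φ 0 := fun s => Subtype.ext (by simp [m, h0']; ring)
  have hm1' : ∀ s, m (s, 1) = φ 1 := fun s => Subtype.ext (by simp [m, h1']; ring)
  refine PtGMap.homotopic_of_isQuotientMap X.cylToSusp X.isQuotientMap_cylToSusp _ _
    (fun p => X.cylToSusp (Triv.mk (m (p.1, p.2.1.val)), p.2.2)) ?_ ?_ ?_ ?_ ?_ ?_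
  · exact X.cylToSusp.continuous.comp ((Triv.continuous_mk.comp (hm.comp (continuous_fst.prodMk
      (Triv.continuous_val.comp (continuous_fst.comp continuous_snd))))).prodMk
      (continuous_snd.comp continuous_snd))
  · exact fun _ _ _ => rfl
  · exact fun _ => cylToSusp_eq_pt_iff.2 (.inr (.inr rfl))
  · rintro ⟨⟨t⟩, x⟩
    exact (congrArg (fun r => X.cylToSusp (Triv.mk r, x)) (hm0 t)).trans
      (reparam_apply X _ _ _ t x).symm
  · rintro ⟨⟨t⟩, x⟩
    exact (congrArg (fun r => X.cylToSusp (Triv.mk r, x)) (hm1 t)).trans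
      (reparam_apply X _ _ _ t x).symm
  · have key : ∀ s t x, X.cylToSusp (Triv.mk t, x) = X.susp.pt →
        X.cylToSusp (Triv.mk (m (s, t)), x) = X.susp.pt := by
      intro s t x h
      rcases cylToSusp_eq_pt_iff.1 h with rfl | rfl | rfl
      · exact cylToSusp_eq_pt_iff.2 (or_assoc.1 (.inl (by rwa [hm0'])))
      · exact cylToSusp_eq_pt_iff.2 (or_assoc.1 (.inl (by rwa [hm1'])))
      · exact cylToSusp_eq_pt_iff.2 (.inr (.inr rfl))
    rintro s ⟨⟨t⟩, x⟩ ⟨⟨t'⟩, x'⟩ h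
    rcases cylToSusp_eq h with ⟨rfl, rfl⟩ | ⟨e, e'⟩
    · rfl
    · exact (key s t x e).trans (key s t' x' e').symm

/-! ### Maps of quotients, and the space `Y ∪ S¹ × B` over `ΣB` -/

section

variable (Y : PtGCW G) {B : Set Y.carrier} (hB : Y.cw.IsSubcomplex B) (hpt : Y.pt ∈ B)

/-- The map of quotients induced by a map of pairs. -/
noncomputable def _root_.PtGMap.quotMap {Y Y' : PtGCW G} (g : PtGMap Y Y') {B : Set Y.carrier}
    {B' : Set Y'.carrier} (hB : Y.cw.IsSubcomplex B) (hpt : Y.pt ∈ B)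
    (hB' : Y'.cw.IsSubcomplex B') (hpt' : Y'.pt ∈ B') (h : ∀ y ∈ B, g y ∈ B') :
    PtGMap (Y.quot B hB hpt) (Y'.quot B' hB' hpt') :=
  PtGMap.quotLift hB hpt ((Y'.proj B' hB' hpt').comp g) fun y hy => proj_eq_pt_iff.2 (h y hy)

/-- The subspace `Y ∪ S¹ × B` of `S¹ × Y`. -/
noncomputable def loopCyl : PtGCW G :=
  Y.circleProd.sub ({Triv.mk 0} ×ˢ univ ∪ univ ×ˢ B)
    ((GCW.isSubcomplex_circle_zero.prod GCW.isSubcomplex_univ).union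
      (GCW.isSubcomplex_univ.prod hB)) (.inl ⟨rfl, trivial⟩)

/-- The projection `Y ∪ S¹ × B → Y`. -/
noncomputable def loopCylSnd : PtGMap (Y.loopCyl hB) Y :=
  Y.sndMap.comp (Y.circleProd.incl _ _ _)

/-- The projection `Y ∪ S¹ × B → S¹`. -/
noncomputable def loopCylFst : PtGMap (Y.loopCyl hB) (circle G) :=
  Y.fstMap.comp (Y.circleProd.incl _ _ _)

/-- The inclusion `S¹ × B → Y ∪ S¹ × B`. -/
noncomputable def circleProdToLoopCyl :
    PtGMap (Y.sub B hB hpt).circleProd (Y.loopCyl hB) :=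
  ⟨⟨fun p => ⟨(p.1, p.2.1), .inr ⟨trivial, p.2.2⟩⟩,
    ((Y.sub B hB hpt).fstMap.continuous.prodMk ((Y.incl B hB hpt).continuous.comp
      (Y.sub B hB hpt).sndMap.continuous)).subtype_mk _, fun _ _ => rfl⟩, rfl⟩

/-- The unpointed map underlying `loopCylToSusp`. -/
noncomputable def loopCylCollapse :
    GMap (Y.loopCyl hB).toGCWSpace (Y.sub B hB hpt).susp.toGCWSpace :=
  GMap.extend (X := (Y.loopCyl hB).toGCWSpace) (T := (Y.sub B hB hpt).susp)
    (P := {p | Y.loopCylSnd hB p ∈ B}) (Q := {p | Y.loopCylFst hB p = Triv.mk 0})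
    (hB.isClosed.preimage (Y.loopCylSnd hB).continuous)
    ((isClosed_singleton (X := Triv.{u} UnitAddCircle)).preimage (Y.loopCylFst hB).continuous)
    (fun p => p.2.elim (fun h => .inr h.1) fun h => .inl h.2)
    (fun g _ => hB.smul_mem_iff g)
    (fun p => (Y.sub B hB hpt).toSusp (Y.loopCylFst hB p.1, ⟨Y.loopCylSnd hB p.1, p.2⟩))
    ((Y.sub B hB hpt).toSusp.continuous.comp
      (((Y.loopCylFst hB).continuous.comp continuous_subtype_val).prodMk
        (((Y.loopCylSnd hB).continuous.comp continuous_subtype_val).subtype_mk _)))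
    (fun _ _ _ _ => rfl) (fun _ _ h => toSusp_eq_pt_iff.2 (.inl h))

theorem loopCylCollapse_eq_pt {p : (Y.loopCyl hB).carrier} (h : p.1.1 = Triv.mk 0) :
    (Y.loopCylCollapse hB hpt).toFun p = (Y.sub B hB hpt).susp.pt :=
  GMap.extend_eq_pt (X := (Y.loopCyl hB).toGCWSpace) (T := (Y.sub B hB hpt).susp) (x := p) h

/-- The collapse `Y ∪ S¹ × B → ΣB` of `Y`. -/
noncomputable def loopCylToSusp : PtGMap (Y.loopCyl hB) (Y.sub B hB hpt).susp :=
  ⟨Y.loopCylCollapse hB hpt, Y.loopCylCollapse_eq_pt hB hpt rfl⟩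

theorem loopCylToSusp_of_mem {p : (Y.loopCyl hB).carrier} (h : p.1.2 ∈ B) :
    Y.loopCylToSusp hB hpt p = (Y.sub B hB hpt).toSusp (p.1.1, ⟨p.1.2, h⟩) :=
  dif_pos (c := p.1.2 ∈ B) h

theorem loopCylToSusp_eq_pt {p : (Y.loopCyl hB).carrier} (h : p.1.1 = Triv.mk 0) :
    Y.loopCylToSusp hB hpt p = (Y.sub B hB hpt).susp.pt :=
  Y.loopCylCollapse_eq_pt hB hpt h

theorem loopCylToSusp_comp_circleProd :
    (Y.loopCylToSusp hB hpt).comp (Y.circleProdToLoopCyl hB hpt) = (Y.sub B hB hpt).toSusp :=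
  PtGMap.ext fun p => Y.loopCylToSusp_of_mem hB hpt (p := Y.circleProdToLoopCyl hB hpt p) p.2.2

/-- The part `Y ∨ S¹` of `Y ∪ S¹ × B`. -/
def loopBase : Set (Y.loopCyl hB).carrier := {p | p.1.1 = Triv.mk 0 ∨ p.1.2 = Y.pt}

theorem isSubcomplex_loopBase : (Y.loopCyl hB).cw.IsSubcomplex (Y.loopBase hB) := by
  have := GCW.IsSubcomplex.preimage_val (K := Y.circleProd.cw)
    ((GCW.isSubcomplex_circle_zero.prod GCW.isSubcomplex_univ).union
      (GCW.isSubcomplex_univ.prod hB))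
    ((GCW.isSubcomplex_circle_zero.prod (K := Y.cw) GCW.isSubcomplex_univ).union
      (GCW.isSubcomplex_univ.prod Y.isSubcomplex_pt))
  refine cast (congrArg _ (Set.ext fun p => ?_)) this
  symm
  exact ⟨fun h => h.imp (fun h => ⟨h, trivial⟩) fun h => ⟨trivial, h⟩,
    fun h => h.imp (fun h => h.1) fun h => h.2⟩

/-- Already its composite with `S¹ × B → Y ∪ S¹ × B` is the quotient map onto `ΣB`. -/
theorem isQuotientMap_loopCylToSusp : IsQuotientMap (Y.loopCylToSusp hB hpt) := by
  refine .of_comp (Y.circleProdToLoopCyl hB hpt).continuous (PtGMap.continuous _) ?_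
  have := (Y.sub B hB hpt).isQuotientMap_toSusp
  rwa [← loopCylToSusp_comp_circleProd] at this

theorem loopCylToSusp_eq_pt_iff {p : (Y.loopCyl hB).carrier} :
    Y.loopCylToSusp hB hpt p = (Y.sub B hB hpt).susp.pt ↔ p ∈ Y.loopBase hB := by
  by_cases h : p.1.2 ∈ B
  · rw [loopCylToSusp_of_mem _ _ _ h]
    exact toSusp_eq_pt_iff.trans ⟨fun h => h.imp id fun h => congrArg Subtype.val h,
      fun h => h.imp id fun h => Subtype.ext h⟩
  · have h' := p.2.resolve_right fun h' => h h'.2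
    exact iff_of_true (Y.loopCylToSusp_eq_pt hB hpt h'.1) (.inl h'.1)

/-- Together with `isQuotientMap_loopCylToSusp` this presents `ΣB` as the quotient of `Y ∪ S¹ × B`
by `Y ∨ S¹`, so that exactness applies to the collapse. -/
theorem loopCylToSusp_eq_iff (p q : (Y.loopCyl hB).carrier) :
    Y.loopCylToSusp hB hpt p = Y.loopCylToSusp hB hpt q ↔
      p = q ∨ (p ∈ Y.loopBase hB ∧ q ∈ Y.loopBase hB) := by
  refine ⟨fun h => ?_, fun h => ?_⟩
  · by_cases hp : p ∈ Y.loopBase hB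
    · rw [(Y.loopCylToSusp_eq_pt_iff hB hpt).2 hp] at h
      exact .inr ⟨hp, (Y.loopCylToSusp_eq_pt_iff hB hpt).1 h.symm⟩
    · have hq : q ∉ Y.loopBase hB := fun hq => hp <| by
        rwa [(Y.loopCylToSusp_eq_pt_iff hB hpt).2 hq, loopCylToSusp_eq_pt_iff] at h
      have hmem : ∀ p : (Y.loopCyl hB).carrier, p ∉ Y.loopBase hB → p.1.2 ∈ B := fun p hp =>
        (p.2.resolve_left fun h => hp (.inl h.1)).2
      rw [loopCylToSusp_of_mem _ _ _ (hmem p hp), loopCylToSusp_of_mem _ _ _ (hmem q hq)] at h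
      rcases toSusp_eq_iff.1 h with e | e
      · exact .inl (Subtype.ext (Prod.ext (congrArg (fun y => y.1) e)
          (congrArg (fun y => y.2.1) e)))
      · exact absurd (e.1.imp id fun h => congrArg Subtype.val h) hp
  · rcases h with rfl | h
    · rfl
    · rw [(Y.loopCylToSusp_eq_pt_iff hB hpt).2 h.1, (Y.loopCylToSusp_eq_pt_iff hB hpt).2 h.2]

end

/-- The point of the circle given by a point of `[0, 1]`. -/
def circleMk (t : unitInterval) : Triv.{u} UnitAddCircle := Triv.mk ((t : ℝ) : UnitAddCircle)

theorem circleMk_one : circleMk.{u} 1 = Triv.mk 0 :=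
  congrArg Triv.mk (AddCircle.coe_period (1 : ℝ))

/-! ### Mapping cones and the Puppe sequence -/

section

variable (Y : PtGCW G) {B : Set Y.carrier} (hB : Y.cw.IsSubcomplex B) (hpt : Y.pt ∈ B)

/-- The subspace `{1} × Y ∪ [0, 1] × B` of `[0, 1] × Y`. -/
noncomputable def mappingCyl : PtGCW G :=
  Y.intervalProd.sub ({Triv.mk 1} ×ˢ univ ∪ univ ×ˢ B)
    ((GCW.isSubcomplex_interval_one.prod GCW.isSubcomplex_univ).union
      (GCW.isSubcomplex_univ.prod hB)) (.inr ⟨trivial, hpt⟩)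

/-- The coordinate in `[0, 1]`. -/
noncomputable def mappingCylFst (p : (Y.mappingCyl hB hpt).carrier) : unitInterval := p.1.1.val

/-- The projection `{1} × Y ∪ [0, 1] × B → Y`. -/
noncomputable def mappingCylSnd : PtGMap (Y.mappingCyl hB hpt) Y :=
  ⟨⟨fun p => p.1.2, continuous_snd.comp (Y.intervalProd.incl _ _ _).continuous, fun _ _ => rfl⟩,
    rfl⟩

theorem continuous_mappingCylFst : Continuous (Y.mappingCylFst hB hpt) :=
  Triv.continuous_val.comp (continuous_fst.comp (Y.intervalProd.incl _ _ _).continuous)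

variable {Y hB hpt} in
theorem mappingCyl_cases (p : (Y.mappingCyl hB hpt).carrier) :
    Y.mappingCylFst hB hpt p = 1 ∨ Y.mappingCylSnd hB hpt p ∈ B :=
  p.2.imp (fun h => congrArg Triv.val h.1) fun h => h.2

variable {Y hB hpt} in
theorem mappingCyl_ext {p q : (Y.mappingCyl hB hpt).carrier}
    (h1 : Y.mappingCylFst hB hpt p = Y.mappingCylFst hB hpt q)
    (h2 : Y.mappingCylSnd hB hpt p = Y.mappingCylSnd hB hpt q) : p = q :=
  Subtype.ext (Prod.ext (congrArg Triv.mk h1) h2)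

/-- A point of `{1} × Y ∪ [0, 1] × B`. -/
noncomputable def mappingCylMk (t : unitInterval) (y : Y.carrier) (h : t = 1 ∨ y ∈ B) :
    (Y.mappingCyl hB hpt).carrier :=
  ⟨(Triv.mk t, y), h.imp (fun h => ⟨congrArg Triv.mk h, trivial⟩) fun h => ⟨trivial, h⟩⟩

theorem continuous_mappingCylMk {Z : Type*} [TopologicalSpace Z] {f : Z → unitInterval}
    {g : Z → Y.carrier} (hf : Continuous f) (hg : Continuous g) (h : ∀ z, f z = 1 ∨ g z ∈ B) :
    Continuous fun z => Y.mappingCylMk hB hpt (f z) (g z) (h z) :=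
  ((Triv.continuous_mk.comp hf).prodMk hg).subtype_mk _

/-- The part of the mapping cylinder that is collapsed in the mapping cone. -/
def mappingCylEnd : Set (Y.mappingCyl hB hpt).carrier :=
  {p | Y.mappingCylFst hB hpt p = 0 ∨ Y.mappingCylSnd hB hpt p = Y.pt}

theorem isSubcomplex_mappingCylEnd :
    (Y.mappingCyl hB hpt).cw.IsSubcomplex (Y.mappingCylEnd hB hpt) := by
  have := GCW.IsSubcomplex.preimage_val (K := Y.intervalProd.cw)
    ((GCW.isSubcomplex_interval_one.prod GCW.isSubcomplex_univ).union
      (GCW.isSubcomplex_univ.prod hB))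
    ((GCW.isSubcomplex_interval_zero.prod (K := Y.cw) GCW.isSubcomplex_univ).union
      (GCW.isSubcomplex_univ.prod Y.isSubcomplex_pt))
  refine cast (congrArg _ (Set.ext fun p => ?_)) this
  exact ⟨fun h => h.imp (fun h => congrArg Triv.val h.1) fun h => h.2,
    fun h => h.imp (fun h => ⟨congrArg Triv.mk h, trivial⟩) fun h => ⟨trivial, h⟩⟩

/-- The mapping cone of the inclusion of `B` in `Y`, that is, the union of `Y` and the reduced
cone on `B`. -/
noncomputable def mappingCone : PtGCW G :=
  (Y.mappingCyl hB hpt).quot (Y.mappingCylEnd hB hpt) (Y.isSubcomplex_mappingCylEnd hB hpt)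
    (.inl rfl)

/-- The projection of the mapping cylinder onto the mapping cone. -/
noncomputable def coneProj : PtGMap (Y.mappingCyl hB hpt) (Y.mappingCone hB hpt) :=
  (Y.mappingCyl hB hpt).proj (Y.mappingCylEnd hB hpt) (Y.isSubcomplex_mappingCylEnd hB hpt)
    (.inl rfl)

theorem isQuotientMap_coneProj : IsQuotientMap (Y.coneProj hB hpt) :=
  (Y.mappingCyl hB hpt).isQuotientMap_proj _ _ _

variable {Y hB hpt} in
theorem coneProj_eq_iff {p q : (Y.mappingCyl hB hpt).carrier} :
    Y.coneProj hB hpt p = Y.coneProj hB hpt q ↔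
      p = q ∨ (p ∈ Y.mappingCylEnd hB hpt ∧ q ∈ Y.mappingCylEnd hB hpt) := proj_eq_iff

variable {Y hB hpt} in
theorem coneProj_eq_pt_iff {p : (Y.mappingCyl hB hpt).carrier} :
    Y.coneProj hB hpt p = (Y.mappingCone hB hpt).pt ↔ p ∈ Y.mappingCylEnd hB hpt :=
  proj_eq_pt_iff

/-- The map out of the mapping cone given by a map on the mapping cylinder. -/
noncomputable def coneLift {T : PtGCW G} (F : PtGMap (Y.mappingCyl hB hpt) T)
    (h : ∀ p ∈ Y.mappingCylEnd hB hpt, F p = T.pt) : PtGMap (Y.mappingCone hB hpt) T :=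
  PtGMap.quotLift (Y.isSubcomplex_mappingCylEnd hB hpt) (.inl rfl) F h

theorem coneLift_apply {T : PtGCW G} (F : PtGMap (Y.mappingCyl hB hpt) T)
    (h : ∀ p ∈ Y.mappingCylEnd hB hpt, F p = T.pt) (p : (Y.mappingCyl hB hpt).carrier) :
    Y.coneLift hB hpt F h (Y.coneProj hB hpt p) = F p :=
  PtGMap.quotLift_apply _ _ _ _ p

/-- The inclusion of `Y` in the mapping cylinder. -/
noncomputable def mappingCylIncl : C(Y.carrier, (Y.mappingCyl hB hpt).carrier) :=
  ⟨fun y => Y.mappingCylMk hB hpt 1 y (.inl rfl),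
    Y.continuous_mappingCylMk hB hpt continuous_const continuous_id _⟩

/-- The inclusion of `Y` in the mapping cone. -/
noncomputable def coneIncl : PtGMap Y (Y.mappingCone hB hpt) :=
  ⟨⟨fun y => Y.coneProj hB hpt (Y.mappingCylIncl hB hpt y),
    (Y.coneProj hB hpt).continuous.comp (Y.mappingCylIncl hB hpt).continuous, fun _ _ => rfl⟩,
    coneProj_eq_pt_iff.2 (.inr rfl)⟩

/-- The map from `[0, 1] × B` to the mapping cone. -/
noncomputable def cylToCone : PtGMap (Y.sub B hB hpt).intervalProd (Y.mappingCone hB hpt) :=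
  ⟨⟨fun p => Y.coneProj hB hpt (Y.mappingCylMk hB hpt p.1.val p.2.1 (.inr p.2.2)),
    (Y.coneProj hB hpt).continuous.comp (Y.continuous_mappingCylMk hB hpt
      (Triv.continuous_val.comp continuous_fst)
      ((Y.incl B hB hpt).continuous.comp continuous_snd) _), fun _ _ => rfl⟩,
    coneProj_eq_pt_iff.2 (.inl rfl)⟩

/-- The collapse of the cone on `B`. -/
noncomputable def coneToQuot : PtGMap (Y.mappingCone hB hpt) (Y.quot B hB hpt) :=
  Y.coneLift hB hpt ((Y.proj B hB hpt).comp (Y.mappingCylSnd hB hpt)) fun p hp => by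
    refine proj_eq_pt_iff.2 ?_
    rcases mappingCyl_cases p with h1 | h1
    · rcases hp with h | h
      · exact absurd (h.symm.trans h1) zero_ne_one
      · rw [h]
        exact hpt
    · exact h1

theorem coneToQuot_apply (p : (Y.mappingCyl hB hpt).carrier) :
    Y.coneToQuot hB hpt (Y.coneProj hB hpt p) = Y.proj B hB hpt (Y.mappingCylSnd hB hpt p) :=
  Y.coneLift_apply hB hpt _ _ p

theorem coneToQuot_comp_coneIncl :
    (Y.coneToQuot hB hpt).comp (Y.coneIncl hB hpt) = Y.proj B hB hpt :=
  PtGMap.ext fun _ => Y.coneToQuot_apply hB hpt _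

/-- The map from the mapping cylinder to `Y ∪ S¹ × B`. -/
noncomputable def mappingCylToLoopCyl : PtGMap (Y.mappingCyl hB hpt) (Y.loopCyl hB) :=
  ⟨⟨fun p => ⟨Y.cylToCircleProd p.1, p.2.imp
      (fun h => ⟨(congrArg (fun t => circleMk (Triv.val t)) h.1).trans circleMk_one, trivial⟩)
      fun h => ⟨trivial, h.2⟩⟩,
    (Y.cylToCircleProd.continuous.comp (Y.intervalProd.incl _ _ _).continuous).subtype_mk _,
    fun _ _ => rfl⟩, rfl⟩

/-- The collapse of `Y` in the mapping cone. -/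
noncomputable def coneToSusp : PtGMap (Y.mappingCone hB hpt) (Y.sub B hB hpt).susp :=
  Y.coneLift hB hpt ((Y.loopCylToSusp hB hpt).comp (Y.mappingCylToLoopCyl hB hpt)) fun p hp =>
    (Y.loopCylToSusp_eq_pt_iff hB hpt).2 <| hp.imp
      (fun h => (congrArg circleMk h : circleMk (Y.mappingCylFst hB hpt p) = circleMk 0))
      fun h => h

theorem coneToSusp_apply (p : (Y.mappingCyl hB hpt).carrier) :
    Y.coneToSusp hB hpt (Y.coneProj hB hpt p) =
      Y.loopCylToSusp hB hpt (Y.mappingCylToLoopCyl hB hpt p) :=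
  Y.coneLift_apply hB hpt _ _ p

theorem coneToSusp_of_mem (p : (Y.mappingCyl hB hpt).carrier) (h : Y.mappingCylSnd hB hpt p ∈ B) :
    Y.coneToSusp hB hpt (Y.coneProj hB hpt p) = (Y.sub B hB hpt).cylToSusp
      (Triv.mk (Y.mappingCylFst hB hpt p), ⟨Y.mappingCylSnd hB hpt p, h⟩) :=
  (Y.coneToSusp_apply hB hpt p).trans
    (Y.loopCylToSusp_of_mem hB hpt (p := Y.mappingCylToLoopCyl hB hpt p) h)

theorem coneToSusp_eq_pt (p : (Y.mappingCyl hB hpt).carrier) (h : Y.mappingCylFst hB hpt p = 1) :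
    Y.coneToSusp hB hpt (Y.coneProj hB hpt p) = (Y.sub B hB hpt).susp.pt :=
  (Y.coneToSusp_apply hB hpt p).trans
    (Y.loopCylToSusp_eq_pt hB hpt (p := Y.mappingCylToLoopCyl hB hpt p)
      ((congrArg circleMk h).trans circleMk_one))

theorem coneToSusp_coneIncl (y : Y.carrier) :
    Y.coneToSusp hB hpt (Y.coneIncl hB hpt y) = (Y.sub B hB hpt).susp.pt :=
  Y.coneToSusp_eq_pt hB hpt _ rfl

theorem coneToSusp_comp_cylToCone :
    (Y.coneToSusp hB hpt).comp (Y.cylToCone hB hpt) = (Y.sub B hB hpt).cylToSusp :=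
  PtGMap.ext fun p => Y.coneToSusp_of_mem hB hpt
    (Y.mappingCylMk hB hpt p.1.val p.2.1 (.inr p.2.2)) p.2.2

theorem isQuotientMap_coneToSusp : IsQuotientMap (Y.coneToSusp hB hpt) := by
  refine .of_comp (Y.cylToCone hB hpt).continuous (PtGMap.continuous _) ?_
  have := (Y.sub B hB hpt).isQuotientMap_cylToSusp
  rwa [← coneToSusp_comp_cylToCone] at this

theorem range_coneIncl : range (Y.coneIncl hB hpt) =
    Y.coneProj hB hpt '' {p | Y.mappingCylFst hB hpt p = 1} := by
  ext m
  constructor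
  · rintro ⟨y, rfl⟩
    exact ⟨_, rfl, rfl⟩
  · rintro ⟨p, h, rfl⟩
    exact ⟨Y.mappingCylSnd hB hpt p,
      congrArg (Y.coneProj hB hpt) (mappingCyl_ext (Eq.symm h) rfl)⟩

/-- Needed twice: for the exactness of `Y → M → ΣB`, where `M` is the cone, and for forming the cone
of `Y` in `M`. -/
theorem isCofib_coneIncl : (Y.coneIncl hB hpt).IsCofib := by
  constructor
  · refine .of_continuous_injective_isClosedMap (PtGMap.continuous _) (fun y y' h => ?_) ?_
    · rcases coneProj_eq_iff.1 h with h | ⟨h, h'⟩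
      · exact congrArg (Y.mappingCylSnd hB hpt) h
      -- At height one only the base point of `Y` belongs to the collapsed part.
      · exact (h.resolve_left one_ne_zero).trans (h'.resolve_left one_ne_zero).symm
    · refine ((Y.mappingCyl hB hpt).isClosedMap_proj _ _ _).comp (f := Y.mappingCylIncl hB hpt) ?_
      intro F hF
      convert (hF.preimage (Y.mappingCylSnd hB hpt).continuous).inter
        (isClosed_singleton.preimage (Y.continuous_mappingCylFst hB hpt) (t := {1})) using 1
      ext p
      constructor
      · rintro ⟨y, hy, rfl⟩
        exact ⟨hy, rfl⟩
      · rintro ⟨h, h'⟩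
        exact ⟨_, h, mappingCyl_ext (Eq.symm h') rfl⟩
  · rw [range_coneIncl]
    refine isSubcomplex_image_proj _ _ ?_
    have := GCW.IsSubcomplex.preimage_val (K := Y.intervalProd.cw)
      ((GCW.isSubcomplex_interval_one.prod GCW.isSubcomplex_univ).union
        (GCW.isSubcomplex_univ.prod hB))
      (GCW.isSubcomplex_interval_one.prod (K := Y.cw) GCW.isSubcomplex_univ)
    refine cast (congrArg _ (Set.ext fun p => ?_)) this
    exact ⟨fun h => congrArg Triv.val h.1, fun h => ⟨congrArg Triv.mk h, trivial⟩⟩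

theorem coneToSusp_eq_pt_iff (m : (Y.mappingCone hB hpt).carrier) :
    Y.coneToSusp hB hpt m = (Y.sub B hB hpt).susp.pt ↔ m ∈ range (Y.coneIncl hB hpt) := by
  constructor
  · intro h
    obtain ⟨p, rfl⟩ := (Y.isQuotientMap_coneProj hB hpt).surjective m
    rcases mappingCyl_cases p with h1 | h1
    · rw [range_coneIncl]
      exact ⟨p, h1, rfl⟩
    · replace h := cylToSusp_eq_pt_iff.1 ((Y.coneToSusp_of_mem hB hpt p h1).symm.trans h)
      have hend : p ∈ Y.mappingCylEnd hB hpt → Y.coneProj hB hpt p ∈ range (Y.coneIncl hB hpt) :=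
        fun hp => by
          rw [coneProj_eq_pt_iff.2 hp]
          exact (Y.coneIncl hB hpt).pt_mem_range
      rcases h with h | h | h
      · exact hend (.inl h)
      · rw [range_coneIncl]
        exact ⟨p, h, rfl⟩
      · exact hend (.inr (congrArg Subtype.val h))
  · rintro ⟨y, rfl⟩
    exact Y.coneToSusp_coneIncl hB hpt y

/-- The fibres are those of the collapse of `Y`, so `ΣB` may stand for the quotient of the cone by
`Y` in the exactness axiom. -/
theorem coneToSusp_eq_iff (m n : (Y.mappingCone hB hpt).carrier) :
    Y.coneToSusp hB hpt m = Y.coneToSusp hB hpt n ↔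
      m = n ∨ (m ∈ range (Y.coneIncl hB hpt) ∧ n ∈ range (Y.coneIncl hB hpt)) := by
  simp only [← coneToSusp_eq_pt_iff]
  refine ⟨fun h => ?_, fun h => h.elim (congrArg _) fun h => h.1.trans h.2.symm⟩
  obtain ⟨p, rfl⟩ := (Y.isQuotientMap_coneProj hB hpt).surjective m
  obtain ⟨q, rfl⟩ := (Y.isQuotientMap_coneProj hB hpt).surjective n
  rcases mappingCyl_cases p with hp | hp
  · rw [Y.coneToSusp_eq_pt hB hpt p hp] at h ⊢
    exact .inr ⟨rfl, h.symm⟩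
  rcases mappingCyl_cases q with hq | hq
  · rw [Y.coneToSusp_eq_pt hB hpt q hq] at h ⊢
    exact .inr ⟨h, rfl⟩
  rw [Y.coneToSusp_of_mem hB hpt p hp, Y.coneToSusp_of_mem hB hpt q hq] at h ⊢
  rcases cylToSusp_eq h with ⟨h1, h2⟩ | h
  · exact .inl (congrArg _ (mappingCyl_ext h1 (congrArg Subtype.val h2)))
  · exact .inr h

/-- The retraction of `[0, 1] × Y` onto the mapping cylinder, as a map to the mapping cone. -/
noncomputable def cylRetract (p : unitInterval × Y.carrier) : (Y.mappingCone hB hpt).carrier :=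
  Y.coneProj hB hpt (Y.mappingCylMk hB hpt (Y.cw.retract B p).1 (Y.cw.retract B p).2
    (GCW.retract_mem p))

theorem continuous_cylRetract : Continuous (Y.cylRetract hB hpt) :=
  (Y.coneProj hB hpt).continuous.comp (Y.continuous_mappingCylMk hB hpt
    (continuous_fst.comp (GCW.continuous_retract hB))
    (continuous_snd.comp (GCW.continuous_retract hB)) _)

theorem cylRetract_smul (t : unitInterval) (g : G) (y : Y.carrier) :
    Y.cylRetract hB hpt (t, g • y) = g • Y.cylRetract hB hpt (t, y) := by
  have h := GCW.retract_smul hB t g y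
  have h1 := congrArg Prod.fst h
  have h2 := congrArg Prod.snd h
  exact congrArg (Y.coneProj hB hpt) (mappingCyl_ext h1 h2)

theorem cylRetract_of_mem (p : (Y.mappingCyl hB hpt).carrier) :
    Y.cylRetract hB hpt (Y.mappingCylFst hB hpt p, Y.mappingCylSnd hB hpt p) =
      Y.coneProj hB hpt p := by
  have h := GCW.retract_of_pushFix (K := Y.cw) (A := B)
    (y := (Y.mappingCylFst hB hpt p, Y.mappingCylSnd hB hpt p)) (mappingCyl_cases p)
  have h1 := congrArg Prod.fst h
  have h2 := congrArg Prod.snd h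
  exact congrArg (Y.coneProj hB hpt) (mappingCyl_ext h1 h2)

theorem cylRetract_eq_pt {t : unitInterval} {y : Y.carrier} (hy : y ∈ B) (h : t = 0 ∨ y = Y.pt) :
    Y.cylRetract hB hpt (t, y) = (Y.mappingCone hB hpt).pt :=
  (Y.cylRetract_of_mem hB hpt (Y.mappingCylMk hB hpt t y (.inr hy))).trans
    (coneProj_eq_pt_iff.2 h)

/-- A homotopy inverse of the collapse of the cone on `B`. -/
noncomputable def quotToCone : PtGMap (Y.quot B hB hpt) (Y.mappingCone hB hpt) :=
  PtGMap.quotLift hB hpt ⟨⟨fun y => Y.cylRetract hB hpt (0, y),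
    (Y.continuous_cylRetract hB hpt).comp (continuous_const.prodMk continuous_id),
    fun g y => Y.cylRetract_smul hB hpt 0 g y⟩, Y.cylRetract_eq_pt hB hpt hpt (.inl rfl)⟩
    fun _ hy => Y.cylRetract_eq_pt hB hpt hy (.inl rfl)

theorem quotToCone_apply (y : Y.carrier) :
    Y.quotToCone hB hpt (Y.proj B hB hpt y) = Y.cylRetract hB hpt (0, y) :=
  PtGMap.quotLift_apply _ _ _ _ y

/-- The homotopy at time `t` is the `Y`-component of the retraction at height `t`. It is the
composite at `t = 0` and the identity at `t = 1`, and it descends to the quotient because the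
retraction preserves the subcomplex `B`. -/
theorem coneToQuot_comp_quotToCone_homotopic :
    ((Y.coneToQuot hB hpt).comp (Y.quotToCone hB hpt)).Homotopic (PtGMap.id _) := by
  have hmem : ∀ t, ∀ y ∈ B, Y.proj B hB hpt (Y.cw.retract B (t, y)).2 = (Y.quot B hB hpt).pt :=
    fun t y hy => proj_eq_pt_iff.2 (GCW.retract_mem_subcomplex hB (y := (t, y)) hy)
  refine PtGMap.homotopic_of_isQuotientMap _ (Y.isQuotientMap_proj B hB hpt) _ _
    (fun p => Y.proj B hB hpt (Y.cw.retract B p).2) ?_ ?_ ?_ ?_ ?_ ?_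
  · exact (Y.proj B hB hpt).continuous.comp (continuous_snd.comp (GCW.continuous_retract hB))
  · intro t g y
    rw [GCW.retract_smul hB]
    rfl
  · exact fun t => hmem t _ hpt
  · intro y
    change _ = Y.coneToQuot hB hpt (Y.quotToCone hB hpt (Y.proj B hB hpt y))
    rw [quotToCone_apply]
    exact (Y.coneToQuot_apply hB hpt (Y.mappingCylMk hB hpt _ _ (GCW.retract_mem _))).symm
  · intro y
    rw [GCW.retract_of_pushFix (.inl rfl)]
    rfl
  · intro t x y h
    rcases proj_eq_iff.1 h with rfl | h
    · rfl
    · exact (hmem t x h.1).trans (hmem t y h.2).symm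

/-- At time `s` the point of the cone given by `(t, y)` goes to the retraction of `(s t, y)`. For `s
= 0` this is the composite; for `s = 1` the point already lies in the mapping cylinder and is fixed.
-/
theorem quotToCone_comp_coneToQuot_homotopic :
    ((Y.quotToCone hB hpt).comp (Y.coneToQuot hB hpt)).Homotopic (PtGMap.id _) := by
  have hend : ∀ t, ∀ p ∈ Y.mappingCylEnd hB hpt, Y.cylRetract hB hpt
      (t * Y.mappingCylFst hB hpt p, Y.mappingCylSnd hB hpt p) = (Y.mappingCone hB hpt).pt := by
    intro t p hp
    refine Y.cylRetract_eq_pt hB hpt ?_ (hp.imp (fun h => by rw [h, mul_zero]) id)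
    -- A point of the collapsed part always lies over `B`: at height one it must lie over the base
    -- point.
    rcases mappingCyl_cases p with h1 | h1
    · rw [hp.resolve_left fun h => absurd (h.symm.trans h1) zero_ne_one]
      exact hpt
    · exact h1
  refine PtGMap.homotopic_of_isQuotientMap _ (Y.isQuotientMap_coneProj hB hpt) _ _
    (fun q => Y.cylRetract hB hpt
      (q.1 * Y.mappingCylFst hB hpt q.2, Y.mappingCylSnd hB hpt q.2)) ?_ ?_ ?_ ?_ ?_ ?_
  · exact (Y.continuous_cylRetract hB hpt).comp
      ((continuous_fst.mul ((Y.continuous_mappingCylFst hB hpt).comp continuous_snd)).prodMk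
        ((Y.mappingCylSnd hB hpt).continuous.comp continuous_snd))
  · intro t g p
    exact Y.cylRetract_smul hB hpt _ g _
  · exact fun t => hend t _ (.inr rfl)
  · intro p
    change _ = Y.quotToCone hB hpt (Y.coneToQuot hB hpt (Y.coneProj hB hpt p))
    rw [coneToQuot_apply, quotToCone_apply, zero_mul]
  · intro p
    rw [one_mul]
    exact Y.cylRetract_of_mem hB hpt p
  · intro t p q h
    rcases coneProj_eq_iff.1 h with rfl | h
    · rfl
    · exact (hend t p h.1).trans (hend t q h.2).symm

/-- The function `min 1 (2 t)` on `[0, 1]`. -/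
noncomputable def rampUp : C(unitInterval, unitInterval) where
  toFun t := ⟨min 1 (2 * (t : ℝ)), le_min zero_le_one (by linarith [t.2.1]), min_le_left _ _⟩
  continuous_toFun := Continuous.subtype_mk (by fun_prop) _

/-- The function `min 1 (2 - 2 t)` on `[0, 1]`. -/
noncomputable def rampDown : C(unitInterval, unitInterval) where
  toFun t := ⟨min 1 (2 - 2 * (t : ℝ)), le_min zero_le_one (by linarith [t.2.2]), min_le_left _ _⟩
  continuous_toFun := Continuous.subtype_mk (by fun_prop) _

theorem rampUp_zero : rampUp 0 = 0 := Subtype.ext (by simp [rampUp])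

theorem rampUp_one : rampUp 1 = 1 := Subtype.ext (by simp [rampUp])

theorem rampDown_zero : rampDown 0 = 1 := Subtype.ext (by simp [rampDown])

theorem rampDown_one : rampDown 1 = 0 := Subtype.ext (by simp [rampDown])

/-- At any time only one ramp moves: `rampUp` in the first half, `rampDown` in the second. This lets
a path climb the inner cone on `B` up to `Y` and then descend the outer cone on `Y` without leaving
`doubleCone`. -/
theorem rampDown_eq_or (t : unitInterval) : rampDown t = 1 ∨ rampUp t = 1 := by
  rcases le_total (t : ℝ) (1 / 2) with h | h
  · exact .inl (Subtype.ext (min_eq_left (by linarith)))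
  · exact .inr (Subtype.ext (min_eq_left (by linarith)))

/-- The mapping cone of the inclusion of `Y` in its mapping cone with `B`. -/
noncomputable abbrev doubleCone : PtGCW G :=
  (Y.mappingCone hB hpt).mappingCone (Y.isCofib_coneIncl hB hpt).isSubcomplex
    (Y.coneIncl hB hpt).pt_mem_range

theorem doubleCone_cases (t : unitInterval) (x : (Y.sub B hB hpt).carrier) :
    rampDown t = 1 ∨ Y.cylToCone hB hpt (Triv.mk (rampUp t), x) ∈ range (Y.coneIncl hB hpt) :=
  (rampDown_eq_or t).imp_right fun h => by
    rw [h]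
    exact ⟨x.1, rfl⟩

/-- The map `[0, 1] × B → doubleCone` that runs through the two cones on `B`. -/
noncomputable def cylToDoubleCone :
    PtGMap (Y.sub B hB hpt).intervalProd (Y.doubleCone hB hpt) :=
  ⟨⟨fun p => coneProj _ _ _ (mappingCylMk _ _ _ (rampDown p.1.val)
      (Y.cylToCone hB hpt (Triv.mk (rampUp p.1.val), p.2)) (Y.doubleCone_cases hB hpt _ _)),
    (coneProj _ _ _).continuous.comp (continuous_mappingCylMk _ _ _
      (rampDown.continuous.comp (Triv.continuous_val.comp continuous_fst))
      ((Y.cylToCone hB hpt).continuous.comp ((Triv.continuous_mk.comp (rampUp.continuous.comp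
        (Triv.continuous_val.comp continuous_fst))).prodMk continuous_snd)) _),
    fun _ _ => rfl⟩, coneProj_eq_pt_iff.2 (.inr (coneProj_eq_pt_iff.2 (.inr rfl)))⟩

/-- The inclusion of `ΣB`, as the union of two cones on `B`. -/
noncomputable def suspToDoubleCone : PtGMap (Y.sub B hB hpt).susp (Y.doubleCone hB hpt) :=
  suspLift (Y.cylToDoubleCone hB hpt)
    (fun _ => coneProj_eq_pt_iff.2 (.inr (coneProj_eq_pt_iff.2 (.inl rampUp_zero))))
    (fun _ => coneProj_eq_pt_iff.2 (.inl rampDown_one))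
    (fun _ => coneProj_eq_pt_iff.2 (.inr (coneProj_eq_pt_iff.2 (.inr rfl))))

/-- The map `M / Y → ΣB` on the quotient of the mapping cone `M`. -/
noncomputable def coneQuotToSusp : PtGMap
    ((Y.mappingCone hB hpt).quot _ (Y.isCofib_coneIncl hB hpt).isSubcomplex
      (Y.coneIncl hB hpt).pt_mem_range) (Y.sub B hB hpt).susp :=
  PtGMap.quotLift _ _ (Y.coneToSusp hB hpt) fun m hm => (Y.coneToSusp_eq_pt_iff hB hpt m).2 hm

/-- The map `doubleCone → ΣB` that collapses the cone on `Y`. -/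
noncomputable def doubleConeToSusp : PtGMap (Y.doubleCone hB hpt) (Y.sub B hB hpt).susp :=
  (Y.coneQuotToSusp hB hpt).comp (coneToQuot _ _ _)

/-- The collapse of the mapping cone of `B` in `doubleCone`. -/
noncomputable def doubleConeCollapse : PtGMap (Y.doubleCone hB hpt)
    ((Y.mappingCone hB hpt).sub _ (Y.isCofib_coneIncl hB hpt).isSubcomplex
      (Y.coneIncl hB hpt).pt_mem_range).susp :=
  coneToSusp _ _ _

/-- Collapsing the outer cone forgets its height and leaves the inner height `rampUp`. Since
`rampUp` has the endpoints of the identity, the composite is homotopic to the identity of `ΣB`. -/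
theorem doubleConeToSusp_comp_suspToDoubleCone :
    (Y.doubleConeToSusp hB hpt).comp (Y.suspToDoubleCone hB hpt) =
      (Y.sub B hB hpt).reparam rampUp (.inl rampUp_zero) (.inr rampUp_one) := by
  refine PtGMap.ext fun y => ?_
  obtain ⟨⟨⟨t⟩, x⟩, rfl⟩ := (Y.sub B hB hpt).isQuotientMap_cylToSusp.surjective y
  refine Eq.trans ?_ (reparam_apply _ _ _ _ t x).symm
  refine (congrArg (Y.doubleConeToSusp hB hpt) (suspLift_apply _ _ _ _ (Triv.mk t, x))).trans ?_
  refine (congrArg (Y.coneQuotToSusp hB hpt) (coneToQuot_apply _ _ _ _)).trans ?_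
  refine (PtGMap.quotLift_apply _ _ _ _ _).trans ?_
  exact congrArg (fun f : PtGMap (Y.sub B hB hpt).intervalProd (Y.sub B hB hpt).susp =>
    f (Triv.mk (rampUp t), x)) (Y.coneToSusp_comp_cylToCone hB hpt)

/-- The inclusion of `B` in the copy of `Y` in the mapping cone. -/
noncomputable def subToRange : PtGMap (Y.sub B hB hpt)
    ((Y.mappingCone hB hpt).sub _ (Y.isCofib_coneIncl hB hpt).isSubcomplex
      (Y.coneIncl hB hpt).pt_mem_range) :=
  ((Y.coneIncl hB hpt).codRestrict _ _ _ mem_range_self).comp (Y.incl B hB hpt)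

/-- Collapsing the inner cone leaves only the descent through the outer cone over `B ⊂ Y`. The
suspension coordinate is thus reversed: this is the sign in the Puppe sequence, kept here as a
reparametrization. -/
theorem doubleConeCollapse_comp_suspToDoubleCone :
    (Y.doubleConeCollapse hB hpt).comp (Y.suspToDoubleCone hB hpt) =
      (Y.subToRange hB hpt).susp.comp
        ((Y.sub B hB hpt).reparam rampDown (.inr rampDown_zero) (.inl rampDown_one)) := by
  refine PtGMap.ext fun y => ?_
  obtain ⟨⟨⟨t⟩, x⟩, rfl⟩ := (Y.sub B hB hpt).isQuotientMap_cylToSusp.surjective y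
  refine Eq.trans ?_ (congrArg (Y.subToRange hB hpt).susp
    (reparam_apply _ rampDown (.inr rampDown_zero) (.inl rampDown_one) t x)).symm
  refine (congrArg (Y.doubleConeCollapse hB hpt)
    (suspLift_apply _ _ _ _ (Triv.mk t, x))).trans ?_
  refine Eq.trans ?_ (susp_map_cylToSusp _ _ _).symm
  let p := (Y.mappingCone hB hpt).mappingCylMk (Y.isCofib_coneIncl hB hpt).isSubcomplex
    (Y.coneIncl hB hpt).pt_mem_range (rampDown t) _ (Y.doubleCone_cases hB hpt t x)
  -- While the outer height is one, both sides are the base point; afterwards the inner point lies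
  -- in the copy of `Y`.
  rcases rampDown_eq_or t with h | h
  · refine (coneToSusp_eq_pt _ _ _ p h).trans (Eq.symm ?_)
    exact cylToSusp_eq_pt_iff.2 (.inr (.inl h))
  · have hx : Y.cylToCone hB hpt (Triv.mk (rampUp t), x) = Y.coneIncl hB hpt x.1 := by
      rw [h]
      rfl
    refine (coneToSusp_of_mem _ _ _ p ⟨x.1, hx.symm⟩).trans ?_
    refine congrArg _ (Prod.ext rfl (Subtype.ext hx))

theorem doubleConeToSusp_comp_coneIncl :
    (Y.doubleConeToSusp hB hpt).comp (coneIncl _ _ _) = Y.coneToSusp hB hpt := by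
  refine PtGMap.ext fun m => ?_
  refine (congrArg (Y.coneQuotToSusp hB hpt) (coneToQuot_apply _ _ _ _)).trans ?_
  exact PtGMap.quotLift_apply _ _ _ _ _

/-- In `ΣY`, unlike in `ΣB`, the point `[(1 - s) t, y]` is defined for all `y ∈ Y`. Shrinking the
height in this way contracts the composite. -/
theorem susp_incl_comp_coneToSusp_homotopic :
    ((Y.incl B hB hpt).susp.comp (Y.coneToSusp hB hpt)).Homotopic (PtGMap.const _ _) := by
  refine PtGMap.homotopic_of_isQuotientMap _ (Y.isQuotientMap_coneProj hB hpt) _ _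
    (fun q => Y.cylToSusp (Triv.mk (unitInterval.symm q.1 * Y.mappingCylFst hB hpt q.2),
      Y.mappingCylSnd hB hpt q.2)) ?_ ?_ ?_ ?_ ?_ ?_
  · exact Y.cylToSusp.continuous.comp ((Triv.continuous_mk.comp
      ((unitInterval.continuous_symm.comp continuous_fst).mul
        ((Y.continuous_mappingCylFst hB hpt).comp continuous_snd))).prodMk
          ((Y.mappingCylSnd hB hpt).continuous.comp continuous_snd))
  · exact fun _ _ _ => rfl
  · exact fun t => cylToSusp_eq_pt_iff.2 (.inr (.inr rfl))
  · intro p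
    change _ = (Y.incl B hB hpt).susp (Y.coneToSusp hB hpt (Y.coneProj hB hpt p))
    rw [unitInterval.symm_zero, one_mul]
    rcases mappingCyl_cases p with h | h
    · rw [Y.coneToSusp_eq_pt hB hpt p h, PtGMap.map_pt]
      exact cylToSusp_eq_pt_iff.2 (.inr (.inl h))
    · exact (congrArg (Y.incl B hB hpt).susp (Y.coneToSusp_of_mem hB hpt p h)).symm
  · intro p
    exact cylToSusp_eq_pt_iff.2 (.inl (by rw [unitInterval.symm_one, zero_mul]))
  · have hend : ∀ t, ∀ p ∈ Y.mappingCylEnd hB hpt,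
        Y.cylToSusp (Triv.mk (unitInterval.symm t * Y.mappingCylFst hB hpt p),
          Y.mappingCylSnd hB hpt p) = Y.susp.pt := fun t p hp =>
      cylToSusp_eq_pt_iff.2 (hp.imp (fun h => by rw [h, mul_zero]) .inr)
    intro t p q h
    rcases coneProj_eq_iff.1 h with rfl | h
    · rfl
    · exact (hend t p h.1).trans (hend t q h.2).symm

end

/-! ### Naturality of mapping cones -/

section

variable {Y Y' : PtGCW G} (g : PtGMap Y Y') {B : Set Y.carrier} {B' : Set Y'.carrier}
  (hB : Y.cw.IsSubcomplex B) (hpt : Y.pt ∈ B) (hB' : Y'.cw.IsSubcomplex B') (hpt' : Y'.pt ∈ B')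
  (h : ∀ y ∈ B, g y ∈ B')

/-- The restriction of a map of pairs. -/
def _root_.PtGMap.subMap : PtGMap (Y.sub B hB hpt) (Y'.sub B' hB' hpt') :=
  (g.comp (Y.incl B hB hpt)).codRestrict B' hB' hpt' fun y => h y.1 y.2

/-- The map of mapping cylinders induced by a map of pairs. -/
noncomputable def _root_.PtGMap.mappingCylMap :
    PtGMap (Y.mappingCyl hB hpt) (Y'.mappingCyl hB' hpt') :=
  ⟨⟨fun p => Y'.mappingCylMk hB' hpt' (Y.mappingCylFst hB hpt p) (g (Y.mappingCylSnd hB hpt p))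
      ((mappingCyl_cases p).imp_right (h _)),
    Y'.continuous_mappingCylMk hB' hpt' (Y.continuous_mappingCylFst hB hpt)
      (g.continuous.comp (Y.mappingCylSnd hB hpt).continuous) _,
    fun a _ => mappingCyl_ext rfl (g.map_smul a _)⟩, mappingCyl_ext rfl g.map_pt⟩

/-- The map of mapping cones induced by a map of pairs. -/
noncomputable def _root_.PtGMap.coneMap :
    PtGMap (Y.mappingCone hB hpt) (Y'.mappingCone hB' hpt') :=
  Y.coneLift hB hpt ((Y'.coneProj hB' hpt').comp (g.mappingCylMap hB hpt hB' hpt' h)) fun _ hp =>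
    coneProj_eq_pt_iff.2 (hp.imp id fun hp => (congrArg g hp).trans g.map_pt)

theorem coneMap_apply (p : (Y.mappingCyl hB hpt).carrier) :
    g.coneMap hB hpt hB' hpt' h (Y.coneProj hB hpt p) =
      Y'.coneProj hB' hpt' (g.mappingCylMap hB hpt hB' hpt' h p) :=
  Y.coneLift_apply _ _ _ _ p

theorem coneToQuot_comp_coneMap : (Y'.coneToQuot hB' hpt').comp (g.coneMap hB hpt hB' hpt' h) =
    (g.quotMap hB hpt hB' hpt' h).comp (Y.coneToQuot hB hpt) := by
  refine PtGMap.ext fun m => ?_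
  obtain ⟨p, rfl⟩ := (Y.isQuotientMap_coneProj hB hpt).surjective m
  refine (congrArg (Y'.coneToQuot hB' hpt') (coneMap_apply _ _ _ _ _ _ p)).trans ?_
  refine (coneToQuot_apply _ _ _ _).trans (Eq.symm ?_)
  refine (congrArg (g.quotMap hB hpt hB' hpt' h) (coneToQuot_apply _ _ _ _)).trans ?_
  exact PtGMap.quotLift_apply _ _ _ _ _

theorem coneToSusp_comp_coneMap : (Y'.coneToSusp hB' hpt').comp (g.coneMap hB hpt hB' hpt' h) =
    (g.subMap hB hpt hB' hpt' h).susp.comp (Y.coneToSusp hB hpt) := by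
  refine PtGMap.ext fun m => ?_
  obtain ⟨p, rfl⟩ := (Y.isQuotientMap_coneProj hB hpt).surjective m
  refine (congrArg (Y'.coneToSusp hB' hpt') (coneMap_apply _ _ _ _ _ _ p)).trans ?_
  rcases mappingCyl_cases p with hp | hp
  · refine (coneToSusp_eq_pt _ _ _ (g.mappingCylMap hB hpt hB' hpt' h p) hp).trans (Eq.symm ?_)
    exact (congrArg (g.subMap hB hpt hB' hpt' h).susp (Y.coneToSusp_eq_pt hB hpt p hp)).trans
      (PtGMap.map_pt _)
  · refine (coneToSusp_of_mem _ _ _ (g.mappingCylMap hB hpt hB' hpt' h p)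
      (h _ hp)).trans (Eq.symm ?_)
    exact congrArg (g.subMap hB hpt hB' hpt' h).susp (Y.coneToSusp_of_mem hB hpt p hp)

end

end PtGCW

/-! ### The long exact sequence of a pair -/

namespace MultCohomology

variable (E : MultCohomology.{u, v} G)

theorem map_bijective_of_homotopic {X Y : PtGCW G} (f : PtGMap X Y) (g : PtGMap Y X)
    (h : (f.comp g).Homotopic (PtGMap.id Y)) (h' : (g.comp f).Homotopic (PtGMap.id X)) :
    Function.Bijective (E.map f) := by
  refine ⟨Function.LeftInverse.injective (g := E.map g) fun y => ?_,
    Function.RightInverse.surjective (g := E.map g) fun x => ?_⟩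
  · rw [← E.map_comp, E.map_homotopic _ _ h, E.map_id]
  · rw [← E.map_comp, E.map_homotopic _ _ h', E.map_id]

section

variable {Y : PtGCW G} {B : Set Y.carrier} (hB : Y.cw.IsSubcomplex B) (hpt : Y.pt ∈ B)

theorem map_coneToQuot_bijective : Function.Bijective (E.map (Y.coneToQuot hB hpt)) :=
  E.map_bijective_of_homotopic _ _ (Y.coneToQuot_comp_quotToCone_homotopic hB hpt)
    (Y.quotToCone_comp_coneToQuot_homotopic hB hpt)

/-- The connecting map of a pair. -/
noncomputable def connect : E.carrier (Y.sub B hB hpt) →+ E.carrier (Y.quot B hB hpt) :=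
  ((AddEquiv.ofBijective (E.map (Y.coneToQuot hB hpt) :
      E.carrier (Y.quot B hB hpt) →+ E.carrier (Y.mappingCone hB hpt))
      (E.map_coneToQuot_bijective hB hpt)).symm :
      E.carrier (Y.mappingCone hB hpt) →+ E.carrier (Y.quot B hB hpt)).comp
    ((E.map (Y.coneToSusp hB hpt) :
      E.carrier (Y.sub B hB hpt).susp →+ E.carrier (Y.mappingCone hB hpt)).comp
    (E.susp (Y.sub B hB hpt) : E.carrier (Y.sub B hB hpt) →+ E.carrier (Y.sub B hB hpt).susp))

theorem map_coneToQuot_connect (a : E.carrier (Y.sub B hB hpt)) :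
    E.map (Y.coneToQuot hB hpt) (E.connect hB hpt a) =
      E.map (Y.coneToSusp hB hpt) (E.susp _ a) :=
  (AddEquiv.ofBijective (E.map (Y.coneToQuot hB hpt) :
    E.carrier (Y.quot B hB hpt) →+ E.carrier (Y.mappingCone hB hpt))
    (E.map_coneToQuot_bijective hB hpt)).apply_symm_apply _

/-- This is exactness of `Y → M → ΣB` for the mapping cone `M`, transported along `M ≃ Y / B` and
the suspension isomorphism. -/
theorem map_proj_eq_zero_iff (d : E.carrier (Y.quot B hB hpt)) :
    E.map (Y.proj B hB hpt) d = 0 ↔ ∃ a, E.connect hB hpt a = d := by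
  rw [← Y.coneToQuot_comp_coneIncl hB hpt, E.map_comp,
    E.exact_of_isCofib _ (Y.isCofib_coneIncl hB hpt) _ (Y.isQuotientMap_coneToSusp hB hpt)
      (Y.coneToSusp_eq_iff hB hpt)]
  constructor
  · rintro ⟨q, hq⟩
    refine ⟨(E.susp _).symm q, (E.map_coneToQuot_bijective hB hpt).injective ?_⟩
    rw [map_coneToQuot_connect, AddEquiv.apply_symm_apply, hq]
  · rintro ⟨a, rfl⟩
    exact ⟨_, (E.map_coneToQuot_connect hB hpt a).symm⟩

/-- The Puppe argument one term further. The suspension of `a`, pulled back to `doubleCone`,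
vanishes on `M` by assumption, so it comes from the suspension of a class on `Y`. Pulling back along
`ΣB → doubleCone` recovers the suspension of `a` and exhibits it as restricted from `Y`, up to
reversal of the suspension coordinate. -/
theorem exists_of_map_coneToSusp_eq_zero (a : E.carrier (Y.sub B hB hpt))
    (h : E.map (Y.coneToSusp hB hpt) (E.susp _ a) = 0) : ∃ y, E.map (Y.incl B hB hpt) y = a := by
  let i := (Y.coneIncl hB hpt).codRestrict _ (Y.isCofib_coneIncl hB hpt).isSubcomplex
    (Y.coneIncl hB hpt).pt_mem_range mem_range_self
  obtain ⟨q, hq⟩ := (E.exact_of_isCofib _ (PtGCW.isCofib_coneIncl _ _ _)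
    (Y.doubleConeCollapse hB hpt) (PtGCW.isQuotientMap_coneToSusp _ _ _)
      (PtGCW.coneToSusp_eq_iff _ _ _) (E.map (Y.doubleConeToSusp hB hpt) (E.susp _ a))).1 (by
      rw [← E.map_comp, ← h, ← Y.doubleConeToSusp_comp_coneIncl hB hpt])
  obtain ⟨y, rfl⟩ := (E.susp _).surjective q
  -- The reversal is moved from `ΣB` to `ΣY` and absorbed into the choice of `y'`, so its effect on
  -- cohomology never has to be computed.
  obtain ⟨y', hy'⟩ := (E.susp Y).surjective (E.map
    (Y.reparam PtGCW.rampDown (.inr PtGCW.rampDown_zero) (.inl PtGCW.rampDown_one))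
    (E.susp Y (E.map i y)))
  refine ⟨y', (E.susp _).injective ?_⟩
  have h1 : E.map ((Y.doubleConeToSusp hB hpt).comp (Y.suspToDoubleCone hB hpt)) (E.susp _ a) =
      E.susp _ a := by
    rw [Y.doubleConeToSusp_comp_suspToDoubleCone hB hpt,
      E.map_homotopic _ _ (PtGCW.reparam_homotopic _ PtGCW.rampUp (ContinuousMap.id _) _ _
        PtGCW.rampUp_zero.symm PtGCW.rampUp_one.symm)]
    exact (congrArg (fun f => E.map f (E.susp _ a)) (PtGCW.reparam_id _)).trans (E.map_id _ _)
  rw [← h1, E.map_comp, ← hq, ← E.map_comp, Y.doubleConeCollapse_comp_suspToDoubleCone hB hpt,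
    E.map_comp, E.susp_natural, hy', ← E.map_comp, ← PtGCW.susp_comp_reparam, E.map_comp,
    ← E.susp_natural, ← E.susp_natural, ← E.map_comp]
  rfl

theorem connect_eq_zero_iff (a : E.carrier (Y.sub B hB hpt)) :
    E.connect hB hpt a = 0 ↔ ∃ y, E.map (Y.incl B hB hpt) y = a := by
  rw [← map_eq_zero_iff _ (E.map_coneToQuot_bijective hB hpt).injective, map_coneToQuot_connect]
  refine ⟨E.exists_of_map_coneToSusp_eq_zero hB hpt a, ?_⟩
  rintro ⟨y, rfl⟩
  rw [E.susp_natural, ← E.map_comp]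
  exact E.map_eq_zero_of_homotopic _ (Y.susp_incl_comp_coneToSusp_homotopic hB hpt) _

theorem map_quotMap_connect {Y' : PtGCW G} (g : PtGMap Y Y') {B' : Set Y'.carrier}
    (hB' : Y'.cw.IsSubcomplex B') (hpt' : Y'.pt ∈ B') (h : ∀ y ∈ B, g y ∈ B')
    (a : E.carrier (Y'.sub B' hB' hpt')) :
    E.map (g.quotMap hB hpt hB' hpt' h) (E.connect hB' hpt' a) =
      E.connect hB hpt (E.map (g.subMap hB hpt hB' hpt' h) a) := by
  apply (E.map_coneToQuot_bijective hB hpt).injective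
  rw [map_coneToQuot_connect, E.susp_natural, ← E.map_comp, ← E.map_comp,
    ← PtGCW.coneToSusp_comp_coneMap, ← PtGCW.coneToQuot_comp_coneMap, E.map_comp, E.map_comp,
    map_coneToQuot_connect]

end

/-! ### The long exact sequence of a closed embedding -/

section

variable {A Y : PtGCW G} {f : PtGMap A Y} (hf : f.IsCofib)

/-- The quotient of a space by the image of a closed embedding. -/
noncomputable abbrev _root_.PtGMap.IsCofib.quot : PtGCW G :=
  Y.quot (range f) hf.isSubcomplex f.pt_mem_range

/-- The projection onto the quotient by the image of a closed embedding. -/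
noncomputable abbrev _root_.PtGMap.IsCofib.proj : PtGMap Y hf.quot :=
  Y.proj (range f) hf.isSubcomplex f.pt_mem_range

/-- A closed embedding as a map to its image. -/
noncomputable def _root_.PtGMap.IsCofib.toRange :
    PtGMap A (Y.sub (range f) hf.isSubcomplex f.pt_mem_range) :=
  f.codRestrict (range f) hf.isSubcomplex f.pt_mem_range mem_range_self

/-- The inverse of a closed embedding on its image. -/
noncomputable def _root_.PtGMap.IsCofib.ofRange :
    PtGMap (Y.sub (range f) hf.isSubcomplex f.pt_mem_range) A :=
  hf.toRange.inv (isHomeomorph_codRestrict hf)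

theorem _root_.PtGMap.IsCofib.ofRange_apply (x : A.carrier) : hf.ofRange (hf.toRange x) = x :=
  PtGMap.inv_apply _ _ x

/-- The connecting map of a closed embedding. -/
noncomputable def connectOf : E.carrier A →+ E.carrier hf.quot :=
  (E.connect hf.isSubcomplex f.pt_mem_range).comp (E.map hf.ofRange)

theorem connectOf_apply (a : E.carrier A) :
    E.connectOf hf a = E.connect hf.isSubcomplex f.pt_mem_range (E.map hf.ofRange a) := rfl

theorem map_isCofib_eq_zero_iff (y : E.carrier Y) :
    E.map f y = 0 ↔ ∃ d, E.map hf.proj d = y :=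
  E.exact_of_isCofib f hf hf.proj (Y.isQuotientMap_proj _ _ _) (fun _ _ => PtGCW.proj_eq_iff) y

theorem map_isCofib_proj_eq_zero_iff (d : E.carrier hf.quot) :
    E.map hf.proj d = 0 ↔ ∃ a, E.connectOf hf a = d := by
  refine (E.map_proj_eq_zero_iff _ _ d).trans ⟨?_, ?_⟩
  · rintro ⟨a, rfl⟩
    refine ⟨E.map hf.toRange a, ?_⟩
    rw [connectOf_apply]
    exact congrArg _ (E.map_inv_map _ (isHomeomorph_codRestrict hf) a)
  · rintro ⟨a, rfl⟩
    exact ⟨_, rfl⟩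

/-- Exactness for the inclusion of the image, transported along the homeomorphism of `A` with the
image of `f`. -/
theorem connectOf_eq_zero_iff (a : E.carrier A) :
    E.connectOf hf a = 0 ↔ ∃ y, E.map f y = a := by
  rw [connectOf_apply, connect_eq_zero_iff]
  refine exists_congr fun y => ?_
  have hr : E.map f y = E.map hf.toRange (E.map (Y.incl _ hf.isSubcomplex f.pt_mem_range) y) := by
    rw [← E.map_comp]
    rfl
  rw [hr, ← (E.map_bijective _ (isHomeomorph_codRestrict hf)).injective.eq_iff]
  have := E.map_map_inv _ (isHomeomorph_codRestrict hf) a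
  exact ⟨fun h => h.trans this, fun h => h.trans this.symm⟩

theorem map_quotMap_connectOf {A' Y' : PtGCW G} {f' : PtGMap A' Y'} (hf' : f'.IsCofib)
    (g : PtGMap Y Y') (g' : PtGMap A A') (h : ∀ x, g (f x) = f' (g' x))
    (hg : ∀ y ∈ range f, g y ∈ range f') (a : E.carrier A') :
    E.map (g.quotMap hf.isSubcomplex f.pt_mem_range hf'.isSubcomplex f'.pt_mem_range hg)
      (E.connectOf hf' a) = E.connectOf hf (E.map g' a) := by
  rw [connectOf_apply, connectOf_apply, E.map_quotMap_connect, ← E.map_comp, ← E.map_comp]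
  congr 3
  refine PtGMap.ext fun y => ?_
  obtain ⟨x, rfl⟩ := (isHomeomorph_codRestrict hf : IsHomeomorph hf.toRange).surjective y
  have h1 : g.subMap hf.isSubcomplex f.pt_mem_range hf'.isSubcomplex f'.pt_mem_range hg
      (hf.toRange x) = hf'.toRange (g' x) := Subtype.ext (h x)
  have h2 := (congrArg (fun z => hf'.ofRange z) h1).trans (hf'.ofRange_apply (g' x))
  exact h2.trans (congrArg (fun z => g' z) (hf.ofRange_apply x)).symm

end

/-! ### Classes on `S¹ ∧ X`, and products on `Y ∪ S¹ × B` -/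

/-- The inclusion `S¹ → S¹ × X`. -/
noncomputable def _root_.PtGCW.circleIncl (X : PtGCW G) : PtGMap (PtGCW.circle G) X.circleProd :=
  ⟨⟨fun θ => (θ, X.pt), continuous_id.prodMk continuous_const,
    fun g _ => Prod.ext rfl (X.smul_pt g).symm⟩, rfl⟩

/-- The kernel is the image of the connecting map from `S¹ ∨ X`, which is zero because every class
on `S¹ ∨ X` extends to `S¹ × X`: the two projections extend its two parts separately. Thus a cross
product with `e` is determined by its pullback to `S¹ × X`. -/
theorem map_toSusp_injective (X : PtGCW G) : Function.Injective (E.map X.toSusp) := by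
  have hB := X.isSubcomplex_wedgeSet
  have hpt : X.circleProd.pt ∈ X.wedgeSet := .inl rfl
  let Z := X.circleProd.sub X.wedgeSet hB hpt
  let j : PtGMap Z X.circleProd := X.circleProd.incl X.wedgeSet hB hpt
  let j₁ : PtGMap (PtGCW.circle G) Z := X.circleIncl.codRestrict _ hB hpt fun _ => .inr rfl
  let j₂ : PtGMap X Z :=
    ⟨⟨fun x => ⟨(Triv.mk 0, x), .inl rfl⟩, (continuous_const.prodMk continuous_id).subtype_mk _,
      fun _ _ => rfl⟩, rfl⟩
  let p₁ : PtGMap Z (PtGCW.circle G) := X.fstMap.comp j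
  let p₂ : PtGMap Z X := X.sndMap.comp j
  let S : Set Z.carrier := {z | p₂ z = X.pt}
  have hS : Z.cw.IsSubcomplex S := by
    have := GCW.IsSubcomplex.preimage_val (K := X.circleProd.cw) hB
      (GCW.isSubcomplex_univ.prod (F := FinCW.circle) X.isSubcomplex_pt)
    refine cast (congrArg _ (Set.ext fun p => ?_)) this
    exact ⟨fun h => h.2, fun h => ⟨trivial, h⟩⟩
  have hsurj : ∀ a : E.carrier Z, ∃ y, E.map j y = a := by
    intro a
    -- The circle part of `a`. On `S`, the copy of `S¹`, the composite `j₁ ∘ p₁` is the identity, so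
    -- `a - b` vanishes there.
    let b := E.map p₁ (E.map j₁ a)
    have h0 : E.map (Z.incl S hS rfl) (a - b) = 0 := by
      rw [map_sub, sub_eq_zero, ← E.map_comp, ← E.map_comp]
      congr 2
      refine PtGMap.ext fun z => Subtype.ext (Prod.ext rfl ?_)
      exact z.2
    obtain ⟨d, hd⟩ := (E.exact Z S hS rfl _).1 h0
    -- The collapse of the circle factors through the projection to `X`, so the remainder `a - b`
    -- extends along the second projection.
    have h1 : Z.proj S hS rfl = ((Z.proj S hS rfl).comp j₂).comp p₂ := by
      refine PtGMap.ext fun z => PtGCW.proj_eq_iff.2 ?_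
      rcases z.2 with h | h
      · exact .inl (Subtype.ext (Prod.ext h rfl))
      · exact .inr ⟨h, h⟩
    refine ⟨E.map X.fstMap (E.map j₁ a) +
      E.map X.sndMap (E.map ((Z.proj S hS rfl).comp j₂) d), ?_⟩
    rw [h1, E.map_comp] at hd
    have e₁ : ∀ z, E.map j (E.map X.fstMap z) = E.map p₁ z := fun z => (E.map_comp _ _ z).symm
    have e₂ : ∀ z, E.map j (E.map X.sndMap z) = E.map p₂ z := fun z => (E.map_comp _ _ z).symm
    rw [map_add, e₁, e₂, hd, add_sub_cancel]
  rw [injective_iff_map_eq_zero]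
  intro d hd
  obtain ⟨a, rfl⟩ := (E.map_proj_eq_zero_iff hB hpt d).1 hd
  exact (E.connect_eq_zero_iff hB hpt a).2 (hsurj a)

/-- The action of a class on `Y` on the image of the suspension of a class on `B`. -/
theorem map_loopCylSnd_mul {Y : PtGCW G} {B : Set Y.carrier} (hB : Y.cw.IsSubcomplex B)
    (hpt : Y.pt ∈ B) (x : E.carrier Y) (w w' : E.carrier (Y.sub B hB hpt))
    (h : E.map (PtGCW.sndMap _) (E.map (Y.incl B hB hpt) x) *
      (E.map (PtGCW.fstMap _) E.e * E.map (PtGCW.sndMap _) w) =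
      E.map (PtGCW.fstMap _) E.e * E.map (PtGCW.sndMap _) w') :
    E.map (Y.loopCylSnd hB) x * E.map (Y.loopCylToSusp hB hpt) (E.susp _ w) =
      E.map (Y.loopCylToSusp hB hpt) (E.susp _ w') := by
  -- Classes pulled back from `ΣB` vanish on `Y ∨ S¹`, so the product does too and descends to a
  -- class `q` on `ΣB`.
  have h0 : ∀ z, E.map ((Y.loopCyl hB).incl (Y.loopBase hB) (Y.isSubcomplex_loopBase hB)
      (.inl rfl)) (E.map (Y.loopCylToSusp hB hpt) z) = 0 := by
    intro z
    rw [← E.map_comp]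
    refine E.map_eq_zero_of_forall _ ?_ z
    rintro ⟨p, hp⟩
    exact (Y.loopCylToSusp_eq_pt_iff hB hpt).2 hp
  obtain ⟨q, hq⟩ := (E.exact_of_isQuotientMap (Y.isSubcomplex_loopBase hB) (.inl rfl) _
    (Y.isQuotientMap_loopCylToSusp hB hpt) (Y.loopCylToSusp_eq_iff hB hpt) (E.map
      (Y.loopCylSnd hB) x * E.map (Y.loopCylToSusp hB hpt) (E.susp _ w))).1 (by
      rw [map_mul, h0, mul_zero])
  rw [← hq]
  congr 1
  -- The class `q` is identified on `S¹ × B`, where suspension is multiplication by `e` and the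
  -- assumption `h` applies.
  apply E.map_toSusp_injective
  have e₁ : E.map (Y.circleProdToLoopCyl hB hpt) (E.map (Y.loopCylSnd hB) x) =
      E.map (PtGCW.sndMap _) (E.map (Y.incl B hB hpt) x) := by
    rw [← E.map_comp, ← E.map_comp]
    rfl
  rw [E.susp_eq, ← h, ← E.susp_eq, ← e₁, ← Y.loopCylToSusp_comp_circleProd hB hpt, E.map_comp, hq,
    map_mul, E.map_comp]

end MultCohomology

/-! ### Adding a disjoint base point -/

namespace GMap

variable {A X Y : GCWSpace G}

theorem range_plus (f : GMap A X) :
    range f.plus = Sum.inl '' range f.toFun ∪ {.inr PUnit.unit} := by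
  ext y
  constructor
  · rintro ⟨x | x, rfl⟩
    · exact .inl ⟨_, ⟨x, rfl⟩, rfl⟩
    · exact .inr rfl
  · rintro (⟨_, ⟨x, rfl⟩, rfl⟩ | rfl)
    · exact ⟨.inl x, rfl⟩
    · exact ⟨.inr PUnit.unit, rfl⟩

theorem isCofib_plus (f : GMap A X) (hf : IsClosedEmbedding f.toFun)
    (h : X.cw.IsSubcomplex (range f.toFun)) : f.plus.IsCofib := by
  refine ⟨.of_continuous_injective_isClosedMap f.plus.continuous
    (hf.injective.sumMap Function.injective_id) (hf.isClosedMap.sumMap IsClosedMap.id), ?_⟩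
  rw [range_plus]
  exact h.inl_union

theorem plus_homotopic (f g : GMap X Y) (H : unitInterval × X.carrier → Y.carrier)
    (hH : Continuous H) (hs : ∀ t (a : G) x, H (t, a • x) = a • H (t, x))
    (h0 : ∀ x, H (0, x) = f.toFun x) (h1 : ∀ x, H (1, x) = g.toFun x) :
    f.plus.Homotopic g.plus := by
  let K : (unitInterval × X.carrier) ⊕ (unitInterval × PUnit.{u + 1}) →
    Y.carrier ⊕ PUnit.{u + 1} := Sum.map H Prod.snd
  have hK : Continuous K := hH.sumMap continuous_snd
  refine ⟨fun p => K (Homeomorph.prodSumDistrib p), hK.comp (Homeomorph.continuous _), ?_, ?_, ?_,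
    ?_⟩
  · rintro t a (x | x)
    · exact congrArg Sum.inl (hs t a x)
    · rfl
  · exact fun t => rfl
  · rintro (x | x)
    · exact congrArg Sum.inl (h0 x)
    · rfl
  · rintro (x | x)
    · exact congrArg Sum.inl (h1 x)
    · rfl

end GMap

/-! ### The double mapping cylinder over `X` -/

namespace GCWTriad

variable (T : GCWTriad G)

theorem isCofib_iU : T.iU.plus.IsCofib :=
  T.iU.isCofib_plus T.hU.isClosed.isClosedEmbedding_subtypeVal <| by
    rw [show range T.iU.toFun = T.U from Subtype.range_coe]
    exact T.hU

theorem isCofib_jV : T.jV.plus.IsCofib :=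
  T.jV.isCofib_plus ((T.hV.isClosed.isClosedEmbedding_subtypeVal.of_comp_iff).1
    T.hW.isClosed.isClosedEmbedding_subtypeVal) <|
    cast (congrArg _ (Set.range_inclusion (inter_subset_right (s := T.U) (t := T.V))).symm)
      (GCW.IsSubcomplex.preimage_val T.hV T.hW)

/-- The inclusion `W → X`. -/
def iW : GMap T.spW T.X := T.X.incl (T.U ∩ T.V) T.hW

theorem isCofib_iW : T.iW.plus.IsCofib :=
  T.iW.isCofib_plus T.hW.isClosed.isClosedEmbedding_subtypeVal <| by
    rw [show range T.iW.toFun = T.U ∩ T.V from Subtype.range_coe]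
    exact T.hW

theorem mem_V_of_notMem_U {x : T.X.carrier} (h : x ∉ T.U) : x ∈ T.V :=
  ((T.union_eq.symm ▸ mem_univ x : x ∈ T.U ∪ T.V)).resolve_left h

/-- Points of `U` do not move. A point outside `U` lies in `V` and stays there, ending either at
height one or in `U ∩ V`. -/
theorem retract_mem_cylSet (x : T.X.carrier) :
    ((Triv.mk (T.X.cw.retract T.U (0, x)).1, (T.X.cw.retract T.U (0, x)).2) :
      Triv.{u} unitInterval × T.X.carrier) ∈ T.cylSet := by
  by_cases h : x ∈ T.U
  · rw [GCW.retract_of_pushFix (y := (0, x)) (.inr h)]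
    exact .inl ⟨rfl, h⟩
  · have hV := GCW.retract_mem_subcomplex (A := T.U) T.hV (y := (0, x)) (T.mem_V_of_notMem_U h)
    rcases GCW.retract_mem (K := T.X.cw) (A := T.U) (0, x) with h1 | h1
    · exact .inr (.inr ⟨congrArg Triv.mk h1, hV⟩)
    · exact .inr (.inl ⟨h1, hV⟩)

/-- A section up to homotopy of the projection `X' → X`. -/
noncomputable def xToCyl : GMap T.X T.cyl :=
  ⟨fun x => ⟨_, T.retract_mem_cylSet x⟩,
    have h := (GCW.continuous_retract (K := T.X.cw) T.hU).comp
      (continuous_const.prodMk continuous_id : Continuous fun x => ((0 : unitInterval), x))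
    ((Triv.continuous_mk.comp (continuous_fst.comp h)).prodMk
      (continuous_snd.comp h)).subtype_mk _,
    fun g x => Subtype.ext <| by
      have h := GCW.retract_smul (K := T.X.cw) T.hU 0 g x
      exact Prod.ext (congrArg (fun y => Triv.mk y.1) h) (congrArg (fun y => y.2) h)⟩

/-- The composite is the `X`-component of the retraction at height zero; raising the height to one
deforms it to the identity. -/
theorem cylToX_comp_xToCyl_homotopic :
    (T.cylToX.plus.comp T.xToCyl.plus).Homotopic (PtGMap.id _) := by
  have h := GMap.plus_homotopic (X := T.X) (Y := T.X)
    ⟨fun x => (T.X.cw.retract T.U (0, x)).2, (continuous_snd.comp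
      (GCW.continuous_retract (K := T.X.cw) T.hU)).comp (continuous_const.prodMk continuous_id),
      fun g x => congrArg Prod.snd (GCW.retract_smul (K := T.X.cw) T.hU 0 g x)⟩
    ⟨fun x => x, continuous_id, fun _ _ => rfl⟩ (fun y => (T.X.cw.retract T.U y).2)
    (continuous_snd.comp (GCW.continuous_retract (K := T.X.cw) T.hU))
    (fun t g x => congrArg Prod.snd (GCW.retract_smul (K := T.X.cw) T.hU t g x)) (fun _ => rfl)
    (fun x => congrArg Prod.snd (GCW.retract_of_pushFix (y := (1, x)) (.inl rfl)))
  convert h using 1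
  · exact PtGMap.ext fun x => by cases x <;> rfl
  · exact PtGMap.ext fun x => by cases x <;> rfl

end GCWTriad

namespace MultCohomology

variable (E : MultCohomology.{u, v} G) (T : GCWTriad G)

theorem pull_xToCyl_pull_cylToX (x : E.coh T.X) :
    E.pull T.xToCyl (E.pull T.cylToX x) = x := by
  rw [← E.map_comp, E.map_homotopic _ _ T.cylToX_comp_xToCyl_homotopic, E.map_id]

/-- This gives uniqueness of the connecting map. The other homotopy is not needed, since existence
comes from an explicit construction. -/
theorem pull_cylToX_injective : Function.Injective (E.pull T.cylToX) :=
  Function.LeftInverse.injective (g := E.pull T.xToCyl) (E.pull_xToCyl_pull_cylToX T)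

end MultCohomology

/-! ### Excision, and the collapse of `X'` through the mapping cone of `W ⊂ V` -/

namespace GCWTriad

variable (T : GCWTriad G)

theorem iV_mem_range (y : T.spV.plus.carrier) (hy : y ∈ range T.jV.plus) :
    T.iV.plus y ∈ range T.iU.plus := by
  obtain ⟨x, rfl⟩ := hy
  exact ⟨T.jU.plus x, by cases x <;> rfl⟩

/-- The excision map `V / W → X / U`. -/
noncomputable def excision : PtGMap T.isCofib_jV.quot T.isCofib_iU.quot :=
  T.iV.plus.quotMap T.isCofib_jV.isSubcomplex T.jV.plus.pt_mem_range T.isCofib_iU.isSubcomplex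
    T.iU.plus.pt_mem_range T.iV_mem_range

theorem excision_proj (y : T.spV.plus.carrier) :
    T.excision (T.isCofib_jV.proj y) = T.isCofib_iU.proj (T.iV.plus y) :=
  PtGMap.quotLift_apply T.isCofib_jV.isSubcomplex T.jV.plus.pt_mem_range
    (T.isCofib_iU.proj.comp T.iV.plus)
    (fun y hy => PtGCW.proj_eq_pt_iff.2 (T.iV_mem_range y hy)) y

theorem isCofib_iV : T.iV.plus.IsCofib :=
  T.iV.isCofib_plus T.hV.isClosed.isClosedEmbedding_subtypeVal <| by
    rw [show range T.iV.toFun = T.V from Subtype.range_coe]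
    exact T.hV

theorem mem_range_jV (y : T.spV.plus.carrier) (h : T.iV.plus y ∈ range T.iU.plus) :
    y ∈ range T.jV.plus := by
  obtain ⟨x | x, hx⟩ := h <;> rcases y with y | y
  · have h : x.1 = y.1 := Sum.inl_injective hx
    exact ⟨.inl ⟨y.1, h ▸ x.2, y.2⟩, rfl⟩
  · exact absurd hx Sum.inl_ne_inr
  · exact absurd hx Sum.inr_ne_inl
  · exact ⟨.inr PUnit.unit, rfl⟩

/-- Bijectivity is set theory from `X = U ∪ V`. The map is closed because `V → X → X / U` is a
composite of closed maps. -/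
theorem isHomeomorph_excision : IsHomeomorph T.excision := by
  rw [isHomeomorph_iff_continuous_isClosedMap_bijective]
  have hq := T.spV.plus.isQuotientMap_proj _ T.isCofib_jV.isSubcomplex T.jV.plus.pt_mem_range
  refine ⟨T.excision.continuous, ?_, ?_, ?_⟩
  · have : IsClosedMap (T.excision ∘ T.isCofib_jV.proj) := by
      rw [show T.excision ∘ T.isCofib_jV.proj = T.isCofib_iU.proj ∘ T.iV.plus from
        funext T.excision_proj]
      exact (T.X.plus.isClosedMap_proj _ _ _).comp T.isCofib_iV.isClosedEmbedding.isClosedMap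
    exact this.of_comp_surjective hq.surjective hq.continuous
  · intro a b hab
    obtain ⟨a, rfl⟩ := hq.surjective a
    obtain ⟨b, rfl⟩ := hq.surjective b
    have h := (T.excision_proj a).symm.trans (hab.trans (T.excision_proj b))
    refine PtGCW.proj_eq_iff.2 ((PtGCW.proj_eq_iff.1 h).imp
      (fun h => T.isCofib_iV.isClosedEmbedding.injective h) fun h => ?_)
    exact ⟨T.mem_range_jV a h.1, T.mem_range_jV b h.2⟩
  · intro c
    obtain ⟨c, rfl⟩ := (T.X.plus.isQuotientMap_proj _ T.isCofib_iU.isSubcomplex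
      T.iU.plus.pt_mem_range).surjective c
    rcases c with x | x
    · by_cases h : x ∈ T.U
      · refine ⟨_, T.excision.map_pt.trans (PtGCW.proj_eq_pt_iff.2 ?_).symm⟩
        exact ⟨.inl ⟨x, h⟩, rfl⟩
      · exact ⟨_, T.excision_proj (.inl ⟨x, T.mem_V_of_notMem_U h⟩)⟩
    · exact ⟨_, T.excision_proj (.inr x)⟩

/-- The mapping cone of the inclusion of `W₊` in `V₊`. -/
noncomputable abbrev cone : PtGCW G :=
  T.spV.plus.mappingCone T.isCofib_jV.isSubcomplex T.jV.plus.pt_mem_range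

theorem mem_V_or (p : T.cyl.carrier) :
    T.cylPt p ∈ T.V ∨ (T.cylCoord p = 0 ∧ T.cylPt p ∈ T.U) := by
  rcases T.cyl_cases p with h | h | h
  · exact .inr h
  · exact .inl h.2
  · exact .inl h.2

theorem eq_one_or (p : T.cyl.carrier) (h : T.cylPt p ∈ T.V) : T.cylCoord p = 1 ∨
    (Sum.inl ⟨T.cylPt p, h⟩ : T.spV.plus.carrier) ∈ range T.jV.plus := by
  rcases T.cyl_cases p with h' | h' | h'
  · exact .inr (T.mem_range_jV _ ⟨.inl ⟨_, h'.2⟩, rfl⟩)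
  · exact .inr (T.mem_range_jV _ ⟨.inl ⟨_, h'.1⟩, rfl⟩)
  · exact .inl h'.1

/-- The point of the mapping cone given by a point of `X'` over `V`. -/
noncomputable def toConeOfMem (p : {p : T.cyl.carrier | T.cylPt p ∈ T.V}) : T.cone.carrier :=
  T.spV.plus.coneProj _ _ (T.spV.plus.mappingCylMk T.isCofib_jV.isSubcomplex
    T.jV.plus.pt_mem_range (T.cylCoord p.1) (.inl ⟨T.cylPt p.1, p.2⟩) (T.eq_one_or p.1 p.2))

theorem continuous_toConeOfMem : Continuous T.toConeOfMem :=
  (PtGMap.continuous _).comp (T.spV.plus.continuous_mappingCylMk T.isCofib_jV.isSubcomplex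
    T.jV.plus.pt_mem_range (T.continuous_cylCoord.comp continuous_subtype_val)
    (continuous_inl.comp ((T.continuous_cylPt.comp continuous_subtype_val).subtype_mk _)) _)

/-- The collapse of `U` from the double mapping cylinder to the mapping cone. -/
noncomputable def cylToConeMap : GMap T.cyl T.cone.toGCWSpace :=
  GMap.extend (P := {p | T.cylPt p ∈ T.V}) (Q := {p | T.cylCoord p = 0 ∧ T.cylPt p ∈ T.U})
    (T.hV.isClosed.preimage T.continuous_cylPt)
    ((isClosed_singleton.preimage T.continuous_cylCoord).inter
      (T.hU.isClosed.preimage T.continuous_cylPt))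
    T.mem_V_or (fun g _ => T.hV.smul_mem_iff g) T.toConeOfMem T.continuous_toConeOfMem
    (fun _ _ _ _ => rfl) (fun _ _ h => PtGCW.coneProj_eq_pt_iff.2 (.inl h.1))

theorem cylToConeMap_of_mem (p : T.cyl.carrier) (h : T.cylPt p ∈ T.V) :
    T.cylToConeMap.toFun p = T.toConeOfMem ⟨p, h⟩ := dif_pos (c := T.cylPt p ∈ T.V) h

theorem cylToConeMap_eq_pt (p : T.cyl.carrier) (h : T.cylCoord p = 0 ∧ T.cylPt p ∈ T.U) :
    T.cylToConeMap.toFun p = T.cone.pt :=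
  GMap.extend_eq_pt (T := T.cone) (x := p) h

/-- The pointed map from the double mapping cylinder to the mapping cone. -/
noncomputable def cylToCone : PtGMap T.cyl.plus T.cone := T.cylToConeMap.plusLift

/-- One of two commuting diagrams relating `X'` to the pair `(V, W)`; `pinch_eq_cone` is the other.
Together they turn the definition of `δ` into the connecting map of that pair. -/
theorem proj_cylToX : T.isCofib_iU.proj.comp T.cylToX.plus =
    T.excision.comp ((T.spV.plus.coneToQuot _ _).comp T.cylToCone) := by
  refine PtGMap.ext ?_
  rintro (p | p)
  · rcases T.mem_V_or p with h | h
    · refine Eq.symm <| (congrArg (fun z => T.excision (T.spV.plus.coneToQuot _ _ z))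
        (T.cylToConeMap_of_mem p h)).trans ?_
      exact (congrArg T.excision (PtGCW.coneToQuot_apply _ _ _ _)).trans (T.excision_proj _)
    · refine Eq.trans ?_ ((congrArg (fun z => T.excision (T.spV.plus.coneToQuot _ _ z))
        (T.cylToConeMap_eq_pt p h)).trans ((congrArg T.excision (PtGMap.map_pt _)).trans
          (PtGMap.map_pt _))).symm
      exact PtGCW.proj_eq_pt_iff.2 ⟨.inl ⟨_, h.2⟩, rfl⟩
  · exact (PtGMap.map_pt _ : (T.isCofib_iU.proj.comp T.cylToX.plus).toFun T.cyl.plus.pt = _).trans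
      (PtGMap.map_pt (T.excision.comp ((T.spV.plus.coneToQuot _ _).comp T.cylToCone))).symm

theorem ofRange_jV (w : T.spW.plus.carrier) (h : T.jV.plus w ∈ range T.jV.plus) :
    T.isCofib_jV.ofRange ⟨T.jV.plus w, h⟩ = w :=
  T.isCofib_jV.ofRange_apply w

theorem pinch_of_mem (p : T.cyl.carrier) (h : T.cylPt p ∈ T.U ∩ T.V) :
    T.pinch (.inl p) = T.suspMk (T.cylCoord p) ⟨T.cylPt p, h⟩ := dif_pos h

theorem pinch_of_notMem (p : T.cyl.carrier) (h : T.cylPt p ∉ T.U ∩ T.V) :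
    T.pinch (.inl p) = T.spW.plus.susp.pt := dif_neg h

/-- Both ends can be collapsed in two stages: `U` first, giving the cone on `W` in `V`, and then
`V`. -/
theorem pinch_eq_cone :
    T.pinch = T.isCofib_jV.ofRange.susp.comp ((T.spV.plus.coneToSusp _ _).comp T.cylToCone) := by
  refine PtGMap.ext ?_
  rintro (p | p)
  · by_cases hp : T.cylPt p ∈ T.U ∩ T.V
    · refine (T.pinch_of_mem p hp).trans (Eq.symm ?_)
      refine (congrArg (fun z => T.isCofib_jV.ofRange.susp (T.spV.plus.coneToSusp _ _ z))
        (T.cylToConeMap_of_mem p hp.2)).trans ?_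
      have hr : T.jV.plus (.inl ⟨T.cylPt p, hp⟩) ∈ range T.jV.plus := mem_range_self _
      refine (congrArg T.isCofib_jV.ofRange.susp
        (PtGCW.coneToSusp_of_mem _ _ _ _ hr)).trans ?_
      exact congrArg (fun w => T.spW.plus.toSusp (PtGCW.circleMk (T.cylCoord p), w))
        (T.ofRange_jV (.inl ⟨T.cylPt p, hp⟩) hr)
    · refine (T.pinch_of_notMem p hp).trans (Eq.symm ?_)
      refine Eq.trans (congrArg T.isCofib_jV.ofRange.susp ?_) (PtGMap.map_pt _)
      rcases T.mem_V_or p with h | h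
      · refine (congrArg (T.spV.plus.coneToSusp _ _) (T.cylToConeMap_of_mem p h)).trans ?_
        refine PtGCW.coneToSusp_eq_pt _ _ _ _ ?_
        rcases T.cyl_cases p with h' | h' | h'
        · exact absurd ⟨h'.2, h⟩ hp
        · exact absurd h' hp
        · exact h'.1
      · exact (congrArg (T.spV.plus.coneToSusp _ _) (T.cylToConeMap_eq_pt p h)).trans
          (PtGMap.map_pt _)
  · exact T.pinch.map_pt.trans (PtGMap.map_pt (T.isCofib_jV.ofRange.susp.comp
      ((T.spV.plus.coneToSusp _ _).comp T.cylToCone))).symm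

end GCWTriad

/-! ### Existence and uniqueness of the Mayer–Vietoris connecting map -/

namespace MultCohomology

variable (E : MultCohomology.{u, v} G) (T : GCWTriad G)

/-- The connecting map of the Mayer-Vietoris sequence. -/
noncomputable def mvConnect : E.coh T.spW →+ E.coh T.X :=
  (E.map T.isCofib_iU.proj : E.carrier T.isCofib_iU.quot →+ E.coh T.X).comp
    ((E.map (T.excision.inv T.isHomeomorph_excision) :
      E.carrier T.isCofib_jV.quot →+ E.carrier T.isCofib_iU.quot).comp (E.connectOf T.isCofib_jV))

theorem mvConnect_apply (w : E.coh T.spW) : E.mvConnect T w = E.map T.isCofib_iU.proj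
    (E.map (T.excision.inv T.isHomeomorph_excision) (E.connectOf T.isCofib_jV w)) := rfl

/-- The factorization of `pinch` through the cone turns the suspension of `w` into the connecting
map of `(V, W)`, and `proj_cylToX` identifies its pullback to `X'` with the one through `X → X / U`.
-/
theorem isConnecting_mvConnect : E.IsConnecting T (E.mvConnect T) := by
  intro w
  rw [mvConnect_apply, T.pinch_eq_cone, E.map_comp, E.map_comp, ← E.susp_natural,
    ← E.map_coneToQuot_connect, ← E.connectOf_apply, pull, ← E.map_comp, T.proj_cylToX, E.map_comp,
    E.map_map_inv, E.map_comp]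

theorem IsConnecting.eq {E : MultCohomology.{u, v} G} {T : GCWTriad G}
    {δ : E.coh T.spW →+ E.coh T.X} (h : E.IsConnecting T δ) : δ = E.mvConnect T :=
  AddMonoidHom.ext fun w => E.pull_cylToX_injective T
    ((h w).trans (E.isConnecting_mvConnect T w).symm)

theorem existsUnique_isConnecting : ∃! δ : E.coh T.spW →+ E.coh T.X, E.IsConnecting T δ :=
  ⟨_, E.isConnecting_mvConnect T, fun _ h => h.eq⟩

end MultCohomology

/-! ### The collapse of `X'` through `X ∪ S¹ × W` -/

namespace GCWTriad

variable (T : GCWTriad G)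

theorem proj_comp_iV :
    T.isCofib_iU.proj.comp T.iV.plus = T.excision.comp T.isCofib_jV.proj :=
  PtGMap.ext fun y => (T.excision_proj y).symm

/-- `X ∪ S¹ × W`, with a disjoint base point added to `X` and `W`. -/
noncomputable abbrev loop : PtGCW G := T.X.plus.loopCyl T.isCofib_iW.isSubcomplex

theorem cylToLoop_mem (p : T.cyl.carrier) :
    ((PtGCW.circleMk (T.cylCoord p), Sum.inl (T.cylPt p)) :
      Triv.{u} UnitAddCircle × T.X.plus.carrier) ∈
    (({Triv.mk 0} ×ˢ univ ∪ univ ×ˢ range T.iW.plus) :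
      Set (Triv.{u} UnitAddCircle × T.X.plus.carrier)) := by
  rcases T.cyl_cases p with h | h | h
  · exact .inl ⟨congrArg PtGCW.circleMk h.1, trivial⟩
  · exact .inr ⟨trivial, .inl ⟨_, h⟩, rfl⟩
  · exact .inl ⟨(congrArg PtGCW.circleMk h.1).trans PtGCW.circleMk_one, trivial⟩

/-- The map from the double mapping cylinder to `X ∪ S¹ × W`. -/
noncomputable def cylToLoopMap : GMap T.cyl T.loop.toGCWSpace :=
  ⟨fun p => ⟨_, T.cylToLoop_mem p⟩,
    ((Triv.continuous_mk.comp ((AddCircle.continuous_mk' 1).comp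
      (continuous_subtype_val.comp T.continuous_cylCoord))).prodMk
      (continuous_inl.comp T.continuous_cylPt)).subtype_mk _, fun _ _ => rfl⟩

/-- The pointed map from the double mapping cylinder to `X ∪ S¹ × W`. -/
noncomputable def cylToLoop : PtGMap T.cyl.plus T.loop := T.cylToLoopMap.plusLift

theorem loopCylSnd_comp_cylToLoop :
    (T.X.plus.loopCylSnd T.isCofib_iW.isSubcomplex).comp T.cylToLoop = T.cylToX.plus :=
  PtGMap.ext fun p => by cases p <;> rfl

theorem mem_range_iW (x : T.X.carrier) (h : (.inl x : T.X.plus.carrier) ∈ range T.iW.plus) :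
    x ∈ T.U ∩ T.V := by
  obtain ⟨w | w, hw⟩ := h
  · exact (Sum.inl_injective hw : w.1 = x) ▸ w.2
  · exact absurd hw Sum.inr_ne_inl

/-- Gluing the ends of `[0, 1]` already sends both ends of `X'` into the copy of `X`, which the
second map collapses. The intermediate space also maps to `X`, compatibly with `X' → X`, so classes
of `E X` can be multiplied there. -/
theorem pinch_eq_loop :
    T.pinch = T.isCofib_iW.ofRange.susp.comp ((T.X.plus.loopCylToSusp
      T.isCofib_iW.isSubcomplex T.iW.plus.pt_mem_range).comp T.cylToLoop) := by
  refine PtGMap.ext ?_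
  rintro (p | p)
  · by_cases hp : T.cylPt p ∈ T.U ∩ T.V
    · refine (T.pinch_of_mem p hp).trans (Eq.symm ?_)
      have hr : T.iW.plus (.inl ⟨T.cylPt p, hp⟩) ∈ range T.iW.plus := mem_range_self _
      refine (congrArg T.isCofib_iW.ofRange.susp (PtGCW.loopCylToSusp_of_mem _ _ _
        (p := T.cylToLoop (.inl p)) hr)).trans ?_
      exact congrArg (fun w => T.spW.plus.toSusp (PtGCW.circleMk (T.cylCoord p), w))
        (T.isCofib_iW.ofRange_apply (.inl ⟨T.cylPt p, hp⟩))
    · refine (T.pinch_of_notMem p hp).trans (Eq.symm ?_)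
      refine Eq.trans (congrArg T.isCofib_iW.ofRange.susp ?_) (PtGMap.map_pt _)
      exact PtGCW.loopCylToSusp_eq_pt _ _ _ (p := T.cylToLoop (.inl p))
        ((T.cylToLoop_mem p).resolve_right fun h => hp (T.mem_range_iW _ h.2)).1
  · exact T.pinch.map_pt.trans (PtGMap.map_pt (T.isCofib_iW.ofRange.susp.comp
      ((T.X.plus.loopCylToSusp _ _).comp T.cylToLoop))).symm

theorem iW_comp_ofRange : T.iW.plus.comp T.isCofib_iW.ofRange =
    T.X.plus.incl (range T.iW.plus) T.isCofib_iW.isSubcomplex T.iW.plus.pt_mem_range := by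
  refine PtGMap.ext fun y => ?_
  obtain ⟨x, rfl⟩ := (MultCohomology.isHomeomorph_codRestrict T.isCofib_iW :
    IsHomeomorph T.isCofib_iW.toRange).surjective y
  exact congrArg T.iW.plus (T.isCofib_iW.ofRange_apply x)

end GCWTriad

/-! ### Exactness of the Mayer–Vietoris sequence -/

namespace MultCohomology

variable (E : MultCohomology.{u, v} G) (T : GCWTriad G)

theorem pull_jU_pull_iU (x : E.coh T.X) : E.pull T.jU (E.pull T.iU x) = E.pull T.iW x := by
  rw [← E.map_comp]
  congr 2
  exact PtGMap.ext fun w => by cases w <;> rfl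

theorem pull_jV_pull_iV (x : E.coh T.X) : E.pull T.jV (E.pull T.iV x) = E.pull T.iW x := by
  rw [← E.map_comp]
  congr 2
  exact PtGMap.ext fun w => by cases w <;> rfl

theorem pull_iV_proj (d : E.carrier T.isCofib_iU.quot) :
    E.pull T.iV (E.map T.isCofib_iU.proj d) =
      E.map T.isCofib_jV.proj (E.map T.excision d) := by
  rw [← E.map_comp, ← E.map_comp, T.proj_comp_iV]

/-- A class that dies on `U` comes from `X / U ≅ V / W`; dying on `V` as well, it comes from `W`
through the connecting map of `(V, W)`. -/
theorem exists_mvConnect_iff (x : E.coh T.X) :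
    (∃ w, E.mvConnect T w = x) ↔ E.pull T.iU x = 0 ∧ E.pull T.iV x = 0 := by
  constructor
  · rintro ⟨w, rfl⟩
    rw [mvConnect_apply]
    refine ⟨(E.map_isCofib_eq_zero_iff T.isCofib_iU _).2 ⟨_, rfl⟩, ?_⟩
    rw [pull_iV_proj, E.map_map_inv]
    exact (E.map_isCofib_proj_eq_zero_iff T.isCofib_jV _).2 ⟨w, rfl⟩
  · rintro ⟨h1, h2⟩
    obtain ⟨d, rfl⟩ := (E.map_isCofib_eq_zero_iff T.isCofib_iU _).1 h1
    rw [pull_iV_proj] at h2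
    obtain ⟨w, hw⟩ := (E.map_isCofib_proj_eq_zero_iff T.isCofib_jV _).1 h2
    refine ⟨w, ?_⟩
    rw [mvConnect_apply, hw, E.map_inv_map]

theorem map_excision_connectOf (a : E.coh T.spU) :
    E.map T.excision (E.connectOf T.isCofib_iU a) = E.connectOf T.isCofib_jV (E.pull T.jU a) :=
  E.map_quotMap_connectOf T.isCofib_jV T.isCofib_iU T.iV.plus T.jU.plus
    (fun x => by cases x <;> rfl) T.iV_mem_range a

theorem mvConnect_pull_jU (a : E.coh T.spU) : E.mvConnect T (E.pull T.jU a) = 0 := by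
  rw [mvConnect_apply, ← map_excision_connectOf, E.map_inv_map]
  exact (E.map_isCofib_proj_eq_zero_iff T.isCofib_iU _).2 ⟨a, rfl⟩

theorem connectOf_pull_jV (b : E.coh T.spV) :
    E.connectOf T.isCofib_jV (E.pull T.jV b) = 0 :=
  (E.connectOf_eq_zero_iff T.isCofib_jV _).2 ⟨b, rfl⟩

theorem mem_imSum {w : E.coh T.spW} :
    w ∈ E.imSum T ↔ ∃ a b, E.pull T.jU a + E.pull T.jV b = w := by
  refine AddSubgroup.mem_sup.trans ⟨?_, ?_⟩
  · rintro ⟨_, ⟨a, rfl⟩, _, ⟨b, rfl⟩, h⟩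
    exact ⟨a, b, h⟩
  · rintro ⟨a, b, h⟩
    exact ⟨_, ⟨a, rfl⟩, _, ⟨b, rfl⟩, h⟩

/-- The long exact sequences of `(X, U)` and `(V, W)` are compared through excision, which matches
their connecting maps along `j_U*`. -/
theorem mvConnect_eq_zero_iff (w : E.coh T.spW) : E.mvConnect T w = 0 ↔ w ∈ E.imSum T := by
  rw [mem_imSum]
  constructor
  · intro h
    rw [mvConnect_apply] at h
    obtain ⟨a, ha⟩ := (E.map_isCofib_proj_eq_zero_iff T.isCofib_iU _).1 h
    -- Vanishing is known only in `E X`. Subtracting the pullback of a class on `U` makes the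
    -- connecting class vanish on `V / W` itself.
    have h1 : E.connectOf T.isCofib_jV (w - E.pull T.jU a) = 0 := by
      rw [map_sub, ← map_excision_connectOf, ha, E.map_map_inv, sub_self]
    obtain ⟨b, hb⟩ := (E.connectOf_eq_zero_iff T.isCofib_jV _).1 h1
    exact ⟨a, b, add_eq_of_eq_sub' hb⟩
  · rintro ⟨a, b, rfl⟩
    rw [map_add, mvConnect_pull_jU, zero_add, mvConnect_apply, connectOf_pull_jV, map_zero,
      map_zero]

/-- By naturality the obstruction to extending `a` to `X` is the obstruction to extending its
restriction to `W` over `V`, which vanishes because `b` is such an extension. -/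
theorem exists_pull_eq (a : E.coh T.spU) (b : E.coh T.spV)
    (h : E.pull T.jU a = E.pull T.jV b) :
    ∃ x, E.pull T.iU x = a ∧ E.pull T.iV x = b := by
  have h1 : E.connectOf T.isCofib_iU a = 0 := by
    apply (E.map_bijective _ T.isHomeomorph_excision).injective
    rw [map_excision_connectOf, h, connectOf_pull_jV, map_zero]
  obtain ⟨x, rfl⟩ := (E.connectOf_eq_zero_iff T.isCofib_iU _).1 h1
  have h2 : E.pull T.jV (b - E.pull T.iV x) = 0 := by
    rw [map_sub, pull_jV_pull_iV, ← pull_jU_pull_iU, ← h, sub_self]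
  obtain ⟨d, hd⟩ := (E.map_isCofib_eq_zero_iff T.isCofib_jV _).1 h2
  -- The correction comes from `X / U`: it is zero on `U`, and on `V` it supplies the missing
  -- difference.
  refine ⟨x + E.map T.isCofib_iU.proj (E.map (T.excision.inv T.isHomeomorph_excision) d), ?_, ?_⟩
  · rw [map_add, (E.map_isCofib_eq_zero_iff T.isCofib_iU _).2 ⟨_, rfl⟩, add_zero]
  · rw [map_add, pull_iV_proj, E.map_map_inv, hd, add_sub_cancel]

/-- The inverse of the pullback along `X' → X` is realized by the pullback along `xToCyl`, so only
the suspension shifts degrees. -/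
theorem mvConnect_mem (n : ℤ) (w : E.coh T.spW) (hw : w ∈ E.deg T.spW n) :
    E.mvConnect T w ∈ E.deg T.X (n + 1) := by
  rw [← E.pull_xToCyl_pull_cylToX T (E.mvConnect T w), E.isConnecting_mvConnect T w]
  exact E.map_mem _ _ _ (E.map_mem _ _ _ (E.susp_mem _ _ _ hw))

/-! ### Products with the connecting map -/

/-- Reduces a product formula in `E X` to an identity on `S¹ × W₊`, with `W₊` taken as its image in
`X₊`. The reduction is `map_loopCylSnd_mul`, transported along the factorization of `pinch`. -/
theorem mul_mvConnect (x : E.coh T.X) (w w' : E.coh T.spW)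
    (h : E.map (PtGCW.sndMap _) (E.map T.isCofib_iW.ofRange (E.pull T.iW x)) *
      (E.map (PtGCW.fstMap _) E.e * E.map (PtGCW.sndMap _) (E.map T.isCofib_iW.ofRange w)) =
      E.map (PtGCW.fstMap _) E.e * E.map (PtGCW.sndMap _) (E.map T.isCofib_iW.ofRange w')) :
    x * E.mvConnect T w = E.mvConnect T w' := by
  apply E.pull_cylToX_injective T
  rw [← E.map_comp T.iW.plus, T.iW_comp_ofRange] at h
  have := E.map_loopCylSnd_mul _ _ _ _ _ h
  rw [map_mul, E.isConnecting_mvConnect T w, E.isConnecting_mvConnect T w', T.pinch_eq_loop,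
    E.map_comp, E.map_comp, ← E.susp_natural, E.map_comp, E.map_comp, ← E.susp_natural, ← this,
    map_mul, pull, ← T.loopCylSnd_comp_cylToLoop, E.map_comp]

theorem mul_mvConnect_of_pull_eq_zero (x : E.coh T.X) (hx : E.pull T.iW x = 0)
    (w : E.coh T.spW) : x * E.mvConnect T w = 0 := by
  -- With `w' = 0` both sides of the identity on `S¹ × W₊` vanish.
  rw [E.mul_mvConnect T x w 0 (by simp only [hx, map_zero, zero_mul, mul_zero]), map_zero]

theorem mul_comm_of_even {Y : PtGCW G} {k m : ℤ} {x y : E.carrier Y} (hx : x ∈ E.gr Y (2 * k))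
    (hy : y ∈ E.gr Y m) : x * y = y * x := by
  rw [E.graded_comm Y _ _ x y hx hy, mul_assoc, Int.negOnePow_two_mul]
  simp

theorem mul_mvConnect_of_even (x : E.coh T.X) (hx : x ∈ E.even T.X) (w : E.coh T.spW) :
    x * E.mvConnect T w = E.mvConnect T (E.pull T.iW x * w) := by
  refine AddSubgroup.iSup_induction _
    (C := fun x => x * E.mvConnect T w = E.mvConnect T (E.pull T.iW x * w)) hx
    (fun k x hx => ?_) ?_ fun x y hx hy => ?_
  · apply E.mul_mvConnect
    -- Moving a class of even degree past `e` costs no sign.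
    rw [← mul_assoc, E.mul_comm_of_even (E.map_mem _ _ _ (E.map_mem _ _ _ (E.map_mem _ _ _ hx)))
      (E.map_mem _ _ _ E.e_mem), mul_assoc, map_mul, map_mul]
  · rw [zero_mul, map_zero, zero_mul, map_zero]
  · rw [add_mul, hx, hy, map_add, add_mul, map_add]

end MultCohomology

/-! ### Homogeneous components, even and odd parts -/

namespace MultCohomology

variable (E : MultCohomology.{u, v} G)

section

variable {X Y : PtGCW G}

/-- The homogeneous component of degree `n`. -/
noncomputable def component (X : PtGCW G) (n : ℤ) : E.carrier X →+ E.carrier X :=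
  letI := (E.isInternal X).chooseDecomposition
  ((E.gr X n).subtype.comp (DFinsupp.evalAddMonoidHom n)).comp
    (DirectSum.decomposeAddEquiv (E.gr X) : E.carrier X →+ DirectSum ℤ fun i => E.gr X i)

theorem component_mem (n : ℤ) (x : E.carrier X) : E.component X n x ∈ E.gr X n :=
  SetLike.coe_mem _

theorem component_of_mem {n : ℤ} {x : E.carrier X} (h : x ∈ E.gr X n) :
    E.component X n x = x :=
  letI := (E.isInternal X).chooseDecomposition
  DirectSum.decompose_of_mem_same _ h

theorem component_of_mem_ne {m n : ℤ} {x : E.carrier X} (h : x ∈ E.gr X m) (hmn : m ≠ n) :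
    E.component X n x = 0 :=
  letI := (E.isInternal X).chooseDecomposition
  DirectSum.decompose_of_mem_ne _ h hmn

theorem eq_zero_of_component {x : E.carrier X} (h : ∀ n, E.component X n x = 0) : x = 0 := by
  let _ := (E.isInternal X).chooseDecomposition
  apply (DirectSum.decompose (E.gr X)).injective
  rw [DirectSum.decompose_zero]
  exact DFinsupp.ext fun n => Subtype.ext (h n)

theorem mem_gr_iff {n : ℤ} {x : E.carrier X} :
    x ∈ E.gr X n ↔ ∀ m, m ≠ n → E.component X m x = 0 := by
  refine ⟨fun h m hm => E.component_of_mem_ne h hm.symm, fun h => ?_⟩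
  have : x - E.component X n x = 0 := E.eq_zero_of_component fun m => by
    rw [map_sub]
    rcases eq_or_ne m n with rfl | hm
    · rw [E.component_of_mem (E.component_mem m x), sub_self]
    · rw [h m hm, E.component_of_mem_ne (E.component_mem n x) hm.symm, sub_zero]
  rw [sub_eq_zero.1 this]
  exact E.component_mem n x

theorem induction_gr {p : E.carrier X → Prop} (x : E.carrier X)
    (hp : ∀ n, ∀ x ∈ E.gr X n, p x) (h0 : p 0) (hadd : ∀ x y, p x → p y → p (x + y)) : p x :=
  let _ := (E.isInternal X).chooseDecomposition
  DirectSum.Decomposition.inductionOn (E.gr X) h0 (fun m => hp _ _ m.2) hadd x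

theorem component_map (f : PtGMap X Y) (n : ℤ) (y : E.carrier Y) :
    E.component X n (E.map f y) = E.map f (E.component Y n y) := by
  refine E.induction_gr (p := fun y => E.component X n (E.map f y) =
    E.map f (E.component Y n y)) y (fun m y hy => ?_)
    (by rw [map_zero, map_zero, map_zero, map_zero]) fun x y hx hy => ?_
  · rcases eq_or_ne m n with rfl | hm
    · rw [E.component_of_mem hy, E.component_of_mem (E.map_mem f _ _ hy)]
    · rw [E.component_of_mem_ne hy hm, E.component_of_mem_ne (E.map_mem f _ _ hy) hm, map_zero]
  · simp only [map_add, hx, hy]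

end

section

variable {X Y : GCWSpace G}

theorem component_of_mem_even {x : E.coh X} (hx : x ∈ E.even X) (k : ℤ) :
    E.component X.plus (2 * k + 1) x = 0 :=
  AddSubgroup.iSup_induction _ (C := fun x => E.component X.plus (2 * k + 1) x = 0) hx
    (fun _ _ hx => E.component_of_mem_ne hx (by omega)) (map_zero _)
    fun x y hx hy => by rw [map_add, hx, hy, add_zero]

theorem component_of_mem_odd {x : E.coh X} (hx : x ∈ E.odd X) (k : ℤ) :
    E.component X.plus (2 * k) x = 0 :=
  AddSubgroup.iSup_induction _ (C := fun x => E.component X.plus (2 * k) x = 0) hx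
    (fun _ _ hx => E.component_of_mem_ne hx (by omega)) (map_zero _)
    fun x y hx hy => by rw [map_add, hx, hy, add_zero]

theorem mem_even_of_mem_deg {x : E.coh X} {k : ℤ} (hx : x ∈ E.deg X (2 * k)) : x ∈ E.even X :=
  AddSubgroup.mem_iSup_of_mem k hx

theorem mem_odd_of_mem_deg {x : E.coh X} {k : ℤ} (hx : x ∈ E.deg X (2 * k + 1)) : x ∈ E.odd X :=
  AddSubgroup.mem_iSup_of_mem k hx

theorem exists_even_add_odd (x : E.coh X) : ∃ y ∈ E.even X, ∃ z ∈ E.odd X, y + z = x := by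
  refine E.induction_gr (p := fun x => ∃ y ∈ E.even X, ∃ z ∈ E.odd X, y + z = x) x
    (fun n x hx => ?_) ?_ ?_
  · obtain ⟨k, rfl | rfl⟩ := Int.even_or_odd' n
    · exact ⟨x, E.mem_even_of_mem_deg hx, 0, zero_mem _, add_zero x⟩
    · exact ⟨0, zero_mem _, x, E.mem_odd_of_mem_deg hx, zero_add x⟩
  · exact ⟨0, zero_mem _, 0, zero_mem _, add_zero 0⟩
  · rintro _ _ ⟨a, ha, b, hb, rfl⟩ ⟨c, hc, d, hd, rfl⟩
    exact ⟨a + c, add_mem ha hc, b + d, add_mem hb hd, add_add_add_comm a c b d⟩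

theorem component_mem_even {x : E.coh X} (hx : x ∈ E.even X) (n : ℤ) :
    E.component X.plus n x ∈ E.even X := by
  obtain ⟨k, rfl | rfl⟩ := Int.even_or_odd' n
  · exact E.mem_even_of_mem_deg (E.component_mem _ x)
  · rw [E.component_of_mem_even hx]
    exact zero_mem _

theorem mem_odd_of_component {x : E.coh X} (h : ∀ k, E.component X.plus (2 * k) x = 0) :
    x ∈ E.odd X := by
  obtain ⟨y, hy, z, hz, rfl⟩ := E.exists_even_add_odd x
  have : y = 0 := E.eq_zero_of_component fun n => by
    obtain ⟨k, rfl | rfl⟩ := Int.even_or_odd' n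
    · rw [← h k, map_add, E.component_of_mem_odd hz, add_zero]
    · exact E.component_of_mem_even hy k
  rwa [this, zero_add]

/-- Pullbacks preserve degrees, and there is nothing of odd degree to land in. -/
theorem pull_eq_zero_of_mem_odd (h : ∀ k : ℤ, E.deg X (2 * k + 1) = ⊥) (f : GMap X Y)
    {y : E.coh Y} (hy : y ∈ E.odd Y) : E.pull f y = 0 :=
  AddSubgroup.iSup_induction _ (C := fun y => E.pull f y = 0) hy
    (fun k y hy => by
      have := E.map_mem f.plus _ y hy
      rwa [show E.gr X.plus _ = ⊥ from h k, AddSubgroup.mem_bot] at this) (map_zero _)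
    fun x y hx hy => by rw [map_add, hx, hy, add_zero]

end

/-! ### The sequence when `U`, `V`, `W` have no odd cohomology -/

variable (T : GCWTriad G)

theorem component_mvConnect (n : ℤ) (w : E.coh T.spW) :
    E.component T.X.plus (n + 1) (E.mvConnect T w) =
      E.mvConnect T (E.component T.spW.plus n w) := by
  refine E.induction_gr (p := fun w => E.component T.X.plus (n + 1) (E.mvConnect T w) =
    E.mvConnect T (E.component T.spW.plus n w)) w (fun m w hw => ?_)
    (by rw [map_zero, map_zero, map_zero, map_zero]) fun x y hx hy => ?_
  · rcases eq_or_ne m n with rfl | hm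
    · rw [E.component_of_mem hw, E.component_of_mem (E.mvConnect_mem T _ _ hw)]
    · rw [E.component_of_mem_ne hw hm, map_zero,
        E.component_of_mem_ne (E.mvConnect_mem T _ _ hw) (by omega)]
  · simp only [map_add, hx, hy]

theorem mvConnect_mem_odd (hW : ∀ k : ℤ, E.deg T.spW (2 * k + 1) = ⊥) (w : E.coh T.spW) :
    E.mvConnect T w ∈ E.odd T.X :=
  E.mem_odd_of_component fun k => by
    have h := E.component_mem (2 * (k - 1) + 1) w
    rw [show E.gr T.spW.plus _ = ⊥ from hW _, AddSubgroup.mem_bot] at h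
    -- The part of `δ w` in degree `2 k` comes from the part of `w` in the odd degree `2 k - 1`,
    -- which is zero.
    rw [show 2 * k = 2 * (k - 1) + 1 + 1 by ring, component_mvConnect, h, map_zero]

/-- By exactness `x` is in the image of the connecting map, which consists of odd classes; an even
and odd class is zero. -/
theorem eq_zero_of_pull_eq_zero (hW : ∀ k : ℤ, E.deg T.spW (2 * k + 1) = ⊥) {x : E.coh T.X}
    (hx : x ∈ E.even T.X) (h1 : E.pull T.iU x = 0) (h2 : E.pull T.iV x = 0) : x = 0 := by
  obtain ⟨w, rfl⟩ := (E.exists_mvConnect_iff T x).2 ⟨h1, h2⟩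
  refine E.eq_zero_of_component fun n => ?_
  obtain ⟨k, rfl | rfl⟩ := Int.even_or_odd' n
  · exact E.component_of_mem_odd (E.mvConnect_mem_odd T hW w) k
  · exact E.component_of_mem_even hx k

/-- The ring homomorphism `E^{even} X → E U ×_{E W} E V`. -/
def evenToFibreProduct : E.even T.X →ₙ+* E.fibreProduct T :=
  NonUnitalRingHom.codRestrict
    (((E.pull T.iU).prod (E.pull T.iV)).comp (NonUnitalSubringClass.subtype (E.even T.X)))
    (E.fibreProduct T) fun x =>
      (E.pull_jU_pull_iU T x).trans (E.pull_jV_pull_iV T x).symm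

theorem evenToFibreProduct_bijective (hU : ∀ k : ℤ, E.deg T.spU (2 * k + 1) = ⊥)
    (hV : ∀ k : ℤ, E.deg T.spV (2 * k + 1) = ⊥) (hW : ∀ k : ℤ, E.deg T.spW (2 * k + 1) = ⊥) :
    Function.Bijective (E.evenToFibreProduct T) := by
  constructor
  · rw [injective_iff_map_eq_zero]
    intro x hx
    have h := congrArg Subtype.val hx
    exact Subtype.ext
      (E.eq_zero_of_pull_eq_zero T hW x.2 (congrArg Prod.fst h) (congrArg Prod.snd h))
  · rintro ⟨⟨a, b⟩, h⟩
    obtain ⟨x, hx1, hx2⟩ := E.exists_pull_eq T a b h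
    -- The odd part of a lift restricts to zero on `U` and `V`, so it can be dropped.
    obtain ⟨y, hy, z, hz, rfl⟩ := E.exists_even_add_odd x
    rw [map_add, E.pull_eq_zero_of_mem_odd hU _ hz, add_zero] at hx1
    rw [map_add, E.pull_eq_zero_of_mem_odd hV _ hz, add_zero] at hx2
    exact ⟨⟨y, hy⟩, Subtype.ext (Prod.ext hx1 hx2)⟩

/-- The components of `x` in the other degrees restrict to zero on `U` and `V`, hence vanish by
injectivity on even classes. -/
theorem mem_deg_iff (hW : ∀ k : ℤ, E.deg T.spW (2 * k + 1) = ⊥) (n : ℤ) {x : E.coh T.X}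
    (hx : x ∈ E.even T.X) : x ∈ E.deg T.X n ↔
      E.pull T.iU x ∈ E.deg T.spU n ∧ E.pull T.iV x ∈ E.deg T.spV n := by
  refine ⟨fun h => ⟨E.map_mem _ _ _ h, E.map_mem _ _ _ h⟩, fun h => E.mem_gr_iff.2 fun m hm => ?_⟩
  refine E.eq_zero_of_pull_eq_zero T hW (E.component_mem_even hx m) ?_ ?_
  · rw [← component_map]
    exact E.mem_gr_iff.1 h.1 m hm
  · rw [← component_map]
    exact E.mem_gr_iff.1 h.2 m hm

/-- Restriction to `W` factors through `U` and through `V`, so multiplication by `x` can be carried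
out before restricting either summand. -/
theorem mul_mem_imSum (x : E.coh T.X) {w : E.coh T.spW} (hw : w ∈ E.imSum T) :
    E.pull T.iW x * w ∈ E.imSum T := by
  obtain ⟨a, b, rfl⟩ := (E.mem_imSum T).1 hw
  refine (E.mem_imSum T).2 ⟨E.pull T.iU x * a, E.pull T.iV x * b, ?_⟩
  rw [map_mul, map_mul, pull_jU_pull_iU, pull_jV_pull_iV, mul_add]

/-- The map `E W / (im j_U* + im j_V*) → E^{odd} X` induced by the connecting map. -/
noncomputable def quotientToOdd (hW : ∀ k : ℤ, E.deg T.spW (2 * k + 1) = ⊥) :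
    (E.coh T.spW ⧸ E.imSum T) →+ E.odd T.X :=
  QuotientAddGroup.lift (E.imSum T)
    ((E.mvConnect T).codRestrict (E.odd T.X) (E.mvConnect_mem_odd T hW)) fun _ hw =>
      Subtype.ext ((E.mvConnect_eq_zero_iff T _).2 hw)

theorem quotientToOdd_mk (hW : ∀ k : ℤ, E.deg T.spW (2 * k + 1) = ⊥) (w : E.coh T.spW) :
    (E.quotientToOdd T hW (QuotientAddGroup.mk w) : E.coh T.X) = E.mvConnect T w := rfl

theorem exists_mvConnect_of_mem_odd (hU : ∀ k : ℤ, E.deg T.spU (2 * k + 1) = ⊥)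
    (hV : ∀ k : ℤ, E.deg T.spV (2 * k + 1) = ⊥) {x : E.coh T.X} (hx : x ∈ E.odd T.X) :
    ∃ w, E.mvConnect T w = x :=
  (E.exists_mvConnect_iff T x).2
    ⟨E.pull_eq_zero_of_mem_odd hU _ hx, E.pull_eq_zero_of_mem_odd hV _ hx⟩

theorem quotientToOdd_bijective (hU : ∀ k : ℤ, E.deg T.spU (2 * k + 1) = ⊥)
    (hV : ∀ k : ℤ, E.deg T.spV (2 * k + 1) = ⊥) (hW : ∀ k : ℤ, E.deg T.spW (2 * k + 1) = ⊥) :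
    Function.Bijective (E.quotientToOdd T hW) := by
  constructor
  · rw [injective_iff_map_eq_zero]
    rintro ⟨w⟩ h
    exact (QuotientAddGroup.eq_zero_iff w).2
      ((E.mvConnect_eq_zero_iff T w).1 (congrArg Subtype.val h))
  · rintro ⟨x, hx⟩
    obtain ⟨w, rfl⟩ := E.exists_mvConnect_of_mem_odd T hU hV hx
    exact ⟨QuotientAddGroup.mk w, rfl⟩

theorem quotientToOdd_mem_iff (hW : ∀ k : ℤ, E.deg T.spW (2 * k + 1) = ⊥) (n : ℤ)
    (y : E.coh T.spW ⧸ E.imSum T) : (E.quotientToOdd T hW y : E.coh T.X) ∈ E.deg T.X (n + 1) ↔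
      ∃ w ∈ E.deg T.spW n, QuotientAddGroup.mk w = y := by
  constructor
  · obtain ⟨w, rfl⟩ := QuotientAddGroup.mk_surjective y
    intro h
    -- The connecting map commutes with components, so passing to the component of degree `n`
    -- changes `w` only by an element of its kernel `imSum`.
    refine ⟨E.component _ n w, E.component_mem n w, ?_⟩
    rw [quotientToOdd_mk] at h
    refine QuotientAddGroup.eq.2 ((E.mvConnect_eq_zero_iff T _).1 ?_)
    rw [map_add, map_neg, ← component_mvConnect, E.component_of_mem h, neg_add_cancel]
  · rintro ⟨w, hw, rfl⟩
    exact E.mvConnect_mem T n w hw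

/-- One factor is `δ w`, and the other restricts to zero on `W`. -/
theorem odd_mul_odd (hU : ∀ k : ℤ, E.deg T.spU (2 * k + 1) = ⊥)
    (hV : ∀ k : ℤ, E.deg T.spV (2 * k + 1) = ⊥) (hW : ∀ k : ℤ, E.deg T.spW (2 * k + 1) = ⊥)
    {x y : E.coh T.X} (hx : x ∈ E.odd T.X) (hy : y ∈ E.odd T.X) : x * y = 0 := by
  obtain ⟨w, rfl⟩ := E.exists_mvConnect_of_mem_odd T hU hV hy
  exact E.mul_mvConnect_of_pull_eq_zero T x (E.pull_eq_zero_of_mem_odd hW _ hx) w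

/-- The even part of `x` obeys the formula without sign; the odd part contributes zero to both sides
because it dies on `W`. So linearity holds over all of `E X`. -/
theorem mul_mvConnect_eq (hW : ∀ k : ℤ, E.deg T.spW (2 * k + 1) = ⊥) (x : E.coh T.X)
    (w : E.coh T.spW) : x * E.mvConnect T w = E.mvConnect T (E.pull T.iW x * w) := by
  obtain ⟨y, hy, z, hz, rfl⟩ := E.exists_even_add_odd x
  have h := E.pull_eq_zero_of_mem_odd hW T.iW hz
  rw [add_mul, E.mul_mvConnect_of_even T y hy, E.mul_mvConnect_of_pull_eq_zero T z h, map_add, h,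
    add_zero, add_zero]

end MultCohomology

theorem mainTheorem6 {G : Type u} [Group G] [TopologicalSpace G] [IsTopologicalGroup G]
    (E : MultCohomology.{u, v} G) (T : GCWTriad G)
    (hU : ∀ k : ℤ, E.deg T.spU (2 * k + 1) = ⊥)
    (hV : ∀ k : ℤ, E.deg T.spV (2 * k + 1) = ⊥)
    (hW : ∀ k : ℤ, E.deg T.spW (2 * k + 1) = ⊥) :
    (∃! δ : E.coh T.spW →+ E.coh T.X, E.IsConnecting T δ) ∧
    ∀ δ : E.coh T.spW →+ E.coh T.X, E.IsConnecting T δ →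
      (∃ φ : E.even T.X ≃+* E.fibreProduct T,
        (∀ x : E.even T.X, (φ x : E.coh T.spU × E.coh T.spV) =
          (E.pull T.iU (x : E.coh T.X), E.pull T.iV (x : E.coh T.X))) ∧
        (∀ (n : ℤ) (x : E.even T.X), (x : E.coh T.X) ∈ E.deg T.X n ↔
          (φ x : E.coh T.spU × E.coh T.spV).1 ∈ E.deg T.spU n ∧
          (φ x : E.coh T.spU × E.coh T.spV).2 ∈ E.deg T.spV n)) ∧
      (∃ ψ : (E.coh T.spW ⧸ E.imSum T) ≃+ E.odd T.X,
        (∀ w : E.coh T.spW, (ψ (QuotientAddGroup.mk w) : E.coh T.X) = δ w) ∧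
        (∀ (n : ℤ) (y : E.coh T.spW ⧸ E.imSum T), (ψ y : E.coh T.X) ∈ E.deg T.X (n + 1) ↔
          ∃ w ∈ E.deg T.spW n, QuotientAddGroup.mk w = y) ∧
        (∀ (x : E.coh T.X) (w : E.coh T.spW), w ∈ E.imSum T →
          E.pull T.jU (E.pull T.iU x) * w ∈ E.imSum T) ∧
        (∀ (x : E.coh T.X) (w : E.coh T.spW),
          (ψ (QuotientAddGroup.mk (E.pull T.jU (E.pull T.iU x) * w)) : E.coh T.X) =
            x * (ψ (QuotientAddGroup.mk w) : E.coh T.X))) ∧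
      (∀ x ∈ E.odd T.X, ∀ y ∈ E.odd T.X, x * y = 0) ∧
      (∀ x ∈ E.even T.X, ∀ w : E.coh T.spW,
        x * δ w = δ (E.pull T.jU (E.pull T.iU x) * w)) := by
  refine ⟨E.existsUnique_isConnecting T, fun δ hδ => ?_⟩
  obtain rfl := hδ.eq
  have hφ := E.evenToFibreProduct_bijective T hU hV hW
  have hψ := E.quotientToOdd_bijective T hU hV hW
  refine ⟨⟨RingEquiv.ofBijective (E.evenToFibreProduct T) hφ, fun _ => rfl,
    fun n x => E.mem_deg_iff T hW n x.2⟩,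
    ⟨AddEquiv.ofBijective (E.quotientToOdd T hW) hψ, fun _ => rfl,
      E.quotientToOdd_mem_iff T hW, fun x w hw => ?_, fun x w => ?_⟩,
    fun x hx y hy => E.odd_mul_odd T hU hV hW hx hy, fun x hx w => ?_⟩
  · rw [MultCohomology.pull_jU_pull_iU]
    exact E.mul_mem_imSum T x hw
  · rw [MultCohomology.pull_jU_pull_iU]
    exact (E.mul_mvConnect_eq T hW x w).symm
  · rw [MultCohomology.pull_jU_pull_iU]
    exact E.mul_mvConnect_of_even T x hx w
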